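/- Let $n\in\mathbb N$ and $\hbar>0$. For a tempered distribution $\psi\in\mathcal S'(\mathbb R^m)$ and a window $\phi\in\mathcal S(\mathbb R^m)$, let $$V_\phi\psi(x,\xi)=\int_{\mathbb R^m}e^{-2\pi i\xi\cdot y}\,\psi(y)\,\overline{\phi(y-x)}\,dy$$ (the integral being the distributional bracket) be the short-time Fourier transform, and for $s\ge 0$ let $v_s(x,\xi)=(1+|x|^2+|\xi|^2)^{s/2}$. * For $1\le q\le\infty$, $M^q_s(\mathbb R^n)$ is the space of all $\psi\in\mathcal S'(\mathbb R^n)$ such that $\|\psi\|^{\phi}_{M^q_s}:=\|v_sV_\phi\psi\|_{L^q(\mathbb R^{2n})}<\infty$ for some $\phi\in\mathcal S(\mathbb R^n)\setminus\{0\}$. * $M^{\infty,1}_s(\mathbb R^{2n})$ is the space of all $A\in\mathcal S'(\mathbb R^{2n})$ such that $\|A\|^{\Phi}_{M^{\infty,1}_s}:=\int_{\mathbb R^{2n}}\sup_{z\in\mathbb R^{2n}}|v_s(z,\zeta)V_\Phi A(z,\zeta)|\,d\zeta<\infty$ for some $\Phi\in\mathcal S(\mathbb R^{2n})\setminus\{0\}$.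 * For $A\in\mathcal S'(\mathbb R^{2n})$ the Weyl operator $\widehat A^{\hbar}=A^w(x,-i\hbar\partial_x):\mathcal S(\mathbb R^n)\to\mathcal S'(\mathbb R^n)$ is defined by $\langle\widehat A^{\hbar}\psi,\phi\rangle=\langle A,W(\psi,\overline\phi)\rangle$ (bilinear brackets), where $$W(\psi,\chi)(x,p)=\Big(\frac1{2\pi\hbar}\Big)^{n}\int_{\mathbb R^n}e^{-\frac i\hbar p\cdot y}\,\psi(x+\tfrac12y)\,\overline{\chi(x-\tfrac12y)}\,dy .$$ **(a)** Let $s\ge0$, and fix non-zero windows $\Phi\in\mathcal S(\mathbb R^{2n})$ and $\phi\in\mathcal S(\mathbb R^n)$. There is a constant $C>0$, independent of $q$ and of $A$, such that for every $A\in M^{\infty,1}_s(\mathbb R^{2n})$ and every $q\in[1,\infty]$ the operator $\widehat A^{\hbar}$ is bounded on $M^q_s(\mathbb R^n)$: it extends to a linear map $\widehat A^{\hbar}:M^q_s(\mathbb R^n)\to M^q_s(\mathbb R^n)$ with $$\|\widehat A^{\hbar}\psi\|^{\phi}_{M^q_s}\le C\,\|A\|^{\Phi}_{M^{\infty,1}_s}\,\|\psi\|^{\phi}_{M^q_s}\qquad\text{for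 all }\psi\in M^q_s(\mathbb R^n).$$ Here the extension is the one with the following continuity property: if $(\psi_k)$ is bounded in $M^q_s(\mathbb R^n)$ and $\psi_k\to\psi\in M^q_s(\mathbb R^n)$ in $\mathcal S'(\mathbb R^n)$, then $\widehat A^{\hbar}\psi_k\to\widehat A^{\hbar}\psi$ in $\mathcal S'(\mathbb R^n)$. **(b)** (Calderón–Vaillancourt.) There is a constant $C>0$ such that for every $a\in C^{2n+1}(\mathbb R^{2n};\mathbb C)$ all of whose derivatives of order $0\le k\le 2n+1$ are bounded, $\|D^ka(z)\|\le K$ for all $z$ and $k$, the Weyl operator $\widehat a^{\hbar}$ extends from $\mathcal S(\mathbb R^n)$ to a bounded linear operator on $L^2(\mathbb R^n)$ with norm at most $CK$. -/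

import Mathlib

open MeasureTheory SchwartzMap
open scoped ENNReal NNReal ContDiff

namespace WeylModulation

section Partial

variable {E F : Type} [NormedAddCommGroup E] [InnerProductSpace ℝ E]

theorem char_hasTemperateGrowth (ξ : E) :
    (fun y : E => (Real.fourierChar (-inner ℝ y ξ) : ℂ)).HasTemperateGrowth := by
  set e : E → ℂ := fun y => (Real.fourierChar (-inner ℝ y ξ) : ℂ) with he
  set L : E →L[ℝ] ℂ := (-2 * Real.pi * Complex.I : ℂ) •
    (Complex.ofRealCLM ∘L ((innerSL ℝ).flip ξ)) with hL
  set M : ℂ →L[ℝ] (E →L[ℝ] ℂ) := (ContinuousLinearMap.lsmul ℝ ℂ).flip L with hM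
  have hd : ∀ y, HasFDerivAt e (M (e y)) y := fun y => by
    convert! Real.hasFDerivAt_fourierChar_neg_bilinear_left (innerSL ℝ) y ξ using 1
    ext v
    simp only [hM, hL, he, ContinuousLinearMap.flip_apply, ContinuousLinearMap.lsmul_apply,
      smul_apply, ContinuousLinearMap.comp_apply, smul_eq_mul]
    rw [show ((innerSL ℝ) y) ξ = inner ℝ y ξ from rfl]
    ring
  have hfd : fderiv ℝ e = fun y => M (e y) := funext fun y => (hd y).fderiv
  have hs : ∀ n : ℕ, ContDiff ℝ n e := by
    intro n
    induction n with
    | zero => exact contDiff_zero.2 (continuous_iff_continuousAt.2 fun y => (hd y).continuousAt)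
    | succ n ih =>
      refine (contDiff_succ_iff_fderiv (n := n)).2 ⟨fun y => (hd y).differentiableAt, by simp, ?_⟩
      rw [hfd]
      exact M.contDiff.comp ih
  refine ⟨contDiff_infty.2 hs, fun n => ⟨0, ‖M‖ ^ n, fun y => ?_⟩⟩
  simp only [pow_zero, mul_one]
  induction n with
  | zero => simp only [he, norm_iteratedFDeriv_zero, pow_zero]; exact (Circle.norm_coe _).le
  | succ n ih =>
    rw [← norm_iteratedFDeriv_fderiv, hfd, pow_succ']
    exact (M.norm_iteratedFDeriv_comp_left ((hs n).contDiffAt) le_rfl).trans (by gcongr)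

variable [NormedAddCommGroup F] [NormedSpace ℝ F] [NormedSpace ℂ F] [IsScalarTower ℝ ℂ F]

/-- The derivative of the partial Fourier transform of `G` is the partial Fourier transform of
`partialDeriv G`. -/
noncomputable def partialDeriv : 𝓢(E × E, F) →L[ℂ] 𝓢(E × E, (E × E) →L[ℝ] F) :=
  SchwartzMap.postcompCLM (𝕜 := ℂ)
      (LinearMap.mkContinuous
        { toFun := fun T : (E × E) →L[ℝ] F => T ∘L
            ((ContinuousLinearMap.inl ℝ E E) ∘L (ContinuousLinearMap.fst ℝ E E))
          map_add' := fun _ _ => rfl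
          map_smul' := fun _ _ => rfl }
        ‖(ContinuousLinearMap.inl ℝ E E) ∘L (ContinuousLinearMap.fst ℝ E E)‖
        (fun T => by
          rw [mul_comm]; exact ContinuousLinearMap.opNorm_comp_le _ _)) ∘L
      SchwartzMap.fderivCLM ℂ (E × E) F +
    (-2 * Real.pi * Complex.I : ℂ) • SchwartzMap.smulRightCLM ℂ F
      (((innerSL ℝ (E := E)).bilinearComp (ContinuousLinearMap.snd ℝ E E)
        (ContinuousLinearMap.snd ℝ E E)))

theorem partialDeriv_apply (G : 𝓢(E × E, F)) (w v : E × E) :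
    partialDeriv G w v = fderiv ℝ G w (v.1, 0) +
      (-2 * Real.pi * Complex.I : ℂ) • (inner ℝ w.2 v.2 : ℝ) • G w := by
  simp [partialDeriv]
  rfl

theorem integrand_hasFDerivAt (G : 𝓢(E × E, F)) (y : E) (w : E × E) :
    HasFDerivAt (fun v : E × E => Real.fourierChar (-inner ℝ y v.2) • G (v.1, y))
      (Real.fourierChar (-inner ℝ y w.2) • partialDeriv G (w.1, y)) w := by
  have h1 : HasFDerivAt (fun v : E × E => (Real.fourierChar (-inner ℝ y v.2) : ℂ)) _ w :=
    (Real.hasFDerivAt_fourierChar_neg_bilinear_right (innerSL ℝ) y w.2).comp w hasFDerivAt_snd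
  have h2 : HasFDerivAt (fun v : E × E => G (v.1, y)) _ w :=
    (G.differentiableAt (x := (w.1, y))).hasFDerivAt.comp w
      (hasFDerivAt_fst.prodMk (hasFDerivAt_const y w))
  refine (h1.smul h2).congr_fderiv ?_
  refine ContinuousLinearMap.ext fun v => ?_
  change ((Real.fourierChar (-inner ℝ y w.2) : Circle) : ℂ) • fderiv ℝ G (w.1, y) (v.1, 0) +
    ((-2 * Real.pi * Complex.I * ((Real.fourierChar (-inner ℝ y w.2) : Circle) : ℂ)) *
      ((inner ℝ y v.2 : ℝ) : ℂ)) • G (w.1, y) =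
    ((Real.fourierChar (-inner ℝ y w.2) : Circle) : ℂ) • partialDeriv G (w.1, y) v
  generalize (Real.fourierChar (-inner ℝ y w.2) : Circle) = c
  have e : (inner ℝ y v.2 : ℝ) • G (w.1, y) = ((inner ℝ y v.2 : ℝ) : ℂ) • G (w.1, y) :=
    (algebraMap_smul ℂ (inner ℝ y v.2 : ℝ) (G (w.1, y))).symm
  rw [partialDeriv_apply, smul_add, e, smul_smul, smul_smul]
  congr 2
  ring

variable [FiniteDimensional ℝ E] [MeasurableSpace E] [BorelSpace E]

/-- The Fourier transform in the second variable. -/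
noncomputable def partialFourierFun (G : E × E → F) (z : E × E) : F :=
  ∫ y, Real.fourierChar (-inner ℝ y z.2) • G (z.1, y)

theorem slice_bound (k j : ℕ) : ∃ (s : Finset (ℕ × ℕ)) (C : ℝ), 0 ≤ C ∧
    ∀ (G : 𝓢(E × E, F)) (x : E),
      Integrable (fun y => ‖(x, y)‖ ^ k * ‖iteratedFDeriv ℝ j G (x, y)‖) ∧
      ∫ y, ‖(x, y)‖ ^ k * ‖iteratedFDeriv ℝ j G (x, y)‖ ≤
        C * s.sup (schwartzSeminormFamily ℂ (E × E) F) G := by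
  set N := (volume : Measure E).integrablePower with hN
  refine ⟨Finset.Iic (k + N, j), 2 ^ (k + N) * ∫ y : E, (1 + ‖y‖) ^ (-(N : ℝ)), by positivity,
    fun G x => ?_⟩
  set S := (Finset.Iic (k + N, j)).sup (schwartzSeminormFamily ℂ (E × E) F) G with hS
  have hi := (Measure.integrable_pow_neg_integrablePower (volume : Measure E)).const_mul
    (2 ^ (k + N) * S)
  have hb : ∀ y, ‖(x, y)‖ ^ k * ‖iteratedFDeriv ℝ j G (x, y)‖ ≤
      2 ^ (k + N) * S * (1 + ‖y‖) ^ (-(N : ℝ)) := fun y => by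
    have h := SchwartzMap.one_add_le_sup_seminorm_apply (𝕜 := ℂ) (m := (k + N, j)) le_rfl le_rfl
      G (x, y)
    rw [Real.rpow_neg (by positivity), Real.rpow_natCast, ← div_eq_mul_inv,
      le_div_iff₀ (by positivity)]
    refine le_trans ?_ h
    have h1 : ‖y‖ ≤ ‖(x, y)‖ := le_max_right _ _
    have h2 : ‖(x, y)‖ ≤ 1 + ‖(x, y)‖ := by linarith
    calc _ = ‖(x, y)‖ ^ k * (1 + ‖y‖) ^ N * ‖iteratedFDeriv ℝ j G (x, y)‖ := by ring
      _ ≤ (1 + ‖(x, y)‖) ^ k * (1 + ‖(x, y)‖) ^ N * ‖iteratedFDeriv ℝ j G (x, y)‖ := by gcongr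
      _ = _ := by rw [pow_add]
  have hint : Integrable (fun y => ‖(x, y)‖ ^ k * ‖iteratedFDeriv ℝ j G (x, y)‖) := by
    refine hi.mono' (Continuous.aestronglyMeasurable ?_) (.of_forall fun y => ?_)
    · have := (G.smooth ⊤).continuous_iteratedFDeriv (m := j) (by exact_mod_cast le_top)
      fun_prop
    · rw [Real.norm_of_nonneg (by positivity)]; exact hb y
  refine ⟨hint, (integral_mono hint hi hb).trans (le_of_eq ?_)⟩
  rw [integral_const_mul]; ring


theorem partialFourier_aesm (K : 𝓢(E × E, F)) (w : E × E) :
    AEStronglyMeasurable (fun y => Real.fourierChar (-inner ℝ y w.2) • K (w.1, y)) := by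
  refine Continuous.aestronglyMeasurable ?_
  have := K.continuous
  have h2 : Continuous fun y : E => (Real.fourierChar (-inner ℝ y w.2)) :=
    Real.continuous_fourierChar.comp (by fun_prop)
  exact h2.smul (by fun_prop)

theorem partialFourier_hasFDerivAt (G : 𝓢(E × E, F)) (z : E × E) :
    HasFDerivAt (partialFourierFun G) (partialFourierFun (partialDeriv G) z) z := by
  obtain ⟨s, C, hC, h⟩ := slice_bound (E := E) (F := F) 0 0
  set N := (volume : Measure E).integrablePower with hN
  set S := (Finset.Iic (N, 0)).sup
    (schwartzSeminormFamily ℂ (E × E) ((E × E) →L[ℝ] F)) (partialDeriv G) with hS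
  refine hasFDerivAt_integral_of_dominated_of_fderiv_le (𝕜 := ℝ) (s := Set.univ)
    (F' := fun w y => Real.fourierChar (-inner ℝ y w.2) • partialDeriv G (w.1, y))
    (bound := fun y => 2 ^ N * S * (1 + ‖y‖) ^ (-(N : ℝ)))
    Filter.univ_mem (.of_forall fun w => partialFourier_aesm G w) ?_
    (partialFourier_aesm (partialDeriv G) z) (.of_forall fun y w _ => ?_)
    ((Measure.integrable_pow_neg_integrablePower (volume : Measure E)).const_mul _)
    (.of_forall fun y w _ => integrand_hasFDerivAt G y w)
  · refine (integrable_norm_iff (partialFourier_aesm G z)).1 ?_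
    simpa [Circle.norm_smul] using (h G z.1).1
  · have h := SchwartzMap.one_add_le_sup_seminorm_apply (𝕜 := ℂ) (m := (N, 0)) le_rfl le_rfl
      (partialDeriv G) (w.1, y)
    have hc : ‖Real.fourierChar (-inner ℝ y w.2) • partialDeriv G (w.1, y)‖ ≤
        ‖partialDeriv G (w.1, y)‖ := by
      refine ContinuousLinearMap.opNorm_le_bound _ (by positivity) fun v => ?_
      refine le_trans (le_of_eq ?_) ((partialDeriv G (w.1, y)).le_opNorm v)
      exact Circle.norm_smul (Real.fourierChar (-inner ℝ y w.2)) (partialDeriv G (w.1, y) v)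
    refine hc.trans ?_
    rw [Real.rpow_neg (by positivity), Real.rpow_natCast, ← div_eq_mul_inv,
      le_div_iff₀ (by positivity)]
    refine le_trans ?_ h
    have h1 : ‖y‖ ≤ ‖(w.1, y)‖ := le_max_right _ _
    rw [norm_iteratedFDeriv_zero, mul_comm]
    gcongr

theorem partialFourier_contDiff (n : ℕ) : ∀ {F : Type} [NormedAddCommGroup F] [NormedSpace ℝ F]
    [NormedSpace ℂ F] [IsScalarTower ℝ ℂ F]
    (G : 𝓢(E × E, F)), ContDiff ℝ n (partialFourierFun G) := by
  induction n with
  | zero =>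
    intro F _ _ _ _ G
    exact contDiff_zero.2 (continuous_iff_continuousAt.2 fun z =>
      (partialFourier_hasFDerivAt G z).continuousAt)
  | succ n ih =>
    intro F _ _ _ _ G
    refine (contDiff_succ_iff_fderiv (n := n)).2
      ⟨fun z => (partialFourier_hasFDerivAt G z).differentiableAt, by simp, ?_⟩
    rw [funext fun z => (partialFourier_hasFDerivAt G z).fderiv]
    exact ih (partialDeriv G)

theorem partialFourier_bound_zero (k : ℕ) : ∃ (s : Finset (ℕ × ℕ)) (C : ℝ), 0 ≤ C ∧
    ∀ (G : 𝓢(E × E, F)) (z : E × E), ‖z‖ ^ k * ‖partialFourierFun G z‖ ≤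
      C * s.sup (schwartzSeminormFamily ℂ (E × E) F) G := by
  obtain rfl : ‹NormedSpace ℝ F› = NormedSpace.complexToReal := by
    ext r x
    exact (algebraMap_smul ℂ r x).symm
  choose s C hC h using fun k j => slice_bound (E := E) (F := F) k j
  let t := s k 0 ∪ (Finset.range (k + 1)).biUnion (s 0)
  have hsup : ∀ a b, s a b ⊆ t → ∀ G : 𝓢(E × E, F),
      C a b * (s a b).sup (schwartzSeminormFamily ℂ (E × E) F) G ≤
      C a b * t.sup (schwartzSeminormFamily ℂ (E × E) F) G := fun a b hab G =>
    mul_le_mul_of_nonneg_left (Finset.sup_mono (f := schwartzSeminormFamily ℂ (E × E) F) hab G)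
      (hC a b)
  refine ⟨t, C k 0 + 2 ^ k * ∑ j ∈ Finset.range (k + 1), C 0 j, ?_, fun G z => ?_⟩
  · have := hC k 0
    have := Finset.sum_nonneg fun j (_ : j ∈ Finset.range (k + 1)) => hC 0 j
    positivity
  have hx : ‖z.1‖ ^ k * ‖partialFourierFun G z‖ ≤ C k 0 * t.sup
      (schwartzSeminormFamily ℂ (E × E) F) G := by
    refine le_trans ?_ ((h k 0 G z.1).2.trans (hsup k 0 Finset.subset_union_left G))
    calc ‖z.1‖ ^ k * ‖partialFourierFun G z‖
        ≤ ‖z.1‖ ^ k * ∫ y, ‖G (z.1, y)‖ := by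
          gcongr
          refine (norm_integral_le_integral_norm _).trans (le_of_eq ?_)
          simp only [Circle.norm_smul]
      _ = ∫ y, ‖z.1‖ ^ k * ‖G (z.1, y)‖ := (integral_const_mul _ _).symm
      _ ≤ _ := by
          refine integral_mono_of_nonneg (.of_forall fun y => by positivity) (h k 0 G z.1).1
            (.of_forall fun y => ?_)
          have h1 : ‖z.1‖ ≤ ‖(z.1, y)‖ := le_max_left _ _
          simp only [norm_iteratedFDeriv_zero]
          gcongr
  have hslice : ∀ j y, ‖iteratedFDeriv ℝ j (fun y => G (z.1, y)) y‖ ≤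
      ‖iteratedFDeriv ℝ j G (z.1, y)‖ := fun j y => by
    have e1 : (fun y => G (z.1, y)) =
        (fun w => G ((z.1, 0) + w)) ∘ (ContinuousLinearMap.inr ℝ E E) := by ext; simp
    rw [e1, ContinuousLinearMap.iteratedFDeriv_comp_right _
      (f := fun w => G ((z.1, 0) + w)) (n := ∞)
      ((G.smooth ⊤).comp (contDiff_const.add contDiff_id)) y (by exact_mod_cast le_top),
      iteratedFDeriv_comp_add_left]
    refine (ContinuousMultilinearMap.norm_compContinuousLinearMap_le _ _).trans ?_
    have e2 : ((z.1, 0) + (ContinuousLinearMap.inr ℝ E E) y : E × E) = (z.1, y) := by simp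
    rw [e2]
    refine mul_le_of_le_one_right (norm_nonneg _) (Finset.prod_le_one (fun _ _ => norm_nonneg _)
      fun _ _ => ContinuousLinearMap.norm_inr_le_one ℝ E E)
  have hsm : ContDiff ℝ ∞ (fun y => G (z.1, y)) :=
    (G.smooth ⊤).comp (contDiff_const.prodMk contDiff_id)
  have hcont : ∀ a b : ℕ, Continuous fun y =>
      ‖y‖ ^ a * ‖iteratedFDeriv ℝ b (fun y => G (z.1, y)) y‖ := by
    intro a b
    have := hsm.continuous_iteratedFDeriv (m := b) (by exact_mod_cast le_top)
    fun_prop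
  have hle : ∀ (a b : ℕ) y, ‖y‖ ^ a * ‖iteratedFDeriv ℝ b (fun y => G (z.1, y)) y‖ ≤
      ‖(z.1, y)‖ ^ a * ‖iteratedFDeriv ℝ b G (z.1, y)‖ := fun a b y => by
    have h1 : ‖y‖ ≤ ‖(z.1, y)‖ := le_max_right _ _
    have := hslice b y
    gcongr
  have hp : ‖z.2‖ ^ k * ‖partialFourierFun G z‖ ≤ (2 ^ k * ∑ j ∈ Finset.range (k + 1), C 0 j) *
      t.sup (schwartzSeminormFamily ℂ (E × E) F) G := by
    have := Real.pow_mul_norm_iteratedFDeriv_fourier_le (K := ⊤) (N := ⊤) hsm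
      (fun a b _ _ => (h a b G z.1).1.mono' (hcont a b).aestronglyMeasurable
        (.of_forall fun y => by rw [Real.norm_of_nonneg (by positivity)]; exact hle a b y))
      (k := 0) (n := k) le_top le_top z.2
    rw [norm_iteratedFDeriv_zero, Real.fourier_eq] at this
    refine this.trans ?_
    rw [pow_zero, one_mul, mul_assoc, Finset.sum_mul]
    simp only [zero_add, Finset.range_one, Finset.singleton_product, Finset.sum_map,
      Function.Embedding.coeFn_mk]
    norm_num
    refine Finset.sum_le_sum fun j hj => ?_
    refine le_trans ?_ ((h 0 j G z.1).2.trans (hsup 0 j ?_ G))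
    · refine integral_mono_of_nonneg (.of_forall fun y => by positivity) (h 0 j G z.1).1
        (.of_forall fun y => ?_)
      simpa using hle 0 j y
    · exact (Finset.subset_biUnion_of_mem (s 0) hj).trans Finset.subset_union_right
  rw [add_mul]
  rcases le_total ‖z.1‖ ‖z.2‖ with hz | hz
  · rw [Prod.norm_def, max_eq_right hz]
    have := mul_nonneg (pow_nonneg (norm_nonneg z.1) k) (norm_nonneg (partialFourierFun G z))
    linarith
  · rw [Prod.norm_def, max_eq_left hz]
    have := mul_nonneg (pow_nonneg (norm_nonneg z.2) k) (norm_nonneg (partialFourierFun G z))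
    linarith

theorem partialFourier_bound (k n : ℕ) : ∀ {F : Type} [NormedAddCommGroup F] [NormedSpace ℝ F]
    [NormedSpace ℂ F] [IsScalarTower ℝ ℂ F],
    ∃ (s : Finset (ℕ × ℕ)) (C : ℝ), 0 ≤ C ∧
    ∀ (G : 𝓢(E × E, F)) (z : E × E), ‖z‖ ^ k * ‖iteratedFDeriv ℝ n (partialFourierFun G) z‖ ≤
      C * s.sup (schwartzSeminormFamily ℂ (E × E) F) G := by
  induction n with
  | zero =>
    intro F _ _ _ _
    simpa only [norm_iteratedFDeriv_zero] using partialFourier_bound_zero (E := E) (F := F) k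
  | succ n ih =>
    intro F _ _ _ _
    obtain ⟨s, C, hC, h⟩ := ih (F := (E × E) →L[ℝ] F)
    let q : Seminorm ℂ 𝓢(E × E, F) := (s.sup (schwartzSeminormFamily ℂ (E × E)
      ((E × E) →L[ℝ] F))).comp (partialDeriv (E := E) (F := F)).toLinearMap
    have hq : Continuous q := by
      have := Seminorm.continuous_finsetSup (p := schwartzSeminormFamily ℂ (E × E)
        ((E × E) →L[ℝ] F)) (s := s) fun i _ =>
        (schwartz_withSeminorms ℂ (E × E) ((E × E) →L[ℝ] F)).continuous_seminorm i
      exact this.comp (partialDeriv (E := E) (F := F)).continuous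
    obtain ⟨t, D, -, hD⟩ := Seminorm.bound_of_continuous (schwartz_withSeminorms ℂ (E × E) F) q hq
    refine ⟨t, C * D, by positivity, fun G z => ?_⟩
    rw [← norm_iteratedFDeriv_fderiv, funext fun z => (partialFourier_hasFDerivAt G z).fderiv,
      mul_assoc]
    exact (h (partialDeriv G) z).trans (mul_le_mul_of_nonneg_left (hD G) hC)


theorem partialFourier_integrable (G : 𝓢(E × E, F)) (z : E × E) :
    Integrable (fun y => Real.fourierChar (-inner ℝ y z.2) • G (z.1, y)) := by
  obtain ⟨s, C, hC, h⟩ := slice_bound (E := E) (F := F) 0 0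
  refine (integrable_norm_iff (partialFourier_aesm G z)).1 ?_
  simpa [Circle.norm_smul] using (h G z.1).1

/-- The Fourier transform in the second variable, on Schwartz functions. -/
noncomputable def partialFourier : 𝓢(E × E, ℂ) →L[ℂ] 𝓢(E × E, ℂ) :=
  SchwartzMap.mkCLM (𝕜 := ℂ) (𝕜' := ℂ) (σ := RingHom.id ℂ) (fun G => partialFourierFun G)
    (fun G H z => by
      simp only [partialFourierFun]
      rw [← integral_add (partialFourier_integrable G z) (partialFourier_integrable H z)]
      simp)
    (fun a G z => by
      simp only [partialFourierFun, RingHom.id_apply]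
      rw [← integral_smul]
      congr 1
      ext y
      rw [smul_apply, smul_comm])
    (fun G => contDiff_infty.2 fun n => partialFourier_contDiff n G)
    (fun m => partialFourier_bound m.1 m.2)

theorem partialFourier_apply (G : 𝓢(E × E, ℂ)) (z : E × E) :
    partialFourier G z = ∫ y, Real.fourierChar (-inner ℝ y z.2) • G (z.1, y) := rfl

end Partial

section Tensor

variable {E : Type} [NormedAddCommGroup E] [NormedSpace ℝ E]

theorem norm_iteratedFDeriv_comp_linear_le {D : Type} [NormedAddCommGroup D] [NormedSpace ℝ D]
    (f : 𝓢(E, ℂ)) (L : D →L[ℝ] E) (hL : ‖L‖ ≤ 1) (j : ℕ) (z : D) :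
    ‖iteratedFDeriv ℝ j (fun w => f (L w)) z‖ ≤ ‖iteratedFDeriv ℝ j f (L z)‖ := by
  have h := L.iteratedFDeriv_comp_right (f.smooth ⊤) z (i := j) (by exact_mod_cast le_top)
  change ‖iteratedFDeriv ℝ j (f ∘ L) z‖ ≤ _
  rw [h]
  refine (ContinuousMultilinearMap.norm_compContinuousLinearMap_le _ _).trans ?_
  exact mul_le_of_le_one_right (norm_nonneg _) (Finset.prod_le_one (fun _ _ => norm_nonneg _)
    fun _ _ => hL)

/-- The tensor product `(u, v) ↦ ψ u * φ v` of two Schwartz functions, continuous in `φ`. -/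
noncomputable def tensor (ψ : 𝓢(E, ℂ)) : 𝓢(E, ℂ) →L[ℂ] 𝓢(E × E, ℂ) :=
  SchwartzMap.mkCLM (𝕜 := ℂ) (𝕜' := ℂ) (σ := RingHom.id ℂ) (fun φ z => ψ z.1 * φ z.2)
    (fun φ χ z => by simp [mul_add])
    (fun a φ z => by simp; ring)
    (fun φ => ((ψ.smooth ⊤).comp contDiff_fst).mul ((φ.smooth ⊤).comp contDiff_snd))
    (fun ⟨k, l⟩ => by
      set S := (Finset.Iic (k, l)).sup (schwartzSeminormFamily ℂ E ℂ) with hS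
      refine ⟨Finset.Iic (k, l), ∑ i ∈ Finset.range (l + 1), (l.choose i : ℝ) *
        (2 ^ k * S ψ) * 2 ^ k, by positivity, fun φ z => ?_⟩
      have hz : ‖z‖ ≤ (1 + ‖z.1‖) * (1 + ‖z.2‖) := by
        have h1 := norm_nonneg z.1
        have h2 := norm_nonneg z.2
        rw [Prod.norm_def]
        refine max_le ?_ ?_ <;> nlinarith
      have h := norm_iteratedFDeriv_mul_le (N := ∞) (n := l)
        ((ψ.smooth ⊤).comp (contDiff_fst (E := E) (F := E)))
        ((φ.smooth ⊤).comp (contDiff_snd (E := E) (F := E))) z (by exact_mod_cast le_top)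
      refine (mul_le_mul_of_nonneg_left h (by positivity)).trans ?_
      rw [Finset.mul_sum, Finset.sum_mul]
      refine Finset.sum_le_sum fun i hi => ?_
      have hi' : i ≤ l := Nat.lt_succ_iff.1 (Finset.mem_range.1 hi)
      have a1 := norm_iteratedFDeriv_comp_linear_le ψ (ContinuousLinearMap.fst ℝ E E)
        (ContinuousLinearMap.norm_fst_le ℝ E E) i z
      have a2 := norm_iteratedFDeriv_comp_linear_le φ (ContinuousLinearMap.snd ℝ E E)
        (ContinuousLinearMap.norm_snd_le ℝ E E) (l - i) z
      have b1 := SchwartzMap.one_add_le_sup_seminorm_apply (𝕜 := ℂ) (m := (k, l)) le_rfl hi' ψ z.1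
      have b2 := SchwartzMap.one_add_le_sup_seminorm_apply (𝕜 := ℂ) (m := (k, l)) le_rfl
        (Nat.sub_le l i) φ z.2
      change _ ≤ (2 : ℝ) ^ k * S ψ at b1
      change _ ≤ (2 : ℝ) ^ k * S φ at b2
      calc ‖z‖ ^ k * ((l.choose i : ℝ) * ‖iteratedFDeriv ℝ i (fun w : E × E => ψ w.1) z‖ *
            ‖iteratedFDeriv ℝ (l - i) (fun w : E × E => φ w.2) z‖)
          ≤ ((1 + ‖z.1‖) * (1 + ‖z.2‖)) ^ k * ((l.choose i : ℝ) *
            ‖iteratedFDeriv ℝ i ψ z.1‖ * ‖iteratedFDeriv ℝ (l - i) φ z.2‖) := by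
            gcongr
            · exact a1
            · exact a2
        _ = (l.choose i : ℝ) * ((1 + ‖z.1‖) ^ k * ‖iteratedFDeriv ℝ i ψ z.1‖) *
            ((1 + ‖z.2‖) ^ k * ‖iteratedFDeriv ℝ (l - i) φ z.2‖) := by rw [mul_pow]; ring
        _ ≤ (l.choose i : ℝ) * (2 ^ k * S ψ) * (2 ^ k * S φ) := by gcongr
        _ = _ := by ring)

/-- The change of variables `(x, y) ↦ (x + y / 2, x - y / 2)`. -/
noncomputable def midpointEquiv : (E × E) ≃L[ℝ] E × E :=
  ContinuousLinearEquiv.equivOfInverse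
    ((ContinuousLinearMap.fst ℝ E E + (2⁻¹ : ℝ) • ContinuousLinearMap.snd ℝ E E).prod
      (ContinuousLinearMap.fst ℝ E E - (2⁻¹ : ℝ) • ContinuousLinearMap.snd ℝ E E))
    (((2⁻¹ : ℝ) • (ContinuousLinearMap.fst ℝ E E + ContinuousLinearMap.snd ℝ E E)).prod
      (ContinuousLinearMap.fst ℝ E E - ContinuousLinearMap.snd ℝ E E))
    (fun z => by ext <;> simp <;> module)
    (fun z => by ext <;> simp <;> module)

end Tensor

/-- Euclidean space `ℝⁿ`. -/
abbrev Rn (n : ℕ) : Type := EuclideanSpace ℝ (Fin n)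

/-- Phase space `ℝ²ⁿ = ℝⁿ × ℝⁿ` with points `z = (x, p)`, Euclidean norm and Lebesgue measure. -/
abbrev Phase (n : ℕ) : Type := WithLp 2 (Rn n × Rn n)

section Weyl

variable {n : ℕ}

/-- The change of variables `(x, p) ↦ (x, p / (2πħ))`. -/
noncomputable def momentumScaling (ħ : ℝ) (hħ : 0 < ħ) : Phase n ≃L[ℝ] Rn n × Rn n :=
  (WithLp.prodContinuousLinearEquiv 2 ℝ (Rn n) (Rn n)).trans
    ((ContinuousLinearEquiv.refl ℝ (Rn n)).prodCongr
      (ContinuousLinearEquiv.smulLeft (Units.mk0 (2 * Real.pi * ħ)⁻¹ (by positivity))))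

/-- The cross-Wigner function `W(ψ, φ̄)` as a Schwartz function on phase space; it is linear and
continuous in `φ`. Its explicit formula is `wigner_apply`. -/
noncomputable def wigner (ħ : ℝ) (hħ : 0 < ħ) (ψ : 𝓢(Rn n, ℂ)) :
    𝓢(Rn n, ℂ) →L[ℂ] 𝓢(Phase n, ℂ) :=
  ((1 / (2 * Real.pi * ħ) : ℂ) ^ n) •
    (SchwartzMap.compCLMOfContinuousLinearEquiv ℂ (momentumScaling ħ hħ) ∘L partialFourier ∘L
      SchwartzMap.compCLMOfContinuousLinearEquiv ℂ midpointEquiv ∘L tensor ψ)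

theorem wigner_apply (ħ : ℝ) (hħ : 0 < ħ) (ψ φ : 𝓢(Rn n, ℂ)) (z : Phase n) :
    wigner ħ hħ ψ φ z = (1 / (2 * Real.pi * ħ) : ℂ) ^ n *
      ∫ y : Rn n, Complex.exp (-(Complex.I / ħ) * (inner ℝ z.snd y : ℝ)) *
        (ψ (z.fst + (2⁻¹ : ℝ) • y) * φ (z.fst - (2⁻¹ : ℝ) • y)) := by
  have hπ : (Real.pi : ℂ) ≠ 0 := by exact_mod_cast Real.pi_ne_zero
  have hc : (ħ : ℂ) ≠ 0 := by exact_mod_cast hħ.ne'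
  change (1 / (2 * Real.pi * ħ) : ℂ) ^ n * (∫ y : Rn n,
    Real.fourierChar (-inner ℝ y ((2 * Real.pi * ħ)⁻¹ • z.snd)) •
        (ψ (z.fst + (2⁻¹ : ℝ) • y) * φ (z.fst - (2⁻¹ : ℝ) • y))) = _
  congr 2
  ext y
  rw [Circle.smul_def, Real.fourierChar_apply, smul_eq_mul, real_inner_smul_right,
    real_inner_comm]
  congr 2
  push_cast
  field_simp

/-- The Weyl operator `A^w(x, -iħ∂ₓ) : 𝓢(ℝⁿ) → 𝓢'(ℝⁿ)` with symbol `A ∈ 𝓢'(ℝ²ⁿ)`, given by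
`⟨A^w ψ, φ⟩ = ⟨A, W(ψ, φ̄)⟩` with bilinear brackets; for an integrable symbol this reads
`(A^w ψ)(x) = (2πħ)⁻ⁿ ∬ exp(i p·(x - y) / ħ) A((x + y) / 2, p) ψ(y) dy dp`. -/
noncomputable def weylOp (ħ : ℝ) (hħ : 0 < ħ) (A : 𝓢'(Phase n, ℂ)) (ψ : 𝓢(Rn n, ℂ)) :
    𝓢'(Rn n, ℂ) :=
  PointwiseConvergenceCLM.precomp ℂ (wigner ħ hħ ψ) A

theorem weylOp_apply (ħ : ℝ) (hħ : 0 < ħ) (A : 𝓢'(Phase n, ℂ)) (ψ φ : 𝓢(Rn n, ℂ)) :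
    weylOp ħ hħ A ψ φ = A (wigner ħ hħ ψ φ) := rfl

end Weyl

section Modulation

variable {V : Type} [NormedAddCommGroup V] [InnerProductSpace ℝ V]

/-- The time-frequency shifted window `y ↦ exp(-2πi ξ·y) * conj (φ (y - x))`. -/
noncomputable def window (φ : 𝓢(V, ℂ)) (x ξ : V) : 𝓢(V, ℂ) :=
  SchwartzMap.smulLeftCLM ℂ (fun y : V => (Real.fourierChar (-inner ℝ y ξ) : ℂ))
    (SchwartzMap.compSubConstCLM ℂ x
      (SchwartzMap.postcompCLM (𝕜 := ℝ) (Complex.conjCLE : ℂ →L[ℝ] ℂ) φ))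

theorem window_apply (φ : 𝓢(V, ℂ)) (x ξ y : V) :
    window φ x ξ y = Complex.exp (-(2 * Real.pi * Complex.I) * (inner ℝ ξ y : ℝ)) *
      (starRingEnd ℂ) (φ (y - x)) := by
  rw [window, SchwartzMap.smulLeftCLM_apply_apply (char_hasTemperateGrowth ξ),
    SchwartzMap.compSubConstCLM_apply, SchwartzMap.postcompCLM_apply, Real.fourierChar_apply,
    smul_eq_mul, real_inner_comm]
  change _ * (starRingEnd ℂ) (φ (y - x)) = _
  congr 2
  push_cast
  ring

/-- The short-time Fourier transform `V_φ ψ (x, ξ) = ∫ exp(-2πi ξ·y) ψ(y) conj (φ (y - x)) dy`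
of the tempered distribution `ψ` with window `φ`. -/
noncomputable def stft (φ : 𝓢(V, ℂ)) (ψ : 𝓢'(V, ℂ)) (x ξ : V) : ℂ :=
  ψ (window φ x ξ)

/-- The weight `(1 + |x|² + |ξ|²)^(s/2)`. -/
noncomputable def weight (s : ℝ) (x ξ : V) : ℝ :=
  (1 + ‖x‖ ^ 2 + ‖ξ‖ ^ 2) ^ (s / 2)

variable [FiniteDimensional ℝ V] [MeasurableSpace V] [BorelSpace V]

/-- The weighted short-time Fourier transform, as a function on `V × V`. -/
noncomputable def weightedStft (s : ℝ) (φ : 𝓢(V, ℂ)) (ψ : 𝓢'(V, ℂ)) (z : V × V) : ℂ :=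
  (weight s z.1 z.2 : ℂ) * stft φ ψ z.1 z.2

/-- The norm `‖ψ‖_{M_s^q}` relative to the window `φ`. -/
noncomputable def modNorm (s : ℝ) (q : ℝ≥0∞) (φ : 𝓢(V, ℂ)) (ψ : 𝓢'(V, ℂ)) : ℝ≥0∞ :=
  eLpNorm (weightedStft s φ ψ) q volume

/-- Membership in the modulation space `M_s^q`. -/
def MemMod (s : ℝ) (q : ℝ≥0∞) (ψ : 𝓢'(V, ℂ)) : Prop :=
  ∃ φ : 𝓢(V, ℂ), φ ≠ 0 ∧ MemLp (weightedStft s φ ψ) q volume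

/-- The norm `‖A‖_{M_s^{∞,1}}` relative to the window `Φ`. -/
noncomputable def symbolNorm (s : ℝ) (Φ : 𝓢(V, ℂ)) (A : 𝓢'(V, ℂ)) : ℝ≥0∞ :=
  ∫⁻ ζ, ⨆ z, ‖weightedStft s Φ A (z, ζ)‖ₑ

/-- Membership in the weighted Sjöstrand class `M_s^{∞,1}`. -/
def MemSymbol (s : ℝ) (A : 𝓢'(V, ℂ)) : Prop :=
  ∃ Φ : 𝓢(V, ℂ), Φ ≠ 0 ∧ symbolNorm s Φ A < ⊤

end Modulation

/-- `T` is the Weyl operator with symbol `A` acting on `M_s^q(ℝⁿ)`: a linear map of `M_s^q` into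
itself which agrees with `A^w` on Schwartz functions and which maps sequences that are bounded in
`M_s^q` and converge in `𝓢'` to sequences that converge in `𝓢'`, to the image of the limit.
As every element of `M_s^q` is the limit in `𝓢'` of a sequence of Schwartz functions that is
bounded in `M_s^q`, there is at most one such `T`. (For `q < ∞` Schwartz functions are even
dense in norm; for `q = ∞` they are not.) -/
structure IsWeylOperatorOn {n : ℕ} (ħ : ℝ) (hħ : 0 < ħ) (A : 𝓢'(Phase n, ℂ)) (s : ℝ) (q : ℝ≥0∞)
    (T : 𝓢'(Rn n, ℂ) →ₗ.[ℂ] 𝓢'(Rn n, ℂ)) : Prop where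
  mem_domain_iff : ∀ ψ, ψ ∈ T.domain ↔ MemMod s q ψ
  mapsTo : ∀ ψ : T.domain, MemMod s q (T ψ)
  eq_weylOp : ∀ f : 𝓢(Rn n, ℂ), ∃ h : (f : 𝓢'(Rn n, ℂ)) ∈ T.domain,
    T ⟨(f : 𝓢'(Rn n, ℂ)), h⟩ = weylOp ħ hħ A f
  tendsto : ∀ φ : 𝓢(Rn n, ℂ), φ ≠ 0 → ∀ (R : ℝ≥0) (u : ℕ → T.domain) (v : T.domain),
    (∀ k, modNorm s q φ (u k : 𝓢'(Rn n, ℂ)) ≤ R) →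
    Filter.Tendsto (fun k => (u k : 𝓢'(Rn n, ℂ))) Filter.atTop (nhds (v : 𝓢'(Rn n, ℂ))) →
    Filter.Tendsto (fun k => T (u k)) Filter.atTop (nhds (T v))

end WeylModulation

open WeylModulation

open MeasureTheory SchwartzMap
open scoped ENNReal NNReal ContDiff FourierTransform BoundedContinuousFunction

namespace WeylModulation

/-! ### Families of Schwartz functions depending smoothly on a parameter -/

section Family

variable {U V : Type} [NormedAddCommGroup U] [NormedSpace ℝ U]
  [NormedAddCommGroup V] [NormedSpace ℝ V]

/-! Write `shift h z` for the time-frequency shift of `h` by a phase space point `z`. Schwartz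
functions are superpositions of such atoms: the coefficients `coef h φ z`, the inner products of `φ`
with `shift h z`, satisfy `∫ coef h φ z • shift h z = energy h • φ`. The integral converges
absolutely in every Schwartz seminorm, so a tempered distribution may be applied under it
(`apply_eq_integral`, `integral_coef_mul_apply_shift`). The rest of the argument studies operators
through their matrices in this continuous frame.

Changing the window is convolution with the integrable function `coef h g`, because the coefficient
of one atom against another depends, in modulus, only on the difference of their positions
(`coef_shift`). Weights are submultiplicative up to a constant, so they pass through the
convolution. Young's inequality then shows that both kinds of modulation space are independent of
the window (`modNorm_le`, `symbolNorm_le`).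

For the Weyl operator the key is covariance: the Wigner function of two shifted windows is, up to a
unimodular factor, a shift of the Wigner function of the windows (`wigner_shift`). Hence the matrix
entry between atoms at `z` and `w` is, up to a phase, the short-time Fourier transform of the symbol
at a rescaled midpoint of `z` and `w`, with frequency a linear image of `w - z` (`weylKernel_eq`).
Taking the supremum over the midpoint dominates the matrix by a function of `w - z`, and the norm of
the symbol in the Sjöstrand class is, up to constants, the integral of that function. Young's
inequality bounds the operator on every weighted `L^q` with one constant for all `q`. The extended
operator rebuilds a distribution from the transformed coefficients (`synthesis`); its sequential
continuity is dominated convergence, applied first to the matrix integral and then to the synthesis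
integral.

For part (b), integration by parts shows that the transform of a symbol with `2n + 1` bounded
derivatives is `O((1 + |ζ|)^(-(2n+1)))` uniformly in position, which is integrable over a space of
dimension `2n`; so the symbol lies in the unweighted class. Plancherel for the coefficients
identifies the case `s = 0`, `q = 2` with `L²` on Schwartz functions. Cauchy–Schwarz in phase space
bounds the form `⟨A^w f, φ⟩` in `L²`, and Riesz representation turns the form into an operator. -/

theorem iteratedFDeriv_slice {G : U × V → ℂ} (hG : ContDiff ℝ ∞ G) (l : ℕ) (z : U) (y : V) :
    iteratedFDeriv ℝ l (fun y => G (z, y)) y =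
      (iteratedFDeriv ℝ l G (z, y)).compContinuousLinearMap
        fun _ => ContinuousLinearMap.inr ℝ U V := by
  have e1 : (fun y => G (z, y)) =
      (fun w => G ((z, 0) + w)) ∘ (ContinuousLinearMap.inr ℝ U V) := by ext; simp
  rw [e1, ContinuousLinearMap.iteratedFDeriv_comp_right _
    (f := fun w => G ((z, 0) + w)) (n := ∞)
    (hG.comp (contDiff_const.add contDiff_id)) y (by exact_mod_cast le_top),
    iteratedFDeriv_comp_add_left]
  simp

theorem norm_compContinuousLinearMap_inr_le {l : ℕ}
    (T : ContinuousMultilinearMap ℝ (fun _ : Fin l => U × V) ℂ) :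
    ‖T.compContinuousLinearMap fun _ => ContinuousLinearMap.inr ℝ U V‖ ≤ ‖T‖ := by
  refine (ContinuousMultilinearMap.norm_compContinuousLinearMap_le _ _).trans ?_
  exact mul_le_of_le_one_right (norm_nonneg _) (Finset.prod_le_one (fun _ _ => norm_nonneg _)
    fun _ _ => ContinuousLinearMap.norm_inr_le_one ℝ U V)

theorem seminorm_slice_le {G : U × V → ℂ} (hG : ContDiff ℝ ∞ G) {w : U → 𝓢(V, ℂ)}
    (hw : ∀ z y, w z y = G (z, y)) {k l N : ℕ} {C : ℝ} (hC : 0 ≤ C)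
    (h : ∀ z y, ‖y‖ ^ k * ‖iteratedFDeriv ℝ l G (z, y)‖ ≤ C * (1 + ‖z‖) ^ N) (z : U) :
    SchwartzMap.seminorm ℂ k l (w z) ≤ C * (1 + ‖z‖) ^ N := by
  refine SchwartzMap.seminorm_le_bound ℂ k l _ (by positivity) fun y => ?_
  rw [show ⇑(w z) = fun y => G (z, y) from funext (hw z), iteratedFDeriv_slice hG]
  refine le_trans ?_ (h z y)
  gcongr
  exact norm_compContinuousLinearMap_inr_le _

/-- The mean value inequality in the parameter: the increment of an `l`-th derivative in `y` is
controlled by derivatives of order `l + 1` of `G`, which are bounded after multiplication by `‖y‖ ^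
k`, locally uniformly in the parameter. -/
theorem continuous_slice {G : U × V → ℂ} (hG : ContDiff ℝ ∞ G) {w : U → 𝓢(V, ℂ)}
    (hw : ∀ z y, w z y = G (z, y))
    (h : ∀ k l : ℕ, ∃ (N : ℕ) (C : ℝ), 0 ≤ C ∧
      ∀ z y, ‖y‖ ^ k * ‖iteratedFDeriv ℝ l G (z, y)‖ ≤ C * (1 + ‖z‖) ^ N) :
    Continuous w := by
  refine continuous_iff_continuousAt.2 fun z₀ => ?_
  refine ((schwartz_withSeminorms ℂ V ℂ).tendsto_nhds _ _).2 ?_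
  rintro ⟨k, l⟩ ε hε
  obtain ⟨N, C, hC, hb⟩ := h k (l + 1)
  have key : ∀ z ∈ Metric.ball z₀ 1,
      SchwartzMap.seminorm ℂ k l (w z - w z₀) ≤ C * (2 + ‖z₀‖) ^ N * ‖z - z₀‖ := by
    intro z hz
    refine SchwartzMap.seminorm_le_bound ℂ k l _ (by positivity) fun y => ?_
    have e : iteratedFDeriv ℝ l (w z - w z₀) y =
        (iteratedFDeriv ℝ l G (z, y) - iteratedFDeriv ℝ l G (z₀, y)).compContinuousLinearMap
          fun _ => ContinuousLinearMap.inr ℝ U V := by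
      have h1 : ⇑(w z - w z₀) = (fun y => G (z, y)) - fun y => G (z₀, y) := by
        ext y; simp [hw]
      have hs : ∀ z, ContDiff ℝ ∞ fun y => G (z, y) :=
        fun z => hG.comp (contDiff_const.prodMk contDiff_id)
      rw [h1, iteratedFDeriv_sub_apply ((hs z).of_le (by exact_mod_cast le_top)).contDiffAt
        ((hs z₀).of_le (by exact_mod_cast le_top)).contDiffAt, iteratedFDeriv_slice hG,
        iteratedFDeriv_slice hG]
      rfl
    rw [e]
    refine (mul_le_mul_of_nonneg_left (norm_compContinuousLinearMap_inr_le _)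
      (by positivity)).trans ?_
    have hd : ∀ z' ∈ Metric.ball z₀ 1, HasFDerivWithinAt
        (fun z' => (‖y‖ ^ k : ℝ) • iteratedFDeriv ℝ l G (z', y))
        ((‖y‖ ^ k : ℝ) • (fderiv ℝ (iteratedFDeriv ℝ l G) (z', y)) ∘L
          ContinuousLinearMap.inl ℝ U V) (Metric.ball z₀ 1) z' := by
      intro z' _
      refine HasFDerivAt.hasFDerivWithinAt ?_
      have h1 : HasFDerivAt (iteratedFDeriv ℝ l G) (fderiv ℝ (iteratedFDeriv ℝ l G) (z', y))
          (z', y) := ((hG.differentiable_iteratedFDeriv (m := l)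
            (by exact_mod_cast WithTop.coe_lt_top _)).differentiableAt).hasFDerivAt
      have h2 := HasFDerivAt.comp (f := fun e : U => (e, y)) z' h1 (hasFDerivAt_prodMk_left z' y)
      exact h2.const_smul (‖y‖ ^ k : ℝ)
    have := (convex_ball z₀ 1).norm_image_sub_le_of_norm_hasFDerivWithin_le hd
      (C := C * (2 + ‖z₀‖) ^ N) (fun z' hz' => ?_) (Metric.mem_ball_self one_pos) hz
    · rwa [← smul_sub, norm_smul, Real.norm_of_nonneg (by positivity)] at this
    · rw [norm_smul, Real.norm_of_nonneg (by positivity)]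
      have h1 : ‖(fderiv ℝ (iteratedFDeriv ℝ l G) (z', y)) ∘L ContinuousLinearMap.inl ℝ U V‖ ≤
          ‖iteratedFDeriv ℝ (l + 1) G (z', y)‖ := by
        rw [← norm_fderiv_iteratedFDeriv]
        refine (ContinuousLinearMap.opNorm_comp_le _ _).trans ?_
        exact mul_le_of_le_one_right (norm_nonneg _) (ContinuousLinearMap.norm_inl_le_one ℝ U V)
      refine (mul_le_mul_of_nonneg_left h1 (by positivity)).trans ((hb z' y).trans ?_)
      have h2 : ‖z'‖ ≤ 1 + ‖z₀‖ := by
        have := norm_le_norm_add_norm_sub z₀ z'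
        rw [Metric.mem_ball, dist_eq_norm, norm_sub_rev] at hz'
        linarith
      exact mul_le_mul_of_nonneg_left (pow_le_pow_left₀ (by positivity) (by linarith) N) hC
  have hlim : Filter.Tendsto (fun z => C * (2 + ‖z₀‖) ^ N * ‖z - z₀‖) (nhds z₀) (nhds 0) := by
    have : Continuous fun z => C * (2 + ‖z₀‖) ^ N * ‖z - z₀‖ := by fun_prop
    simpa using this.tendsto z₀
  filter_upwards [Metric.ball_mem_nhds z₀ one_pos, hlim.eventually_lt_const hε] with z hz h2
  exact (key z hz).trans_lt h2

end Family

/-! ### Time-frequency shifts as a continuous family -/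

section Shift

variable {V : Type} [NormedAddCommGroup V] [InnerProductSpace ℝ V]

/-- The time-frequency shift `y ↦ exp(-2πi ξ·y) h (y - x)`. -/
noncomputable def shift (h : 𝓢(V, ℂ)) (x ξ : V) : 𝓢(V, ℂ) :=
  SchwartzMap.smulLeftCLM ℂ (fun y : V => (Real.fourierChar (-inner ℝ y ξ) : ℂ))
    (SchwartzMap.compSubConstCLM ℂ x h)

/-- The complex conjugate of a Schwartz function. -/
noncomputable def conjS (h : 𝓢(V, ℂ)) : 𝓢(V, ℂ) :=
  SchwartzMap.postcompCLM (𝕜 := ℝ) (Complex.conjCLE : ℂ →L[ℝ] ℂ) h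

@[simp]
theorem conjS_apply (h : 𝓢(V, ℂ)) (y : V) : conjS h y = (starRingEnd ℂ) (h y) := rfl

@[simp]
theorem conjS_conjS (h : 𝓢(V, ℂ)) : conjS (conjS h) = h := by ext; simp

theorem conjS_ne_zero {h : 𝓢(V, ℂ)} (hh : h ≠ 0) : conjS h ≠ 0 := fun e => hh <| by
  rw [← conjS_conjS h, e]; ext; simp

theorem window_eq_shift (φ : 𝓢(V, ℂ)) (x ξ : V) : window φ x ξ = shift (conjS φ) x ξ := rfl

theorem shift_apply (h : 𝓢(V, ℂ)) (x ξ y : V) :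
    shift h x ξ y = (Real.fourierChar (-inner ℝ y ξ) : ℂ) * h (y - x) := by
  rw [shift, SchwartzMap.smulLeftCLM_apply_apply (char_hasTemperateGrowth ξ),
    SchwartzMap.compSubConstCLM_apply, smul_eq_mul]

theorem conj_fourierChar (t : ℝ) : (starRingEnd ℂ) (Real.fourierChar t : ℂ) =
    (Real.fourierChar (-t) : ℂ) := by
  rw [AddChar.map_neg_eq_inv, Circle.coe_inv_eq_conj]

theorem fourierChar_add (s t : ℝ) : (Real.fourierChar (s + t) : ℂ) =
    (Real.fourierChar s : ℂ) * (Real.fourierChar t : ℂ) := by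
  rw [AddChar.map_add_eq_mul, Circle.coe_mul]

theorem conjS_shift (h : 𝓢(V, ℂ)) (x ξ : V) : conjS (shift h x ξ) = shift (conjS h) x (-ξ) := by
  ext y
  simp [shift_apply]

/-- The shifted functions, as a function of all variables. -/
noncomputable def shiftFun (h : 𝓢(V, ℂ)) (w : (V × V) × V) : ℂ :=
  (Real.fourierChar (-inner ℝ w.2 w.1.2) : ℂ) * h (w.2 - w.1.1)

theorem phase_hasTemperateGrowth :
    (fun w : (V × V) × V => (Real.fourierChar (-inner ℝ w.2 w.1.2) : ℂ)).HasTemperateGrowth := by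
  have h1 : (fun w : (V × V) × V => inner ℝ w.2 w.1.2).HasTemperateGrowth :=
    (innerSL ℝ (E := V)).bilinear_hasTemperateGrowth (𝕜 := ℝ)
      (ContinuousLinearMap.hasTemperateGrowth (ContinuousLinearMap.snd ℝ (V × V) V))
      (ContinuousLinearMap.hasTemperateGrowth
        (ContinuousLinearMap.snd ℝ V V ∘L ContinuousLinearMap.fst ℝ (V × V) V))
  have h2 := (char_hasTemperateGrowth (1 : ℝ)).comp h1
  simpa [Function.comp_def] using h2

theorem shiftFun_contDiff (h : 𝓢(V, ℂ)) : ContDiff ℝ ∞ (shiftFun h) :=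
  phase_hasTemperateGrowth.1.mul
    ((h.smooth ⊤).comp (contDiff_snd.sub (contDiff_fst.comp contDiff_fst)))

theorem shiftFun_bound (h : 𝓢(V, ℂ)) (k l : ℕ) : ∃ (N : ℕ) (C : ℝ), 0 ≤ C ∧
    ∀ z y, ‖y‖ ^ k * ‖iteratedFDeriv ℝ l (shiftFun h) (z, y)‖ ≤ C * (1 + ‖z‖) ^ N := by
  obtain ⟨N, C, hC, hm⟩ :=
    (phase_hasTemperateGrowth (V := V)).norm_iteratedFDeriv_le_uniform l
  set L : (V × V) × V →L[ℝ] V := ContinuousLinearMap.snd ℝ (V × V) V -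
    ContinuousLinearMap.fst ℝ V V ∘L ContinuousLinearMap.fst ℝ (V × V) V with hL
  set S := (Finset.Iic (k + N, l)).sup (schwartzSeminormFamily ℂ V ℂ) h with hS
  -- Leibniz puts `N` powers of `1 + ‖(z, y)‖` on the phase factor. Trading `y` for `y - z.1` costs
  -- one factor `1 + ‖z‖` for each power of `‖y‖` and two for each power of `1 + ‖(z, y)‖`; this
  -- gives growth `k + 2N` in `z`, while the window absorbs `k + N` powers of `1 + ‖y - z.1‖`.
  refine ⟨k + N + N, ∑ i ∈ Finset.range (l + 1), (l.choose i : ℝ) * C * ‖L‖ ^ (l - i) *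
    (2 ^ (k + N) * S), by positivity, fun z y => ?_⟩
  have hmul := norm_iteratedFDeriv_mul_le (N := ∞) (n := l)
    (phase_hasTemperateGrowth (V := V)).1 ((h.smooth ⊤).comp L.contDiff) (z, y)
    (by exact_mod_cast le_top)
  have hy : ‖y‖ ≤ ‖y - z.1‖ + ‖z‖ := by
    have h1 : ‖y‖ ≤ ‖y - z.1‖ + ‖z.1‖ := by simpa using norm_add_le (y - z.1) z.1
    have h2 : ‖z.1‖ ≤ ‖z‖ := le_max_left _ _
    linarith
  have n1 := norm_nonneg z
  have n2 := norm_nonneg (y - z.1)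
  have hy1 : ‖y‖ ≤ (1 + ‖z‖) * (1 + ‖y - z.1‖) := by nlinarith
  have hy2 : 1 + ‖(z, y)‖ ≤ (1 + ‖z‖) * ((1 + ‖z‖) * (1 + ‖y - z.1‖)) := by
    have : ‖(z, y)‖ ≤ ‖z‖ + ‖y‖ := by
      rw [Prod.norm_def]; exact max_le (by simp) (by simp)
    nlinarith [mul_nonneg n1 n2, mul_nonneg n1 (mul_nonneg n1 n2), mul_nonneg n1 n1]
  refine (mul_le_mul_of_nonneg_left hmul (by positivity)).trans ?_
  rw [Finset.mul_sum, Finset.sum_mul]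
  refine Finset.sum_le_sum fun i hi => ?_
  have hi' : i ≤ l := Nat.lt_succ_iff.1 (Finset.mem_range.1 hi)
  have a1 := hm i hi' (z, y)
  have a2 : ‖iteratedFDeriv ℝ (l - i) (h ∘ L) (z, y)‖ ≤
      ‖L‖ ^ (l - i) * ‖iteratedFDeriv ℝ (l - i) h (y - z.1)‖ := by
    generalize l - i = j
    rw [L.iteratedFDeriv_comp_right (h.smooth ⊤) (z, y) (i := j) (by exact_mod_cast le_top)]
    refine (ContinuousMultilinearMap.norm_compContinuousLinearMap_le _ _).trans ?_
    simp [hL, mul_comm]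
  have b := SchwartzMap.one_add_le_sup_seminorm_apply (𝕜 := ℂ) (m := (k + N, l)) le_rfl
    (Nat.sub_le l i) h (y - z.1)
  change _ ≤ (2 : ℝ) ^ (k + N) * S at b
  calc _ ≤ ((1 + ‖z‖) * (1 + ‖y - z.1‖)) ^ k * ((l.choose i : ℝ) *
        (C * ((1 + ‖z‖) * ((1 + ‖z‖) * (1 + ‖y - z.1‖))) ^ N) *
        (‖L‖ ^ (l - i) * ‖iteratedFDeriv ℝ (l - i) h (y - z.1)‖)) := by
        gcongr
        exact a1.trans (by gcongr)
    _ = (l.choose i : ℝ) * C * ‖L‖ ^ (l - i) *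
        ((1 + ‖y - z.1‖) ^ (k + N) * ‖iteratedFDeriv ℝ (l - i) h (y - z.1)‖) *
        (1 + ‖z‖) ^ (k + N + N) := by
        simp only [mul_pow, pow_add]; ring
    _ ≤ _ := by gcongr

/-- Polynomial growth in `z` is what makes a shift multiplied by a Schwartz coefficient integrable
in every seminorm. -/
theorem seminorm_shift_le (h : 𝓢(V, ℂ)) (k l : ℕ) : ∃ (N : ℕ) (C : ℝ), 0 ≤ C ∧
    ∀ z : V × V, SchwartzMap.seminorm ℂ k l (shift h z.1 z.2) ≤ C * (1 + ‖z‖) ^ N := by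
  obtain ⟨N, C, hC, hb⟩ := shiftFun_bound h k l
  exact ⟨N, C, hC, seminorm_slice_le (shiftFun_contDiff h)
    (w := fun z : V × V => shift h z.1 z.2) (fun z y => shift_apply h z.1 z.2 y) hC hb⟩

theorem continuous_shift (h : 𝓢(V, ℂ)) : Continuous fun z : V × V => shift h z.1 z.2 :=
  continuous_slice (shiftFun_contDiff h) (fun z y => shift_apply h z.1 z.2 y) (shiftFun_bound h)

theorem continuous_apply_shift (ψ : 𝓢'(V, ℂ)) (h : 𝓢(V, ℂ)) :
    Continuous fun z : V × V => ψ (shift h z.1 z.2) :=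
  ψ.continuous.comp (continuous_shift h)

theorem continuous_stft (φ : 𝓢(V, ℂ)) (ψ : 𝓢'(V, ℂ)) :
    Continuous fun z : V × V => stft φ ψ z.1 z.2 :=
  continuous_apply_shift ψ (conjS φ)

end Shift

/-! ### Distributions applied under an integral -/

section Pettis

variable {V : Type} [NormedAddCommGroup V] [NormedSpace ℝ V]

/-- Multilinear forms on `V`, the values of the `l`-th derivative of a scalar function. -/
def MultilinearForm (V : Type) [NormedAddCommGroup V] [NormedSpace ℝ V] (l : ℕ) : Type :=
  ContinuousMultilinearMap ℝ (fun _ : Fin l => V) ℂ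

noncomputable instance (l : ℕ) : NormedAddCommGroup (MultilinearForm V l) :=
  inferInstanceAs (NormedAddCommGroup (ContinuousMultilinearMap ℝ (fun _ : Fin l => V) ℂ))

noncomputable instance (l : ℕ) : NormedSpace ℂ (MultilinearForm V l) :=
  inferInstanceAs (NormedSpace ℂ (ContinuousMultilinearMap ℝ (fun _ : Fin l => V) ℂ))

instance (l : ℕ) : CompleteSpace (MultilinearForm V l) :=
  inferInstanceAs (CompleteSpace (ContinuousMultilinearMap ℝ (fun _ : Fin l => V) ℂ))

/-- The `l`-th derivative of a Schwartz function. -/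
noncomputable def nthDeriv (l : ℕ) (φ : 𝓢(V, ℂ)) (y : V) : MultilinearForm V l :=
  iteratedFDeriv ℝ l φ y

theorem continuous_nthDeriv (l : ℕ) (φ : 𝓢(V, ℂ)) : Continuous (nthDeriv l φ) :=
  (φ.smooth ⊤).continuous_iteratedFDeriv (m := l) (by exact_mod_cast le_top)

theorem nthDeriv_add (l : ℕ) (φ χ : 𝓢(V, ℂ)) (y : V) :
    nthDeriv l (φ + χ) y = nthDeriv l φ y + nthDeriv l χ y :=
  iteratedFDeriv_add_apply (φ.smooth l).contDiffAt (χ.smooth l).contDiffAt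

theorem nthDeriv_smul (l : ℕ) (a : ℂ) (φ : 𝓢(V, ℂ)) (y : V) :
    nthDeriv l (a • φ) y = a • nthDeriv l φ y :=
  iteratedFDeriv_const_smul_apply (φ.smooth l).contDiffAt

/-- The bounded continuous function `y ↦ ‖y‖ ^ k • D^l φ (y)`. -/
noncomputable def weightedDerivFun (k l : ℕ) (φ : 𝓢(V, ℂ)) :
    V →ᵇ MultilinearForm V l :=
  BoundedContinuousFunction.ofNormedAddCommGroup
    (fun y => (‖y‖ ^ k : ℝ) • nthDeriv l φ y)
    (by
      have := continuous_nthDeriv l φ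
      fun_prop)
    (SchwartzMap.seminorm ℂ k l φ)
    (fun y => by
      rw [norm_smul, Real.norm_of_nonneg (by positivity)]
      exact SchwartzMap.le_seminorm ℂ k l φ y)

theorem norm_weightedDerivFun_le (k l : ℕ) (φ : 𝓢(V, ℂ)) :
    ‖weightedDerivFun k l φ‖ ≤ SchwartzMap.seminorm ℂ k l φ :=
  BoundedContinuousFunction.norm_ofNormedAddCommGroup_le _ (apply_nonneg _ _) _

theorem seminorm_le_norm_weightedDerivFun (k l : ℕ) (φ : 𝓢(V, ℂ)) :
    SchwartzMap.seminorm ℂ k l φ ≤ ‖weightedDerivFun k l φ‖ := by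
  refine SchwartzMap.seminorm_le_bound ℂ k l _ (norm_nonneg (weightedDerivFun k l φ)) fun y => ?_
  have h := (weightedDerivFun k l φ).norm_coe_le_norm y
  change ‖(‖y‖ ^ k : ℝ) • nthDeriv l φ y‖ ≤ _ at h
  rwa [norm_smul, Real.norm_of_nonneg (by positivity)] at h

/-- The map `φ ↦ (y ↦ ‖y‖ ^ k • D^l φ (y))` into a space of bounded continuous functions. -/
noncomputable def weightedDeriv (k l : ℕ) :
    𝓢(V, ℂ) →L[ℂ] (V →ᵇ MultilinearForm V l) :=
  SchwartzMap.mkCLMtoNormedSpace (σ := RingHom.id ℂ) (weightedDerivFun k l)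
    (fun f g => by
      ext1 y
      change (‖y‖ ^ k : ℝ) • nthDeriv l (f + g) y =
        (‖y‖ ^ k : ℝ) • nthDeriv l f y + (‖y‖ ^ k : ℝ) • nthDeriv l g y
      rw [nthDeriv_add, smul_add])
    (fun a f => by
      ext1 y
      change (‖y‖ ^ k : ℝ) • nthDeriv l (a • f) y = a • (‖y‖ ^ k : ℝ) • nthDeriv l f y
      rw [nthDeriv_smul, smul_comm])
    ⟨{(k, l)}, 1, zero_le_one, fun f => by
      simpa [schwartzSeminormFamily] using norm_weightedDerivFun_le k l f⟩

theorem weightedDeriv_apply (k l : ℕ) (φ : 𝓢(V, ℂ)) (y : V) :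
    weightedDeriv k l φ y = (‖y‖ ^ k : ℝ) • nthDeriv l φ y := rfl

/-- Each Schwartz seminorm becomes the norm of a Banach space valued linear image, so that Bochner
integration is available. -/
theorem norm_weightedDeriv (k l : ℕ) (φ : 𝓢(V, ℂ)) :
    ‖weightedDeriv k l φ‖ = SchwartzMap.seminorm ℂ k l φ :=
  le_antisymm (norm_weightedDerivFun_le k l φ) (seminorm_le_norm_weightedDerivFun k l φ)

theorem continuous_seminorm_comp {Z : Type} [TopologicalSpace Z] {w : Z → 𝓢(V, ℂ)}
    (hw : Continuous w) (k l : ℕ) : Continuous fun z => SchwartzMap.seminorm ℂ k l (w z) := by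
  simp only [← norm_weightedDeriv]
  fun_prop

theorem fderiv_integral_apply {Z : Type} [MeasurableSpace Z] {μ : Measure Z} {W : Type}
    [NormedAddCommGroup W] [NormedSpace ℝ W]
    [CompleteSpace W] {G : Z → V → W} {b : Z → ℝ} {y : V}
    (hG : ∀ y, Integrable (fun z => G z y) μ) (hd : ∀ z, Differentiable ℝ (G z))
    (hm : AEStronglyMeasurable (fun z => fderiv ℝ (G z) y) μ)
    (hb : ∀ z y, ‖fderiv ℝ (G z) y‖ ≤ b z) (hi : Integrable b μ) (v : V) :
    Integrable (fun z => fderiv ℝ (G z) y v) μ ∧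
      fderiv ℝ (fun y => ∫ z, G z y ∂μ) y v = ∫ z, fderiv ℝ (G z) y v ∂μ := by
  have hI : Integrable (fun z => fderiv ℝ (G z) y) μ :=
    hi.mono' hm (.of_forall fun z => hb z y)
  have h := hasFDerivAt_integral_of_dominated_of_fderiv_le (𝕜 := ℝ) (s := Set.univ)
    (F := fun y z => G z y) (F' := fun y z => fderiv ℝ (G z) y) (bound := b) (x₀ := y)
    Filter.univ_mem (.of_forall fun y => (hG y).aestronglyMeasurable) (hG y) hm
    (.of_forall fun z y _ => hb z y) hi (.of_forall fun z y _ => (hd z y).hasFDerivAt)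
  rw [h.fderiv, ContinuousLinearMap.integral_apply hI]
  exact ⟨(ContinuousLinearMap.apply ℝ W v).integrable_comp hI, rfl⟩

variable {Z : Type} [TopologicalSpace Z] [SecondCountableTopology Z] [MeasurableSpace Z]
  [OpensMeasurableSpace Z] {μ : Measure Z}

/-- Derivatives pass under the integral one at a time: the seminorm of order `(0, l + 1)` is an
integrable majorant of the next derivative, uniform in `y`. -/
theorem iteratedFDeriv_eq_integral {w : Z → 𝓢(V, ℂ)} (hw : Continuous w)
    (hi : ∀ k l, Integrable (fun z => SchwartzMap.seminorm ℂ k l (w z)) μ) {φ : 𝓢(V, ℂ)}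
    (h : ∀ y, ∫ z, w z y ∂μ = φ y) (l : ℕ) :
    ∀ y, iteratedFDeriv ℝ l φ y = ∫ z, iteratedFDeriv ℝ l (w z) y ∂μ := by
  have hc : ∀ l y, Continuous fun z => iteratedFDeriv ℝ l (w z) y := fun l y => by
    have : Continuous fun z => weightedDeriv 0 l (w z) y :=
      (BoundedContinuousFunction.evalCLM ℝ y).continuous.comp
        ((weightedDeriv 0 l).continuous.comp hw)
    refine this.congr fun z => ?_
    rw [weightedDeriv_apply, pow_zero]
    exact one_smul ℝ (nthDeriv l (w z) y)
  have hint : ∀ l y, Integrable (fun z => iteratedFDeriv ℝ l (w z) y) μ := fun l y =>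
    (hi 0 l).mono' (hc l y).aestronglyMeasurable (.of_forall fun z =>
      SchwartzMap.norm_iteratedFDeriv_le_seminorm ℂ (w z) l y)
  induction l with
  | zero =>
    intro y
    simp only [iteratedFDeriv_zero_eq_comp, Function.comp_apply, ← h]
    exact ((continuousMultilinearCurryFin0 ℝ V ℂ).symm.toContinuousLinearEquiv.integral_comp_comm
      (fun z => w z y)).symm
  | succ l ih =>
    intro y
    have e : ∀ z y, fderiv ℝ (iteratedFDeriv ℝ l (w z)) y =
        continuousMultilinearCurryLeftEquiv ℝ (fun _ : Fin (l + 1) => V) ℂ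
          (iteratedFDeriv ℝ (l + 1) (w z) y) := fun z y => by
      rw [iteratedFDeriv_succ_eq_comp_left]; simp
    have hm : AEStronglyMeasurable (fun z => fderiv ℝ (iteratedFDeriv ℝ l (w z)) y) μ := by
      simp only [e]
      exact ((LinearIsometryEquiv.continuous _).comp (hc (l + 1) y)).aestronglyMeasurable
    have hb : ∀ z y, ‖fderiv ℝ (iteratedFDeriv ℝ l (w z)) y‖ ≤
        SchwartzMap.seminorm ℂ 0 (l + 1) (w z) := fun z y => by
      rw [norm_fderiv_iteratedFDeriv]
      exact SchwartzMap.norm_iteratedFDeriv_le_seminorm ℂ (w z) (l + 1) y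
    ext m
    obtain ⟨h1, h2⟩ := fderiv_integral_apply (hint l)
      (fun z => ((w z).smooth ⊤).differentiable_iteratedFDeriv (m := l)
        (by exact_mod_cast WithTop.coe_lt_top _)) hm hb (hi 0 (l + 1)) (m 0)
    rw [ContinuousMultilinearMap.integral_apply (hint (l + 1) y), iteratedFDeriv_succ_apply_left,
      funext ih, h2, ContinuousMultilinearMap.integral_apply h1]
    simp only [iteratedFDeriv_succ_apply_left]

/-- A tempered distribution factors through finitely many weighted derivatives. -/
theorem exists_factor_weightedDeriv (A : 𝓢'(V, ℂ)) : ∃ (s : Finset (ℕ × ℕ))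
    (Λ : (∀ m : s, V →ᵇ MultilinearForm V m.1.2) →L[ℂ] ℂ),
    ∀ φ, A φ = Λ fun m => weightedDeriv m.1.1 m.1.2 φ := by
  have hq : Continuous ((normSeminorm ℂ ℂ).comp A.toLinearMap) := by
    exact continuous_norm.comp A.continuous
  obtain ⟨s, C, -, hC⟩ := Seminorm.bound_of_continuous (schwartz_withSeminorms ℂ V ℂ) _ hq
  -- Including the sup norm makes the map into the product of function spaces injective, so `A`
  -- defines a bounded functional on its range, which Hahn–Banach extends.
  set t := insert (0, 0) s with ht
  set J : 𝓢(V, ℂ) →L[ℂ] (∀ m : t, V →ᵇ MultilinearForm V m.1.2) :=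
    ContinuousLinearMap.pi fun m => weightedDeriv m.1.1 m.1.2 with hJ
  have hinj : Function.Injective J.toLinearMap := by
    refine (injective_iff_map_eq_zero _).2 fun φ hφ => ?_
    ext y
    have h1 := congrFun hφ ⟨(0, 0), Finset.mem_insert_self _ _⟩
    have h2 : SchwartzMap.seminorm ℂ 0 0 φ = 0 := by
      rw [← norm_weightedDeriv]
      exact norm_eq_zero.2 h1
    simpa [h2] using SchwartzMap.norm_le_seminorm ℂ φ y
  have hb : ∀ φ, ‖A φ‖ ≤ C * ‖J φ‖ := fun φ => by
    refine (hC φ).trans ?_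
    change (C : ℝ) * (s.sup (schwartzSeminormFamily ℂ V ℂ)) φ ≤ _
    gcongr
    refine Seminorm.finset_sup_apply_le (norm_nonneg _) fun m hm => ?_
    have h1 := norm_le_pi_norm (J φ) ⟨m, Finset.mem_insert_of_mem hm⟩
    exact (norm_weightedDeriv m.1 m.2 φ).symm.le.trans h1
  let e := LinearEquiv.ofInjective J.toLinearMap hinj
  let f : LinearMap.range J.toLinearMap →L[ℂ] ℂ :=
    LinearMap.mkContinuous (A.toLinearMap ∘ₗ e.symm.toLinearMap) C fun x => by
      obtain ⟨φ, rfl⟩ := e.surjective x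
      change ‖A (e.symm (e φ))‖ ≤ C * ‖J φ‖
      rw [e.symm_apply_apply]
      exact hb φ
  obtain ⟨Λ, hΛ, -⟩ := exists_extension_norm_eq _ f
  refine ⟨t, Λ, fun φ => ?_⟩
  have h1 := hΛ (e φ)
  have h2 : f (e φ) = A φ := by
    change A (e.symm (e φ)) = A φ
    rw [e.symm_apply_apply]
  rw [h2] at h1
  exact h1.symm

theorem integrable_apply_of_seminorm {w : Z → 𝓢(V, ℂ)} (hw : Continuous w)
    (hi : ∀ k l, Integrable (fun z => SchwartzMap.seminorm ℂ k l (w z)) μ) (k l : ℕ) :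
    Integrable (fun z => weightedDeriv k l (w z)) μ :=
  (hi k l).mono' ((weightedDeriv k l).continuous.comp hw).aestronglyMeasurable
    (.of_forall fun z => (norm_weightedDeriv k l (w z)).le)

/-- Tempered distributions commute with absolutely convergent integrals of Schwartz functions. -/
theorem apply_eq_integral (A : 𝓢'(V, ℂ)) {w : Z → 𝓢(V, ℂ)} (hw : Continuous w)
    (hi : ∀ k l, Integrable (fun z => SchwartzMap.seminorm ℂ k l (w z)) μ) {φ : 𝓢(V, ℂ)}
    (h : ∀ y, ∫ z, w z y ∂μ = φ y) : A φ = ∫ z, A (w z) ∂μ := by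
  -- The factor `Λ` lives on a Banach space, where bounded functionals commute with Bochner
  -- integrals. It remains to identify the integral of the weighted derivatives, which is done
  -- component by component and pointwise in `y`.
  obtain ⟨s, Λ, hΛ⟩ := exists_factor_weightedDeriv A
  have hI : Integrable (fun z (m : s) => weightedDeriv m.1.1 m.1.2 (w z)) μ :=
    Integrable.of_eval fun m => integrable_apply_of_seminorm hw hi m.1.1 m.1.2
  simp only [hΛ]
  rw [Λ.integral_comp_comm hI]
  congr 1
  funext m
  rw [eval_integral fun m => integrable_apply_of_seminorm hw hi m.1.1 m.1.2]
  ext1 y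
  have h1 := (BoundedContinuousFunction.evalCLM ℝ y).integral_comp_comm
    (integrable_apply_of_seminorm hw hi m.1.1 m.1.2)
  simp only [BoundedContinuousFunction.evalCLM_apply] at h1
  rw [← h1]
  simp only [weightedDeriv_apply]
  rw [integral_smul]
  exact congrArg _ (iteratedFDeriv_eq_integral hw hi h m.1.2 y)

end Pettis

/-! ### Coefficients, inversion and Plancherel -/

section Slice

variable {V : Type} [NormedAddCommGroup V] [InnerProductSpace ℝ V]

/-- The change of variables `(x, y) ↦ (y - x, y)`. -/
noncomputable def differenceEquiv : (V × V) ≃L[ℝ] V × V :=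
  ContinuousLinearEquiv.equivOfInverse
    ((ContinuousLinearMap.snd ℝ V V - ContinuousLinearMap.fst ℝ V V).prod
      (ContinuousLinearMap.snd ℝ V V))
    ((ContinuousLinearMap.snd ℝ V V - ContinuousLinearMap.fst ℝ V V).prod
      (ContinuousLinearMap.snd ℝ V V))
    (fun z => by ext <;> simp)
    (fun z => by ext <;> simp)

variable (V) in
/-- The reflection `(x, ξ) ↦ (x, -ξ)`. -/
noncomputable def reflectEquiv : (V × V) ≃L[ℝ] V × V :=
  (ContinuousLinearEquiv.refl ℝ V).prodCongr (ContinuousLinearEquiv.neg ℝ)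

@[simp]
theorem reflectEquiv_apply (z : V × V) : reflectEquiv V z = (z.1, -z.2) := rfl

/-- The slice `y ↦ φ y * conj (h (y - x))`. -/
noncomputable def slice (h φ : 𝓢(V, ℂ)) (x : V) : 𝓢(V, ℂ) :=
  SchwartzMap.smulLeftCLM ℂ φ (SchwartzMap.compSubConstCLM ℂ x (conjS h))

theorem slice_apply (h φ : 𝓢(V, ℂ)) (x y : V) :
    slice h φ x y = φ y * (starRingEnd ℂ) (h (y - x)) := by
  rw [slice, SchwartzMap.smulLeftCLM_apply_apply φ.hasTemperateGrowth,
    SchwartzMap.compSubConstCLM_apply, smul_eq_mul, conjS_apply]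

theorem norm_shift_le (h : 𝓢(V, ℂ)) (x ξ y : V) :
    ‖shift h x ξ y‖ ≤ SchwartzMap.seminorm ℂ 0 0 h := by
  rw [shift_apply, norm_mul, Circle.norm_coe, one_mul]
  exact SchwartzMap.norm_le_seminorm ℂ h _

theorem continuous_shift_apply (h : 𝓢(V, ℂ)) (y : V) :
    Continuous fun z : V × V => shift h z.1 z.2 y := by
  simp only [shift_apply]
  have := h.continuous
  have h2 : Continuous fun z : V × V => (Real.fourierChar (-inner ℝ y z.2)) :=
    Real.continuous_fourierChar.comp (by fun_prop)
  fun_prop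

end Slice

section Coef

variable {V : Type} [NormedAddCommGroup V] [InnerProductSpace ℝ V] [FiniteDimensional ℝ V]
  [MeasurableSpace V] [BorelSpace V]

instance : (volume : Measure (V × V)).IsAddHaarMeasure :=
  Measure.prod.instIsAddHaarMeasure _ _

theorem measurePreserving_reflectEquiv :
    MeasurePreserving (reflectEquiv V) (volume : Measure (V × V)) volume :=
  (MeasurePreserving.id volume).prod (Measure.measurePreserving_neg volume)

/-- The coefficients `(x, ξ) ↦ ∫ φ y * conj (shift h x ξ y) dy`, as a Schwartz function. -/
noncomputable def coef (h : 𝓢(V, ℂ)) : 𝓢(V, ℂ) →L[ℂ] 𝓢(V × V, ℂ) :=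
  SchwartzMap.compCLMOfContinuousLinearEquiv ℂ (reflectEquiv V) ∘L partialFourier ∘L
    SchwartzMap.compCLMOfContinuousLinearEquiv ℂ differenceEquiv ∘L tensor (conjS h)

theorem coef_eq (h φ : 𝓢(V, ℂ)) (z : V × V) :
    coef h φ z = ∫ y, Real.fourierChar (-inner ℝ y (-z.2)) • (conjS h (y - z.1) * φ y) := rfl

theorem coef_apply (h φ : 𝓢(V, ℂ)) (z : V × V) :
    coef h φ z = ∫ y, φ y * (starRingEnd ℂ) (shift h z.1 z.2 y) := by
  rw [coef_eq]
  congr 1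
  ext y
  rw [shift_apply, map_mul, conj_fourierChar, Circle.smul_def, inner_neg_right, smul_eq_mul,
    conjS_apply]
  ring

/-- For fixed `x` the coefficients are a Fourier transform, so Fourier inversion in `ξ` recovers the
slice. -/
theorem coef_eq_fourier (h φ : 𝓢(V, ℂ)) (x ξ : V) :
    coef h φ (x, ξ) = 𝓕 (slice h φ x) (-ξ) := by
  rw [coef_eq, SchwartzMap.fourier_coe, Real.fourier_eq]
  congr 1
  ext y
  rw [slice_apply, conjS_apply, mul_comm (φ y)]

theorem fourierInv_slice (h φ : 𝓢(V, ℂ)) (x y : V) :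
    ∫ ξ, coef h φ (x, ξ) * (Real.fourierChar (-inner ℝ y ξ) : ℂ) = slice h φ x y := by
  have h1 : (𝓕⁻ (𝓕 (slice h φ x))) y = slice h φ x y := by simp
  rw [SchwartzMap.fourierInv_coe, Real.fourierInv_eq, ← integral_neg_eq_self] at h1
  rw [← h1]
  congr 1
  ext ξ
  rw [coef_eq_fourier, Circle.smul_def, smul_eq_mul, inner_neg_left, real_inner_comm, mul_comm]

/-- The squared norm of a window. -/
noncomputable def energy (h : 𝓢(V, ℂ)) : ℝ := ∫ y, ‖h y‖ ^ 2

theorem energy_pos {h : 𝓢(V, ℂ)} (hh : h ≠ 0) : 0 < energy h := by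
  obtain ⟨y, hy⟩ : ∃ y, h y ≠ 0 := by
    by_contra! hc
    exact hh (by ext y; simpa using hc y)
  have hi : Integrable fun y => ‖h y‖ ^ 2 := by
    have := (h.memLp 2).integrable_norm_pow (by norm_num)
    simpa using this
  exact integral_pos_of_integrable_nonneg_nonzero (by have := h.continuous; fun_prop) hi
    (fun y => by positivity) (x := y) (by simpa using hy)

/-- Integrating over `ξ` returns `φ y * conj (h (y - x))` by Fourier inversion; the factor `h (y -
x)` of the atom completes this to `φ y * ‖h (y - x)‖ ^ 2`, and the integral over `x` is the energy.
-/
theorem integral_coef_mul_shift (h φ : 𝓢(V, ℂ)) (y : V) :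
    ∫ z : V × V, coef h φ z * shift h z.1 z.2 y = energy h * φ y := by
  have hi : Integrable (fun z : V × V => coef h φ z * shift h z.1 z.2 y) :=
    (coef h φ).integrable.mul_bdd (c := SchwartzMap.seminorm ℂ 0 0 h)
      (continuous_shift_apply h y).aestronglyMeasurable
      (.of_forall fun z => norm_shift_le h z.1 z.2 y)
  rw [Measure.volume_eq_prod, integral_prod _ hi]
  have e : ∀ x, ∫ ξ, coef h φ (x, ξ) * shift h x ξ y = φ y * (‖h (y - x)‖ ^ 2 : ℝ) := by
    intro x
    simp only [shift_apply, ← mul_assoc]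
    rw [integral_mul_const, fourierInv_slice, slice_apply, mul_assoc, mul_comm (starRingEnd ℂ _),
      Complex.mul_conj, Complex.normSq_eq_norm_sq]
  simp only [e]
  rw [integral_const_mul, integral_complex_ofReal,
    integral_sub_left_eq_self (fun x => ‖h x‖ ^ 2) volume y, mul_comm]
  rfl

theorem integrable_growth_mul (F : 𝓢(V × V, ℂ)) (N : ℕ) :
    Integrable fun z : V × V => (1 + ‖z‖) ^ N * ‖F z‖ := by
  have h : ∀ z : V × V, (1 + ‖z‖) ^ N * ‖F z‖ =
      ∑ i ∈ Finset.range (N + 1), (N.choose i : ℝ) * (‖z‖ ^ i * ‖F z‖) := fun z => by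
    rw [add_comm, add_pow, Finset.sum_mul]
    refine Finset.sum_congr rfl fun i _ => ?_
    rw [one_pow]; ring
  simp only [h]
  exact integrable_finsetSum _ fun i _ => (F.integrable_pow_mul volume i).const_mul _

/-- The inversion formula for the short-time Fourier transform, tested against a tempered
distribution. -/
theorem integral_coef_mul_apply_shift (ψ : 𝓢'(V, ℂ)) (h φ : 𝓢(V, ℂ)) :
    ∫ z : V × V, coef h φ z * ψ (shift h z.1 z.2) = energy h * ψ φ := by
  have h1 := apply_eq_integral (μ := (volume : Measure (V × V))) ψ
    (w := fun z => coef h φ z • shift h z.1 z.2)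
    ((coef h φ).continuous.smul (continuous_shift h)) (fun k l => ?_)
    (φ := (energy h : ℂ) • φ) (fun y => ?_)
  · simp only [map_smul, smul_eq_mul] at h1
    exact h1.symm
  · obtain ⟨N, C, hC, hb⟩ := seminorm_shift_le h k l
    refine ((integrable_growth_mul (coef h φ) N).const_mul C).mono'
      (continuous_seminorm_comp ((coef h φ).continuous.smul
        (continuous_shift h)) k l).aestronglyMeasurable (.of_forall fun z => ?_)
    rw [Real.norm_of_nonneg (apply_nonneg _ _), map_smul_eq_mul]
    refine (mul_le_mul_of_nonneg_left (hb z) (norm_nonneg _)).trans (le_of_eq ?_)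
    ring
  · simpa using integral_coef_mul_shift h φ y

/-- Time-frequency shifts compose up to a unimodular factor, and the adjoint of a shift is a shift
up to such a factor; only the relative position survives in the modulus. This is the source of every
convolution structure below. -/
theorem coef_shift (g h : 𝓢(V, ℂ)) (u w : V × V) :
    ‖coef g (shift h u.1 u.2) w‖ = ‖coef h g (u - w)‖ := by
  rw [coef_apply, coef_apply, ← integral_add_right_eq_self _ w.1]
  rw [← RCLike.norm_conj (∫ y, g y * _), ← integral_conj]
  have e : ∀ y, shift h u.1 u.2 (y + w.1) * (starRingEnd ℂ) (shift g w.1 w.2 (y + w.1)) =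
      (Real.fourierChar (-inner ℝ w.1 (u.2 - w.2)) : ℂ) *
      (starRingEnd ℂ) (g y * (starRingEnd ℂ) (shift h (u - w).1 (u - w).2 y)) := fun y => by
    simp only [shift_apply, map_mul, conj_fourierChar, Prod.fst_sub, Prod.snd_sub,
      Complex.conj_conj, inner_add_left, inner_sub_right, neg_add, fourierChar_add,
      sub_eq_add_neg (inner ℝ _ _ : ℝ) _, add_sub_cancel_right, neg_neg]
    rw [show y + w.1 - u.1 = y - (u.1 - w.1) by abel]
    ring
  simp only [e]
  rw [integral_const_mul, norm_mul, Circle.norm_coe, one_mul]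

theorem coe_shift_eq_conj_coef (h φ : 𝓢(V, ℂ)) (z : V × V) :
    (conjS φ : 𝓢'(V, ℂ)) (shift h z.1 z.2) = (starRingEnd ℂ) (coef h φ z) := by
  rw [coef_apply, ← integral_conj, SchwartzMap.coe_apply]
  congr 1
  ext y
  simp [mul_comm]

/-- Plancherel's theorem for the short-time Fourier transform. -/
theorem integral_norm_sq_coef (h φ : 𝓢(V, ℂ)) :
    ∫ z, ‖coef h φ z‖ ^ 2 = energy h * energy φ := by
  -- Inversion tested against the conjugate of `φ` itself: the values on the atoms are then the
  -- conjugate coefficients.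
  have h1 := integral_coef_mul_apply_shift (conjS φ : 𝓢'(V, ℂ)) h φ
  rw [SchwartzMap.coe_apply] at h1
  simp only [coe_shift_eq_conj_coef, Complex.mul_conj, conjS_apply,
    smul_eq_mul, Complex.normSq_eq_norm_sq] at h1
  rw [integral_complex_ofReal, integral_complex_ofReal] at h1
  exact_mod_cast h1

end Coef

/-! ### Young's inequality -/

section Young

variable {G : Type} [NormedAddCommGroup G] [MeasurableSpace G] [BorelSpace G]
  [SecondCountableTopology G] {μ : Measure G} [μ.IsAddHaarMeasure] [SFinite μ] [μ.IsNegInvariant]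

/-- Comparison of the `L¹` and `L^p` norms for the measure with density `h`, whose total mass
produces the factor with exponent `p - 1`. -/
theorem lintegral_mul_rpow_le {α : Type} [MeasurableSpace α] {μ : Measure α} {h f : α → ℝ≥0∞}
    (hh : Measurable h) (hf : Measurable f) {p : ℝ} (hp : 1 ≤ p) :
    (∫⁻ w, h w * f w ∂μ) ^ p ≤ (∫⁻ w, h w ∂μ) ^ (p - 1) * ∫⁻ w, h w * f w ^ p ∂μ := by
  have hp0 : 0 < p := by linarith
  have hq : (1 : ℝ≥0∞) ≤ ENNReal.ofReal p := by simpa using hp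
  have h1 := eLpNorm_le_eLpNorm_mul_rpow_measure_univ (μ := μ.withDensity h) hq
    (hf.aestronglyMeasurable)
  rw [eLpNorm_one_eq_lintegral_enorm, eLpNorm_eq_lintegral_rpow_enorm_toReal (by simpa using hp0)
    ENNReal.ofReal_ne_top, ENNReal.toReal_ofReal hp0.le] at h1
  simp only [enorm_eq_self, ENNReal.toReal_one, withDensity_apply _ MeasurableSet.univ,
    Measure.restrict_univ] at h1
  rw [lintegral_withDensity_eq_lintegral_mul _ hh hf,
    lintegral_withDensity_eq_lintegral_mul _ hh (hf.pow_const p)] at h1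
  have h2 := ENNReal.rpow_le_rpow h1 hp0.le
  rw [ENNReal.mul_rpow_of_nonneg _ _ hp0.le, ← ENNReal.rpow_mul, ← ENNReal.rpow_mul,
    one_div_mul_cancel hp0.ne', ENNReal.rpow_one, mul_comm] at h2
  have e : (1 / (1 : ℝ) - 1 / p) * p = p - 1 := by field_simp
  rw [e, mul_comm (∫⁻ w, (h * fun x => f x ^ p) w ∂μ)] at h2
  simpa only [Pi.mul_apply, mul_comm (f _)] using h2

/-- Young's inequality for the convolution of an integrable function and an `L^q` function. -/
theorem eLpNorm_convolution_le {h f : G → ℝ≥0∞} (hh : Measurable h) (hf : Measurable f)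
    {q : ℝ≥0∞} (hq : 1 ≤ q) :
    eLpNorm (fun u => ∫⁻ w, h (u - w) * f w ∂μ) q μ ≤ (∫⁻ w, h w ∂μ) * eLpNorm f q μ := by
  have hH : ∀ u, ∫⁻ w, h (u - w) ∂μ = ∫⁻ w, h w ∂μ := fun u => lintegral_sub_left_eq_self h u
  rcases eq_or_ne q ⊤ with rfl | hq'
  · rw [eLpNorm_exponent_top, eLpNorm_exponent_top]
    refine eLpNormEssSup_le_of_ae_enorm_bound (.of_forall fun u => ?_)
    rw [enorm_eq_self]
    calc ∫⁻ w, h (u - w) * f w ∂μ ≤ ∫⁻ w, h (u - w) * eLpNormEssSup f μ ∂μ := by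
          refine lintegral_mono_ae ?_
          filter_upwards [enorm_ae_le_eLpNormEssSup f μ] with w hw
          gcongr
          simpa using hw
      _ = _ := by rw [lintegral_mul_const _ (by fun_prop), hH]
  · have hp : 1 ≤ q.toReal := by
      rw [← ENNReal.toReal_one]; exact (ENNReal.toReal_le_toReal (by simp) hq').2 hq
    have hp0 : 0 < q.toReal := by linarith
    have hq0 : q ≠ 0 := (one_pos.trans_le hq).ne'
    rw [eLpNorm_eq_lintegral_rpow_enorm_toReal hq0 hq',
      eLpNorm_eq_lintegral_rpow_enorm_toReal hq0 hq']
    simp only [enorm_eq_self]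
    set p := q.toReal with hpd
    -- The weighted power inequality for fixed `u`, followed by Tonelli; translation invariance
    -- turns the inner integral into the mass of `h`, which raises its exponent from `p - 1` to `p`.
    have key : ∫⁻ u, (∫⁻ w, h (u - w) * f w ∂μ) ^ p ∂μ ≤
        (∫⁻ w, h w ∂μ) ^ p * ∫⁻ w, f w ^ p ∂μ := by
      calc ∫⁻ u, (∫⁻ w, h (u - w) * f w ∂μ) ^ p ∂μ
          ≤ ∫⁻ u, (∫⁻ w, h w ∂μ) ^ (p - 1) * ∫⁻ w, h (u - w) * f w ^ p ∂μ ∂μ := by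
            refine lintegral_mono fun u => ?_
            have := lintegral_mul_rpow_le (μ := μ) (h := fun w => h (u - w)) (by fun_prop) hf hp
            rwa [hH] at this
        _ = (∫⁻ w, h w ∂μ) ^ (p - 1) * ∫⁻ u, ∫⁻ w, h (u - w) * f w ^ p ∂μ ∂μ := by
            refine lintegral_const_mul _ (Measurable.lintegral_prod_right ?_)
            fun_prop
        _ = (∫⁻ w, h w ∂μ) ^ (p - 1) * ∫⁻ w, ∫⁻ u, h (u - w) * f w ^ p ∂μ ∂μ := by
            rw [lintegral_lintegral_swap]
            exact Measurable.aemeasurable (by fun_prop)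
        _ = (∫⁻ w, h w ∂μ) ^ (p - 1) * ((∫⁻ w, h w ∂μ) * ∫⁻ w, f w ^ p ∂μ) := by
            congr 1
            rw [← lintegral_const_mul _ (by fun_prop)]
            refine lintegral_congr fun w => ?_
            rw [lintegral_mul_const _ (by fun_prop), lintegral_sub_right_eq_self h w]
        _ = _ := by
            rw [← mul_assoc]
            congr 1
            nth_rewrite 2 [← ENNReal.rpow_one (∫⁻ w, h w ∂μ)]
            rw [← ENNReal.rpow_add_of_nonneg _ _ (by linarith) zero_le_one, sub_add_cancel]
    refine (ENNReal.rpow_le_rpow key (by positivity)).trans (le_of_eq ?_)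
    rw [ENNReal.mul_rpow_of_nonneg _ _ (by positivity), ← ENNReal.rpow_mul,
      mul_one_div_cancel hp0.ne', ENNReal.rpow_one]

end Young

/-! ### Weights and the weighted transform -/

section Weight

variable {V : Type} [NormedAddCommGroup V]

theorem weight_pos (s : ℝ) (x ξ : V) : 0 < weight s x ξ := by unfold weight; positivity

theorem one_le_weight {s : ℝ} (hs : 0 ≤ s) (x ξ : V) : 1 ≤ weight s x ξ :=
  Real.one_le_rpow (by nlinarith [sq_nonneg ‖x‖, sq_nonneg ‖ξ‖]) (by positivity)

theorem continuous_weight (s : ℝ) : Continuous fun z : V × V => weight s z.1 z.2 := by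
  unfold weight
  refine Continuous.rpow_const (by fun_prop) fun z => Or.inl ?_
  positivity

/-- From `‖a + b‖² ≤ 2‖a‖² + 2‖b‖²`, whose constant gives the factor `2 ^ (s / 2)`. This
submultiplicativity lets a weight be split between the two factors of a convolution. -/
theorem weight_add_le {s : ℝ} (hs : 0 ≤ s) (x ξ y η : V) :
    weight s (x + y) (ξ + η) ≤ 2 ^ (s / 2) * weight s x ξ * weight s y η := by
  unfold weight
  rw [← Real.mul_rpow (by positivity) (by positivity),
    ← Real.mul_rpow (by positivity) (by positivity)]
  refine Real.rpow_le_rpow (by positivity) ?_ (by positivity)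
  have h : ∀ a b : V, ‖a + b‖ ^ 2 ≤ 2 * ‖a‖ ^ 2 + 2 * ‖b‖ ^ 2 := fun a b => by
    have := norm_add_le a b
    nlinarith [sq_nonneg (‖a‖ - ‖b‖), norm_nonneg (a + b), norm_nonneg a, norm_nonneg b]
  have h1 := h x y
  have h2 := h ξ η
  have h3 : 0 ≤ (‖x‖ ^ 2 + ‖ξ‖ ^ 2) * (‖y‖ ^ 2 + ‖η‖ ^ 2) := by positivity
  nlinarith

theorem weight_le_pow (s : ℝ) : ∃ N : ℕ, ∀ z : V × V,
    weight s z.1 z.2 ≤ 2 ^ N * (1 + ‖z‖) ^ (2 * N) := by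
  refine ⟨⌈s / 2⌉₊, fun z => ?_⟩
  have h1 : ‖z.1‖ ≤ ‖z‖ := le_max_left _ _
  have h2 : ‖z.2‖ ≤ ‖z‖ := le_max_right _ _
  have h0 := norm_nonneg z
  have h3 : 1 + ‖z.1‖ ^ 2 + ‖z.2‖ ^ 2 ≤ 2 * (1 + ‖z‖) ^ 2 := by
    nlinarith [norm_nonneg z.1, norm_nonneg z.2]
  rw [pow_mul, ← mul_pow]
  unfold weight
  calc _ ≤ (1 + ‖z.1‖ ^ 2 + ‖z.2‖ ^ 2) ^ ((⌈s / 2⌉₊ : ℕ) : ℝ) :=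
        Real.rpow_le_rpow_of_exponent_le (by nlinarith [sq_nonneg ‖z.1‖, sq_nonneg ‖z.2‖])
          (Nat.le_ceil _)
    _ ≤ _ := by
        rw [Real.rpow_natCast]
        gcongr

/-- The weight as an extended nonnegative function on phase space. -/
noncomputable def eweight (s : ℝ) (z : V × V) : ℝ≥0∞ := ENNReal.ofReal (weight s z.1 z.2)

theorem eweight_ne_top (s : ℝ) (z : V × V) : eweight s z ≠ ⊤ := ENNReal.ofReal_ne_top

theorem one_le_eweight {s : ℝ} (hs : 0 ≤ s) (z : V × V) : 1 ≤ eweight s z := by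
  simpa [eweight] using one_le_weight hs z.1 z.2

theorem continuous_eweight (s : ℝ) : Continuous (eweight s : V × V → ℝ≥0∞) :=
  ENNReal.continuous_ofReal.comp (continuous_weight s)

theorem eweight_le {s : ℝ} (hs : 0 ≤ s) (u w : V × V) :
    eweight s u ≤ ENNReal.ofReal (2 ^ (s / 2)) * eweight s (u - w) * eweight s w := by
  unfold eweight
  rw [← ENNReal.ofReal_mul (by positivity),
    ← ENNReal.ofReal_mul (mul_nonneg (by positivity) (weight_pos _ _ _).le)]
  refine ENNReal.ofReal_le_ofReal ?_
  simpa using weight_add_le hs (u - w).1 (u - w).2 w.1 w.2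

end Weight

section WeightedStft

variable {V : Type} [NormedAddCommGroup V] [InnerProductSpace ℝ V]

theorem enorm_weightedStft (s : ℝ) (φ : 𝓢(V, ℂ)) (ψ : 𝓢'(V, ℂ)) (z : V × V) :
    ‖weightedStft s φ ψ z‖ₑ = eweight s z * ‖stft φ ψ z.1 z.2‖ₑ := by
  rw [weightedStft, enorm_mul, ← ofReal_norm, Complex.norm_real,
    Real.norm_of_nonneg (weight_pos _ _ _).le]
  rfl

theorem continuous_weightedStft (s : ℝ) (φ : 𝓢(V, ℂ)) (ψ : 𝓢'(V, ℂ)) :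
    Continuous (weightedStft s φ ψ) :=
  (Complex.continuous_ofReal.comp (continuous_weight s)).mul (continuous_stft φ ψ)

variable [MeasurableSpace V] [BorelSpace V]

/-- The supremum over positions of the weighted short-time Fourier transform of a symbol. -/
noncomputable def symbolSup (s : ℝ) (Φ : 𝓢(V, ℂ)) (A : 𝓢'(V, ℂ)) (ζ : V) : ℝ≥0∞ :=
  ⨆ z, ‖weightedStft s Φ A (z, ζ)‖ₑ

/-- The supremum is over uncountably many points; measurability comes from lower semicontinuity of a
supremum of continuous functions. -/
theorem measurable_symbolSup (s : ℝ) (Φ : 𝓢(V, ℂ)) (A : 𝓢'(V, ℂ)) :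
    Measurable (symbolSup s Φ A) := by
  refine LowerSemicontinuous.measurable (lowerSemicontinuous_iSup fun z => ?_)
  refine Continuous.lowerSemicontinuous ?_
  have := continuous_weightedStft s Φ A
  exact continuous_enorm.comp (by fun_prop)

end WeightedStft

/-! ### Independence of the window -/

section WindowChange

variable {V : Type} [NormedAddCommGroup V] [InnerProductSpace ℝ V] [FiniteDimensional ℝ V]
  [MeasurableSpace V] [BorelSpace V]

theorem weighted_convolution_le {s : ℝ} (hs : 0 ≤ s) {F h f : V × V → ℝ≥0∞} (hh : Measurable h)
    (hf : Measurable f) (u : V × V) (hF : F u ≤ ∫⁻ w, h (u - w) * f w) :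
    eweight s u * F u ≤ ENNReal.ofReal (2 ^ (s / 2)) *
      ∫⁻ w, (eweight s (u - w) * h (u - w)) * (eweight s w * f w) := by
  have hm := (continuous_eweight (V := V) s).measurable
  calc eweight s u * F u ≤ eweight s u * ∫⁻ w, h (u - w) * f w := by gcongr
    _ = ∫⁻ w, eweight s u * (h (u - w) * f w) := (lintegral_const_mul _ (by fun_prop)).symm
    _ ≤ ∫⁻ w, ENNReal.ofReal (2 ^ (s / 2)) *
        ((eweight s (u - w) * h (u - w)) * (eweight s w * f w)) := by
        refine lintegral_mono fun w => ?_
        refine (mul_le_mul_left (eweight_le hs u w) _).trans (le_of_eq ?_)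
        ring
    _ = _ := lintegral_const_mul _ (by fun_prop)

theorem lintegral_eweight_mul_lt_top (s : ℝ) (F : 𝓢(V × V, ℂ)) :
    ∫⁻ z, eweight s z * ‖F z‖ₑ < ⊤ := by
  obtain ⟨N, hN⟩ := weight_le_pow (V := V) s
  refine lt_of_le_of_lt (lintegral_mono fun z => ?_)
    ((integrable_growth_mul F (2 * N)).const_mul (2 ^ N)).lintegral_lt_top
  rw [eweight, ← ofReal_norm, ← ENNReal.ofReal_mul (weight_pos _ _ _).le, ← mul_assoc]
  exact ENNReal.ofReal_le_ofReal (mul_le_mul_of_nonneg_right (hN z) (norm_nonneg _))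

/-- The inverse of the squared norm of a window. -/
noncomputable def invEnergy (g : 𝓢(V, ℂ)) : ℂ := (energy g : ℂ)⁻¹

theorem apply_eq_integral_coef {g : 𝓢(V, ℂ)} (hg : g ≠ 0) (ψ : 𝓢'(V, ℂ)) (φ : 𝓢(V, ℂ)) :
    ψ φ = invEnergy g * ∫ w : V × V, coef g φ w * ψ (shift g w.1 w.2) := by
  have : (energy g : ℂ) ≠ 0 := by exact_mod_cast (energy_pos hg).ne'
  rw [integral_coef_mul_apply_shift, invEnergy, inv_mul_cancel_left₀ this]

/-- Expand the atom `shift h u` in atoms with window `g` and apply `ψ`; by `coef_shift` the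
coefficients have modulus `‖coef h g (u - w)‖`, so a convolution appears. -/
theorem enorm_apply_shift_le {g : 𝓢(V, ℂ)} (hg : g ≠ 0) (h : 𝓢(V, ℂ)) (ψ : 𝓢'(V, ℂ))
    (u : V × V) : ‖ψ (shift h u.1 u.2)‖ₑ ≤
      ∫⁻ w, (‖invEnergy g‖ₑ * ‖coef h g (u - w)‖ₑ) * ‖ψ (shift g w.1 w.2)‖ₑ := by
  rw [apply_eq_integral_coef hg, enorm_mul]
  have hm := (continuous_apply_shift ψ g).measurable
  have hc := (coef h g).continuous.measurable
  simp only [mul_assoc]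
  have hm2 : Measurable fun w => ‖coef h g (u - w)‖ₑ * ‖ψ (shift g w.1 w.2)‖ₑ :=
    (hc.comp (measurable_const.sub measurable_id)).enorm.mul hm.enorm
  rw [lintegral_const_mul _ hm2]
  gcongr
  refine (enorm_integral_le_lintegral_enorm _).trans (le_of_eq (lintegral_congr fun w => ?_))
  rw [enorm_mul, ← ofReal_norm (coef g _ w), coef_shift, ofReal_norm]

/-- The kernel that controls a change of windows. -/
noncomputable def windowKernel (s : ℝ) (h g : 𝓢(V, ℂ)) (z : V × V) : ℝ≥0∞ :=
  ENNReal.ofReal (2 ^ (s / 2)) * ‖invEnergy g‖ₑ * (eweight s z * ‖coef h g z‖ₑ)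

theorem measurable_windowKernel (s : ℝ) (h g : 𝓢(V, ℂ)) : Measurable (windowKernel s h g) := by
  have hm := (continuous_eweight (V := V) s).measurable
  have hc := (coef h g).continuous.measurable
  unfold windowKernel
  fun_prop

theorem lintegral_windowKernel_lt_top (s : ℝ) (h g : 𝓢(V, ℂ)) :
    ∫⁻ z, windowKernel s h g z < ⊤ := by
  have hm := (continuous_eweight (V := V) s).measurable
  have hc := (coef h g).continuous.measurable
  unfold windowKernel
  rw [lintegral_const_mul _ (by fun_prop)]
  exact ENNReal.mul_lt_top (ENNReal.mul_lt_top ENNReal.ofReal_lt_top enorm_lt_top)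
    (lintegral_eweight_mul_lt_top s _)

theorem weighted_windowKernel_le {s : ℝ} (hs : 0 ≤ s) (h g : 𝓢(V, ℂ)) {F f : V × V → ℝ≥0∞}
    (hf : Measurable f) (u : V × V)
    (hF : F u ≤ ∫⁻ w, (‖invEnergy g‖ₑ * ‖coef h g (u - w)‖ₑ) * f w) :
    eweight s u * F u ≤ ∫⁻ w, windowKernel s h g (u - w) * (eweight s w * f w) := by
  have hm := (continuous_eweight (V := V) s).measurable
  have hc := (coef h g).continuous.measurable
  refine (weighted_convolution_le hs (h := fun z => ‖invEnergy g‖ₑ * ‖coef h g z‖ₑ)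
    (by fun_prop) hf u hF).trans (le_of_eq ?_)
  rw [← lintegral_const_mul _ (by fun_prop)]
  refine lintegral_congr fun w => ?_
  unfold windowKernel
  ring

theorem enorm_weightedStft_le {s : ℝ} (hs : 0 ≤ s) {g : 𝓢(V, ℂ)} (hg : g ≠ 0) (φ : 𝓢(V, ℂ))
    (ψ : 𝓢'(V, ℂ)) (u : V × V) : ‖weightedStft s φ ψ u‖ₑ ≤
      ∫⁻ w, windowKernel s (conjS φ) (conjS g) (u - w) * ‖weightedStft s g ψ w‖ₑ := by
  simp only [enorm_weightedStft]
  refine weighted_windowKernel_le hs _ _ (F := fun u => ‖stft φ ψ u.1 u.2‖ₑ) ?_ u ?_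
  · exact (continuous_stft g ψ).measurable.enorm
  · exact enorm_apply_shift_le (conjS_ne_zero hg) (conjS φ) ψ u

/-- The constant is the `L¹` norm of the kernel, hence the same for all `q`. -/
theorem modNorm_le {s : ℝ} (hs : 0 ≤ s) {q : ℝ≥0∞} (hq : 1 ≤ q) {g : 𝓢(V, ℂ)} (hg : g ≠ 0)
    (φ : 𝓢(V, ℂ)) (ψ : 𝓢'(V, ℂ)) : modNorm s q φ ψ ≤
      (∫⁻ z, windowKernel s (conjS φ) (conjS g) z) * modNorm s q g ψ := by
  have h1 := eLpNorm_convolution_le (μ := (volume : Measure (V × V)))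
    (measurable_windowKernel s (conjS φ) (conjS g))
    (f := fun w => ‖weightedStft s g ψ w‖ₑ) (continuous_weightedStft s g ψ).measurable.enorm hq
  rw [eLpNorm_enorm] at h1
  refine le_trans (eLpNorm_mono_enorm fun u => ?_) h1
  rw [enorm_eq_self]
  exact enorm_weightedStft_le hs hg φ ψ u

theorem memMod_iff {s : ℝ} (hs : 0 ≤ s) {q : ℝ≥0∞} (hq : 1 ≤ q) {g : 𝓢(V, ℂ)} (hg : g ≠ 0)
    (ψ : 𝓢'(V, ℂ)) : MemMod s q ψ ↔ modNorm s q g ψ < ⊤ := by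
  refine ⟨fun ⟨φ, hφ, h⟩ => ?_, fun h => ⟨g, hg,
    (continuous_weightedStft s g ψ).aestronglyMeasurable, h⟩⟩
  exact (modNorm_le hs hq hφ g ψ).trans_lt
    (ENNReal.mul_lt_top (lintegral_windowKernel_lt_top s _ _) h.2)

/-- Elements of `M_s^q` have bounded short-time Fourier transforms. -/
theorem exists_enorm_stft_le {s : ℝ} (hs : 0 ≤ s) {q : ℝ≥0∞} (hq : 1 ≤ q) {φ : 𝓢(V, ℂ)}
    (hφ : φ ≠ 0) (g : 𝓢(V, ℂ)) : ∃ C : ℝ≥0, ∀ (ψ : 𝓢'(V, ℂ)) (z : V × V),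
      ‖stft g ψ z.1 z.2‖ₑ ≤ C * modNorm s q φ ψ := by
  set φ' := conjS φ with hφ'
  set g' := conjS g with hg'
  have hc := (coef g' φ').continuous
  -- Hölder with the conjugate exponent written as `(1 - q⁻¹)⁻¹`, which also covers `q = 1` and `q =
  -- ∞`. The weight is at least `1`, so it can be inserted for free, and translation and reflection
  -- do not change the norm of the coefficient function.
  have hpq : ENNReal.HolderConjugate q (1 - q⁻¹)⁻¹ := ENNReal.HolderConjugate.inv_one_sub_inv' hq
  have hpq' := hpq.symm
  have hfin := (coef g' φ').eLpNorm_lt_top (1 - q⁻¹)⁻¹ volume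
  refine ⟨(‖invEnergy φ'‖ₑ * eLpNorm (coef g' φ') (1 - q⁻¹)⁻¹ volume).toNNReal, fun ψ u => ?_⟩
  rw [ENNReal.coe_toNNReal (ENNReal.mul_lt_top enorm_lt_top hfin).ne]
  refine (enorm_apply_shift_le (conjS_ne_zero hφ) g' ψ u).trans ?_
  have hm := (continuous_weightedStft s φ ψ).measurable
  have hcm := hc.measurable
  calc _ ≤ ∫⁻ w, ‖invEnergy φ'‖ₑ * (‖coef g' φ' (u - w)‖ₑ * ‖weightedStft s φ ψ w‖ₑ) := by
        refine lintegral_mono fun w => ?_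
        rw [← mul_assoc, enorm_weightedStft]
        gcongr
        exact le_mul_of_one_le_left' (one_le_eweight hs w)
    _ = ‖invEnergy φ'‖ₑ *
        eLpNorm ((fun w => coef g' φ' (u - w)) • weightedStft s φ ψ) 1 volume := by
        rw [lintegral_const_mul _ (by fun_prop), eLpNorm_one_eq_lintegral_enorm]
        simp [enorm_mul]
    _ ≤ ‖invEnergy φ'‖ₑ * (eLpNorm (fun w => coef g' φ' (u - w)) (1 - q⁻¹)⁻¹ volume *
        eLpNorm (weightedStft s φ ψ) q volume) := by
        gcongr
        exact eLpNorm_smul_le_mul_eLpNorm hm.aestronglyMeasurable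
          (by exact Measurable.aestronglyMeasurable (by fun_prop))
    _ = _ := by
        rw [← mul_assoc]
        congr 2
        exact eLpNorm_comp_measurePreserving hc.aestronglyMeasurable
          (Measure.measurePreserving_sub_left volume u)

theorem symbolNorm_le {s : ℝ} (hs : 0 ≤ s) {Φ : 𝓢(V, ℂ)} (hΦ : Φ ≠ 0) (Φ' : 𝓢(V, ℂ))
    (A : 𝓢'(V, ℂ)) : symbolNorm s Φ' A ≤
      (∫⁻ z, windowKernel s (conjS Φ') (conjS Φ) z) * symbolNorm s Φ A := by
  set k := windowKernel s (conjS Φ') (conjS Φ) with hk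
  have hkm : Measurable k := measurable_windowKernel s _ _
  have hsm := measurable_symbolSup s Φ A
  -- Replacing the transform by its supremum over positions leaves a kernel integrated over all
  -- positions, that is, a convolution in the frequency variable alone.
  have key : ∀ ζ, symbolSup s Φ' A ζ ≤
      ∫⁻ ζ', (∫⁻ z, k (z, ζ - ζ')) * symbolSup s Φ A ζ' := fun ζ => by
    refine iSup_le fun z => (enorm_weightedStft_le hs hΦ Φ' A (z, ζ)).trans ?_
    calc _ ≤ ∫⁻ w : V × V, k ((z, ζ) - w) * symbolSup s Φ A w.2 := by
          refine lintegral_mono fun w => ?_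
          gcongr
          exact le_iSup (fun z => ‖weightedStft s Φ A (z, w.2)‖ₑ) w.1
      _ = ∫⁻ ζ', ∫⁻ z', k ((z, ζ) - (z', ζ')) * symbolSup s Φ A ζ' := by
          rw [Measure.volume_eq_prod, lintegral_prod_symm _ (by fun_prop)]
      _ = _ := by
          refine lintegral_congr fun ζ' => ?_
          rw [lintegral_mul_const _ (by fun_prop)]
          congr 1
          exact lintegral_sub_left_eq_self (fun x => k (x, ζ - ζ')) z
  have hm2 : Measurable fun ζ => ∫⁻ z, k (z, ζ) := Measurable.lintegral_prod_left hkm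
  calc symbolNorm s Φ' A = ∫⁻ ζ, symbolSup s Φ' A ζ := rfl
    _ ≤ ∫⁻ ζ, ∫⁻ ζ', (∫⁻ z, k (z, ζ - ζ')) * symbolSup s Φ A ζ' := lintegral_mono key
    _ = ∫⁻ ζ', ∫⁻ ζ, (∫⁻ z, k (z, ζ - ζ')) * symbolSup s Φ A ζ' := by
        refine lintegral_lintegral_swap (Measurable.aemeasurable ?_)
        exact ((hm2.comp (measurable_fst.sub measurable_snd)).mul (hsm.comp measurable_snd))
    _ = ∫⁻ ζ', (∫⁻ z, k z) * symbolSup s Φ A ζ' := by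
        refine lintegral_congr fun ζ' => ?_
        rw [lintegral_mul_const _ (by fun_prop)]
        congr 1
        rw [lintegral_sub_right_eq_self (fun ζ => ∫⁻ z, k (z, ζ)) ζ', Measure.volume_eq_prod,
          lintegral_prod_symm _ (by fun_prop)]
    _ = _ := lintegral_const_mul _ hsm

end WindowChange

/-! ### Covariance of the Wigner function and the Weyl matrix -/

section Covariance

variable {n : ℕ} {ħ : ℝ} (hħ : 0 < ħ)

theorem wigner_eq_integral (ψ φ : 𝓢(Rn n, ℂ)) (z : Phase n) :
    wigner ħ hħ ψ φ z = (1 / (2 * Real.pi * ħ) : ℂ) ^ n * ∫ y : Rn n,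
      (Real.fourierChar (-inner ℝ y ((2 * Real.pi * ħ)⁻¹ • z.snd)) : ℂ) *
        (ψ (z.fst + (2⁻¹ : ℝ) • y) * φ (z.fst - (2⁻¹ : ℝ) • y)) := rfl

/-- The covariance of the Wigner function under time-frequency shifts. -/
theorem wigner_shift (h₁ h₂ : 𝓢(Rn n, ℂ)) (x₁ ξ₁ x₂ ξ₂ : Rn n) (m j : Phase n)
    (hm : m = WithLp.toLp 2 ((2⁻¹ : ℝ) • (x₁ + x₂), (Real.pi * ħ) • (ξ₂ - ξ₁)))
    (hj : j = WithLp.toLp 2 (ξ₁ + ξ₂, (2 * Real.pi * ħ)⁻¹ • (x₁ - x₂))) :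
    wigner ħ hħ (shift h₁ x₁ ξ₁) (shift h₂ x₂ ξ₂) =
      (Real.fourierChar (inner ℝ m.snd j.snd) : ℂ) • shift (wigner ħ hħ h₁ h₂) m j := by
  -- The only relation between the scaling constants that is needed to match the phases.
  have hk : (2 * Real.pi * ħ)⁻¹ * (Real.pi * ħ) = 2⁻¹ := by
    have := Real.pi_ne_zero
    have := hħ.ne'
    field_simp
  ext z
  -- Translating `y` by `x₁ - x₂` recentres both arguments at the midpoint `(x₁ + x₂) / 2`, so that
  -- the window values agree on the two sides and only characters remain to be compared.
  rw [smul_apply, shift_apply, wigner_eq_integral, wigner_eq_integral,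
    ← integral_add_right_eq_self _ (x₁ - x₂), smul_eq_mul, mul_left_comm _ (_ ^ n),
    mul_left_comm _ (_ ^ n)]
  congr 1
  rw [← integral_const_mul, ← integral_const_mul]
  congr 1
  ext y
  have e1 : z.fst + (2⁻¹ : ℝ) • (y + (x₁ - x₂)) - x₁ = (z - m).fst + (2⁻¹ : ℝ) • y := by
    rw [hm, WithLp.sub_fst]
    change _ = z.fst - (2⁻¹ : ℝ) • (x₁ + x₂) + (2⁻¹ : ℝ) • y
    module
  have e2 : z.fst - (2⁻¹ : ℝ) • (y + (x₁ - x₂)) - x₂ = (z - m).fst - (2⁻¹ : ℝ) • y := by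
    rw [hm, WithLp.sub_fst]
    change _ = z.fst - (2⁻¹ : ℝ) • (x₁ + x₂) - (2⁻¹ : ℝ) • y
    module
  simp only [shift_apply, e1, e2]
  generalize h₁ _ = a
  generalize h₂ _ = b
  have e3 : ∀ c₁ c₂ c₃ d₁ d₂ d₃ : ℝ, c₁ + c₂ + c₃ = d₁ + d₂ + d₃ →
      (Real.fourierChar c₁ : ℂ) * ((Real.fourierChar c₂ : ℂ) * a *
        ((Real.fourierChar c₃ : ℂ) * b)) =
      (Real.fourierChar d₁ : ℂ) * ((Real.fourierChar d₂ : ℂ) * ((Real.fourierChar d₃ : ℂ) *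
        (a * b))) := fun c₁ c₂ c₃ d₁ d₂ d₃ h => by
    have h' := congrArg (fun t => (Real.fourierChar t : ℂ)) h
    simp only [fourierChar_add] at h'
    linear_combination (a * b) * h'
  refine e3 _ _ _ _ _ _ ?_
  rw [WithLp.prod_inner_apply, hm, hj]
  change -inner ℝ (y + (x₁ - x₂)) ((2 * Real.pi * ħ)⁻¹ • z.snd) +
    -inner ℝ (z.fst + (2⁻¹ : ℝ) • (y + (x₁ - x₂))) ξ₁ +
    -inner ℝ (z.fst - (2⁻¹ : ℝ) • (y + (x₁ - x₂))) ξ₂ =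
    inner ℝ ((Real.pi * ħ) • (ξ₂ - ξ₁)) ((2 * Real.pi * ħ)⁻¹ • (x₁ - x₂)) +
    -(inner ℝ z.fst (ξ₁ + ξ₂) + inner ℝ z.snd ((2 * Real.pi * ħ)⁻¹ • (x₁ - x₂))) +
    -inner ℝ y ((2 * Real.pi * ħ)⁻¹ • (z.snd - (Real.pi * ħ) • (ξ₂ - ξ₁)))
  simp only [inner_add_left, inner_add_right, inner_sub_left, inner_sub_right,
    real_inner_smul_left, real_inner_smul_right, real_inner_comm x₁ ξ₁,
    real_inner_comm x₁ ξ₂, real_inner_comm x₂ ξ₁, real_inner_comm x₂ ξ₂,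
    real_inner_comm x₁ z.snd, real_inner_comm x₂ z.snd]
  linear_combination (inner ℝ y ξ₁ - inner ℝ y ξ₂ + inner ℝ x₂ ξ₂ - inner ℝ x₁ ξ₂ +
    inner ℝ x₁ ξ₁ - inner ℝ x₂ ξ₁) * hk

/-- The reflection `(x, p) ↦ (x, -p)` of phase space. -/
noncomputable def phaseReflect (n : ℕ) : Phase n ≃L[ℝ] Phase n :=
  (WithLp.prodContinuousLinearEquiv 2 ℝ (Rn n) (Rn n)).trans
    ((reflectEquiv (Rn n)).trans (WithLp.prodContinuousLinearEquiv 2 ℝ (Rn n) (Rn n)).symm)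

/-- The substitution `y ↦ -y`. It makes the pairing continuous in `ψ` as well, so that `ψ ↦ ⟨A^w ψ,
φ⟩` is itself a tempered distribution to which the inversion formula applies. -/
theorem wigner_swap (ψ φ : 𝓢(Rn n, ℂ)) :
    wigner ħ hħ ψ φ =
      SchwartzMap.compCLMOfContinuousLinearEquiv ℂ (phaseReflect n) (wigner ħ hħ φ ψ) := by
  ext z
  rw [SchwartzMap.compCLMOfContinuousLinearEquiv_apply, Function.comp_apply, wigner_eq_integral,
    wigner_eq_integral, ← integral_neg_eq_self]
  congr 2
  ext y
  change (Real.fourierChar (-inner ℝ (-y) ((2 * Real.pi * ħ)⁻¹ • z.snd)) : ℂ) *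
    (ψ (z.fst + (2⁻¹ : ℝ) • (-y)) * φ (z.fst - (2⁻¹ : ℝ) • (-y))) =
    (Real.fourierChar (-inner ℝ y ((2 * Real.pi * ħ)⁻¹ • (-z.snd))) : ℂ) *
    (φ (z.fst + (2⁻¹ : ℝ) • y) * ψ (z.fst - (2⁻¹ : ℝ) • y))
  rw [smul_neg, smul_neg, inner_neg_left, inner_neg_right, ← sub_eq_add_neg, sub_neg_eq_add]
  ring

/-- The functional `ψ ↦ ⟨A^w ψ, φ⟩`. -/
noncomputable def weylDual (A : 𝓢'(Phase n, ℂ)) (φ : 𝓢(Rn n, ℂ)) : 𝓢'(Rn n, ℂ) :=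
  PointwiseConvergenceCLM.precomp ℂ
    (SchwartzMap.compCLMOfContinuousLinearEquiv ℂ (phaseReflect n) ∘L wigner ħ hħ φ) A

theorem weylDual_apply (A : 𝓢'(Phase n, ℂ)) (φ ψ : 𝓢(Rn n, ℂ)) :
    weylDual hħ A φ ψ = weylOp ħ hħ A ψ φ := by
  rw [weylOp_apply, wigner_swap]; rfl

/-- The matrix coefficients of the Weyl operator with respect to time-frequency shifts of `g`. -/
noncomputable def weylKernel (A : 𝓢'(Phase n, ℂ)) (g : 𝓢(Rn n, ℂ)) (w z : Rn n × Rn n) : ℂ :=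
  weylOp ħ hħ A (shift g z.1 (-z.2)) (shift (conjS g) w.1 w.2)

/-- The phase space window attached to a window `g`. -/
noncomputable def phaseWindow (g : 𝓢(Rn n, ℂ)) : 𝓢(Phase n, ℂ) :=
  conjS (wigner ħ hħ g (conjS g))

/-- The midpoint of two phase space points, in the scaling of `Phase n`. -/
noncomputable def kernelPos (ħ : ℝ) (w z : Rn n × Rn n) : Phase n :=
  WithLp.toLp 2 ((2⁻¹ : ℝ) • (z.1 + w.1), (Real.pi * ħ) • (w.2 + z.2))

/-- The frequency variable of the symbol that governs a transition by `u`. -/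
noncomputable def kernelFreq : (Rn n × Rn n) ≃L[ℝ] Phase n :=
  (ContinuousLinearEquiv.prodComm ℝ (Rn n) (Rn n)).trans
    (((ContinuousLinearEquiv.refl ℝ (Rn n)).prodCongr (ContinuousLinearEquiv.smulLeft
      (Units.mk0 (-(2 * Real.pi * ħ)⁻¹) (neg_ne_zero.2 (by positivity))))).trans
    (WithLp.prodContinuousLinearEquiv 2 ℝ (Rn n) (Rn n)).symm)

theorem kernelFreq_apply (u : Rn n × Rn n) :
    kernelFreq hħ u = WithLp.toLp 2 (u.2, (-(2 * Real.pi * ħ)⁻¹) • u.1) := rfl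

/-- Covariance carries the shifts off the windows and onto the symbol's window. The conjugate in
`phaseWindow` cancels the one in the definition of the short-time Fourier transform. -/
theorem weylKernel_eq (A : 𝓢'(Phase n, ℂ)) (g : 𝓢(Rn n, ℂ)) (w z : Rn n × Rn n) :
    weylKernel hħ A g w z =
      (Real.fourierChar (inner ℝ (kernelPos ħ w z).snd (kernelFreq hħ (w - z)).snd) : ℂ) *
      stft (phaseWindow hħ g) A (kernelPos ħ w z) (kernelFreq hħ (w - z)) := by
  rw [weylKernel, weylOp_apply, wigner_shift hħ g (conjS g) z.1 (-z.2) w.1 w.2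
    (kernelPos ħ w z) (kernelFreq hħ (w - z)), map_smul, smul_eq_mul, stft, window_eq_shift,
    phaseWindow, conjS_conjS]
  · rw [kernelPos, sub_neg_eq_add]
  · rw [kernelFreq_apply]
    congr 2
    · simp; abel
    · simp only [Prod.fst_sub]; module

theorem continuous_weylKernel (A : 𝓢'(Phase n, ℂ)) (g : 𝓢(Rn n, ℂ)) :
    Continuous fun p : (Rn n × Rn n) × (Rn n × Rn n) => weylKernel hħ A g p.1 p.2 := by
  simp only [weylKernel_eq]
  have h1 : Continuous fun p : (Rn n × Rn n) × (Rn n × Rn n) => kernelPos ħ p.1 p.2 := by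
    unfold kernelPos
    exact (WithLp.prod_continuous_toLp 2 _ _).comp (by fun_prop)
  have h2 : Continuous fun p : (Rn n × Rn n) × (Rn n × Rn n) => kernelFreq hħ (p.1 - p.2) :=
    (kernelFreq hħ).continuous.comp (continuous_fst.sub continuous_snd)
  generalize phaseWindow hħ g = Φ
  have h4 : Continuous fun p : (Rn n × Rn n) × (Rn n × Rn n) =>
      stft Φ A (kernelPos ħ p.1 p.2) (kernelFreq hħ (p.1 - p.2)) := by
    have hs : Continuous fun z : Phase n × Phase n => stft Φ A z.1 z.2 := continuous_stft Φ A
    generalize stft Φ A = F at hs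
    exact hs.comp₂ h1 h2
  refine Continuous.mul ?_ h4
  have h3 : Continuous fun v : Phase n => v.snd := (WithLp.prod_continuous_ofLp 2 _ _).snd
  exact continuous_subtype_val.comp (Real.continuous_fourierChar.comp
    ((h3.comp h1).inner (h3.comp h2)))

theorem enorm_weylKernel (A : 𝓢'(Phase n, ℂ)) (g : 𝓢(Rn n, ℂ)) (w z : Rn n × Rn n) :
    ‖weylKernel hħ A g w z‖ₑ =
      ‖stft (phaseWindow hħ g) A (kernelPos ħ w z) (kernelFreq hħ (w - z))‖ₑ := by
  rw [weylKernel_eq, enorm_mul, ← ofReal_norm, Circle.norm_coe, ENNReal.ofReal_one, one_mul]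

/-- The split is chosen so that `ħ` does not enter: the position `w.1 = (z.1 + w.1) - z.1` is
controlled by the first component of the midpoint, and the frequency `w.2 = (w.2 - z.2) + z.2` by
the first component of the transition frequency. The factor `4 ^ (s / 2)` undoes the halving in the
midpoint. -/
theorem weight_le_kernel {s : ℝ} (hs : 0 ≤ s) (w z : Rn n × Rn n) :
    weight s w.1 w.2 ≤ 2 ^ (s / 2) * 4 ^ (s / 2) *
      weight s (kernelPos ħ w z) (kernelFreq hħ (w - z)) * weight s z.1 z.2 := by
  have h := weight_add_le hs (z.1 + w.1) (w.2 - z.2) (-z.1) z.2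
  rw [show z.1 + w.1 + -z.1 = w.1 by abel, sub_add_cancel] at h
  have e1 : weight s (-z.1) z.2 = weight s z.1 z.2 := by simp [weight]
  have e2 : weight s (z.1 + w.1) (w.2 - z.2) ≤ 4 ^ (s / 2) *
      weight s (kernelPos ħ w z) (kernelFreq hħ (w - z)) := by
    unfold weight
    rw [← Real.mul_rpow (by norm_num) (by positivity)]
    refine Real.rpow_le_rpow (by positivity) ?_ (by positivity)
    have h1 : ‖kernelPos ħ w z‖ ^ 2 = ‖(2⁻¹ : ℝ) • (z.1 + w.1)‖ ^ 2 +
      ‖(Real.pi * ħ) • (w.2 + z.2)‖ ^ 2 := WithLp.prod_norm_sq_eq_of_L2 _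
    have h2 : ‖kernelFreq hħ (w - z)‖ ^ 2 = ‖w.2 - z.2‖ ^ 2 +
      ‖(-(2 * Real.pi * ħ)⁻¹) • (w.1 - z.1)‖ ^ 2 := WithLp.prod_norm_sq_eq_of_L2 _
    rw [norm_smul] at h1
    norm_num at h1
    nlinarith [sq_nonneg ‖(Real.pi * ħ) • (w.2 + z.2)‖, sq_nonneg ‖w.2 - z.2‖,
      sq_nonneg ‖(-(2 * Real.pi * ħ)⁻¹) • (w.1 - z.1)‖]
  rw [e1] at h
  refine h.trans ?_
  have := weight_pos s z.1 z.2
  rw [mul_assoc (2 ^ (s / 2) : ℝ) (4 ^ (s / 2))]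
  gcongr

/-- The convolution kernel that dominates the matrix coefficients of a Weyl operator. -/
noncomputable def kernelBound (s : ℝ) (A : 𝓢'(Phase n, ℂ)) (g : 𝓢(Rn n, ℂ))
    (u : Rn n × Rn n) : ℝ≥0∞ :=
  ENNReal.ofReal (2 ^ (s / 2) * 4 ^ (s / 2)) *
    symbolSup s (phaseWindow hħ g) A (kernelFreq hħ u)

theorem measurable_kernelBound (s : ℝ) (A : 𝓢'(Phase n, ℂ)) (g : 𝓢(Rn n, ℂ)) :
    Measurable (kernelBound hħ s A g) :=
  ((measurable_symbolSup s _ A).comp (kernelFreq hħ).continuous.measurable).const_mul _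

/-- The weight at `w` is paid for by the weight in the symbol norm and by the weight at `z`; this is
where the symbol class needs its weight. -/
theorem eweight_mul_kernel_le {s : ℝ} (hs : 0 ≤ s) (A : 𝓢'(Phase n, ℂ)) (g : 𝓢(Rn n, ℂ))
    (w z : Rn n × Rn n) :
    eweight s w * ‖weylKernel hħ A g w z‖ₑ ≤ kernelBound hħ s A g (w - z) * eweight s z := by
  have h1 : eweight s w ≤ ENNReal.ofReal (2 ^ (s / 2) * 4 ^ (s / 2)) *
      eweight s (kernelPos ħ w z, kernelFreq hħ (w - z)) * eweight s z := by
    unfold eweight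
    rw [← ENNReal.ofReal_mul (by positivity),
      ← ENNReal.ofReal_mul (mul_nonneg (by positivity) (weight_pos _ _ _).le)]
    exact ENNReal.ofReal_le_ofReal (weight_le_kernel hħ hs w z)
  have h2 := le_iSup (fun y => ‖weightedStft s (phaseWindow hħ g) A (y, kernelFreq hħ (w - z))‖ₑ)
    (kernelPos ħ w z)
  simp only [enorm_weightedStft] at h2
  rw [enorm_weylKernel, kernelBound, symbolSup]
  simp only [enorm_weightedStft]
  refine (mul_le_mul_left h1 _).trans ?_
  calc _ = ENNReal.ofReal (2 ^ (s / 2) * 4 ^ (s / 2)) *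
        (eweight s (kernelPos ħ w z, kernelFreq hħ (w - z)) *
        ‖stft (phaseWindow hħ g) A (kernelPos ħ w z) (kernelFreq hħ (w - z))‖ₑ) *
        eweight s z := by ring
    _ ≤ _ := by gcongr

/-- The unweighted version, used for pointwise bounds and dominated convergence. -/
theorem kernel_le {s : ℝ} (hs : 0 ≤ s) (A : 𝓢'(Phase n, ℂ)) (g : 𝓢(Rn n, ℂ))
    (w z : Rn n × Rn n) : ‖weylKernel hħ A g w z‖ₑ ≤ kernelBound hħ s A g (w - z) := by
  have h2 := le_iSup (fun y => ‖weightedStft s (phaseWindow hħ g) A (y, kernelFreq hħ (w - z))‖ₑ)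
    (kernelPos ħ w z)
  simp only [enorm_weightedStft] at h2
  rw [enorm_weylKernel, kernelBound, symbolSup]
  simp only [enorm_weightedStft]
  have h3 : 1 ≤ ENNReal.ofReal (2 ^ (s / 2) * 4 ^ (s / 2)) := by
    rw [ENNReal.one_le_ofReal]
    exact one_le_mul_of_one_le_of_one_le (Real.one_le_rpow (by norm_num) (by positivity))
      (Real.one_le_rpow (by norm_num) (by positivity))
  exact (le_mul_of_one_le_left' (one_le_eweight hs _)).trans
    (h2.trans (le_mul_of_one_le_left' h3))

theorem exists_lintegral_kernelBound (s : ℝ) : ∃ C : ℝ≥0,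
    ∀ (A : 𝓢'(Phase n, ℂ)) (g : 𝓢(Rn n, ℂ)),
      ∫⁻ u, kernelBound hħ s A g u ≤ C * symbolNorm s (phaseWindow hħ g) A := by
  -- A linear isomorphism carries Lebesgue measure to a Haar measure, so the change of variables
  -- costs only a scalar factor, depending on `n` and `ħ`.
  have : (Measure.map (kernelFreq hħ : Rn n × Rn n → Phase n) volume).IsAddHaarMeasure :=
    (kernelFreq hħ).isAddHaarMeasure_map volume
  set c := Measure.addHaarScalarFactor
    (Measure.map (kernelFreq hħ : Rn n × Rn n → Phase n) volume) volume with hc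
  refine ⟨(2 ^ (s / 2) * 4 ^ (s / 2) : ℝ).toNNReal * c, fun A g => ?_⟩
  have hm := measurable_symbolSup s (phaseWindow hħ g) A
  have hmk := (kernelFreq (n := n) hħ).continuous.measurable
  unfold kernelBound
  have hm2 : Measurable fun u : Rn n × Rn n =>
      symbolSup s (phaseWindow hħ g) A (kernelFreq hħ u) := hm.comp hmk
  rw [lintegral_const_mul _ hm2, ← lintegral_map hm hmk,
    Measure.isAddLeftInvariant_eq_smul
    (Measure.map (kernelFreq hħ : Rn n × Rn n → Phase n) volume) volume, ← hc]
  rw [lintegral_smul_measure, ENNReal.coe_mul, mul_assoc]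
  exact le_rfl

end Covariance

/-! ### Synthesis and the modulation spaces as subspaces -/

section Interpolation

theorem memLp_of_integrable_of_bound {α : Type} [MeasurableSpace α] {μ : Measure α} {f : α → ℂ}
    (hf : Integrable f μ) {B : ℝ≥0} (hB : ∀ z, ‖f z‖ₑ ≤ B) {q : ℝ≥0∞} (hq : 1 ≤ q) :
    MemLp f q μ := by
  refine ⟨hf.aestronglyMeasurable, ?_⟩
  rcases eq_or_ne q ⊤ with rfl | hq'
  · rw [eLpNorm_exponent_top]
    exact (eLpNormEssSup_le_of_ae_enorm_bound (.of_forall hB)).trans_lt ENNReal.coe_lt_top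
  · have hp : 1 ≤ q.toReal := by
      rw [← ENNReal.toReal_one]; exact (ENNReal.toReal_le_toReal (by simp) hq').2 hq
    rw [eLpNorm_lt_top_iff_lintegral_rpow_enorm_lt_top (one_pos.trans_le hq).ne' hq']
    calc ∫⁻ z, ‖f z‖ₑ ^ q.toReal ∂μ ≤ ∫⁻ z, (B : ℝ≥0∞) ^ (q.toReal - 1) * ‖f z‖ₑ ∂μ := by
          refine lintegral_mono fun z => ?_
          have h1 : ‖f z‖ₑ ^ q.toReal = ‖f z‖ₑ ^ (q.toReal - 1) * ‖f z‖ₑ := by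
            nth_rewrite 3 [← ENNReal.rpow_one ‖f z‖ₑ]
            rw [← ENNReal.rpow_add_of_nonneg _ _ (by linarith) zero_le_one, sub_add_cancel]
          rw [h1]
          gcongr
          exact hB z
      _ = (B : ℝ≥0∞) ^ (q.toReal - 1) * ∫⁻ z, ‖f z‖ₑ ∂μ :=
          lintegral_const_mul' _ _ (ENNReal.rpow_ne_top_of_nonneg (by linarith)
            ENNReal.coe_ne_top)
      _ < ⊤ := ENNReal.mul_lt_top (ENNReal.rpow_lt_top_of_nonneg (by linarith)
            ENNReal.coe_ne_top) hf.2

end Interpolation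

section Synthesis

variable {V : Type} [NormedAddCommGroup V] [InnerProductSpace ℝ V] [FiniteDimensional ℝ V]
  [MeasurableSpace V] [BorelSpace V]

open Classical in
/-- The distribution `c ∫ F(w) conj(shift h w) dw` with bounded coefficient function `F`, where
`c` is the inverse of the energy of `h`; it is zero if `F` is not essentially bounded. -/
noncomputable def synthesis (h : 𝓢(V, ℂ)) (F : V × V → ℂ) : 𝓢'(V, ℂ) :=
  if hF : MemLp F ⊤ volume then
    invEnergy h • PointwiseConvergenceCLM.precomp ℂ (coef h)
      (Lp.toTemperedDistribution (hF.toLp F))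
  else 0

theorem synthesis_apply (h : 𝓢(V, ℂ)) {F : V × V → ℂ} (hF : MemLp F ⊤ volume) (φ : 𝓢(V, ℂ)) :
    synthesis h F φ = invEnergy h * ∫ w, coef h φ w * F w := by
  rw [synthesis, dif_pos hF]
  change invEnergy h * (Lp.toTemperedDistribution (hF.toLp F)) (coef h φ) = _
  rw [Lp.toTemperedDistribution_apply]
  congr 1
  refine integral_congr_ae ?_
  filter_upwards [hF.coeFn_toLp] with w hw
  rw [hw, smul_eq_mul]

theorem integrable_coef_mul (h : 𝓢(V, ℂ)) {F : V × V → ℂ} (hF : MemLp F ⊤ volume)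
    (φ : 𝓢(V, ℂ)) : Integrable fun w => coef h φ w * F w := by
  refine (Integrable.mul_of_top_right (coef h φ).integrable hF).congr (.of_forall fun w => ?_)
  exact mul_comm _ _

/-- Synthesis followed by analysis is again dominated by convolution with the coefficients of one
window against the other. -/
theorem enorm_synthesis_shift_le (h φ : 𝓢(V, ℂ)) {F : V × V → ℂ} (hF : MemLp F ⊤ volume)
    (u : V × V) : ‖synthesis h F (shift φ u.1 u.2)‖ₑ ≤
      ∫⁻ w, (‖invEnergy h‖ₑ * ‖coef φ h (u - w)‖ₑ) * ‖F w‖ₑ := by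
  rw [synthesis_apply h hF, enorm_mul]
  simp only [mul_assoc]
  rw [lintegral_const_mul' _ _ enorm_ne_top]
  gcongr
  refine (enorm_integral_le_lintegral_enorm _).trans (le_of_eq (lintegral_congr fun w => ?_))
  rw [enorm_mul, ← ofReal_norm (coef h _ w), coef_shift, ofReal_norm]

theorem modNorm_synthesis_le {s : ℝ} (hs : 0 ≤ s) {q : ℝ≥0∞} (hq : 1 ≤ q) (h φ : 𝓢(V, ℂ))
    {F : V × V → ℂ} (hF : MemLp F ⊤ volume) (hm : Measurable F) :
    modNorm s q φ (synthesis h F) ≤ (∫⁻ z, windowKernel s (conjS φ) h z) *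
      eLpNorm (fun w => eweight s w * ‖F w‖ₑ) q volume := by
  have hw := (continuous_eweight (V := V) s).measurable
  have h1 := eLpNorm_convolution_le (μ := (volume : Measure (V × V)))
    (measurable_windowKernel s (conjS φ) h)
    (f := fun w => eweight s w * ‖F w‖ₑ) (by fun_prop) hq
  refine le_trans (eLpNorm_mono_enorm fun u => ?_) h1
  rw [enorm_eq_self, enorm_weightedStft]
  exact weighted_windowKernel_le hs _ _ (F := fun u => ‖stft φ (synthesis h F) u.1 u.2‖ₑ)
    hm.enorm u (enorm_synthesis_shift_le h (conjS φ) hF u)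

theorem stft_coe (g f : 𝓢(V, ℂ)) (z : V × V) :
    stft g (f : 𝓢'(V, ℂ)) z.1 z.2 = coef g f (reflectEquiv V z) := by
  rw [stft, window_eq_shift, SchwartzMap.coe_apply, coef_apply]
  congr 1
  ext y
  have h := congrArg (fun t : 𝓢(V, ℂ) => t y) (conjS_shift g z.1 (-z.2))
  simp only [conjS_apply, neg_neg] at h
  simp only [reflectEquiv_apply, h, smul_eq_mul, mul_comm]

theorem memMod_coe {s : ℝ} {q : ℝ≥0∞} (hq : 1 ≤ q) {g : 𝓢(V, ℂ)}
    (hg : g ≠ 0) (f : 𝓢(V, ℂ)) : MemMod s q (f : 𝓢'(V, ℂ)) := by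
  refine ⟨g, hg, ?_⟩
  set S : 𝓢(V × V, ℂ) := SchwartzMap.compCLMOfContinuousLinearEquiv ℂ (reflectEquiv V) (coef g f)
    with hS
  have hst : ∀ z, ‖weightedStft s g (f : 𝓢'(V, ℂ)) z‖ₑ = eweight s z * ‖S z‖ₑ := fun z => by
    rw [enorm_weightedStft, stft_coe]; rfl
  have hm := (continuous_weightedStft s g (f : 𝓢'(V, ℂ))).aestronglyMeasurable
    (μ := (volume : Measure (V × V)))
  obtain ⟨N, hN⟩ := weight_le_pow (V := V) s
  set B := 2 ^ N * (2 ^ (2 * N) * ((Finset.Iic (2 * N, 0)).sup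
    (schwartzSeminormFamily ℂ (V × V) ℂ)) S) with hB
  refine memLp_of_integrable_of_bound (B := B.toNNReal) ⟨hm, ?_⟩ (fun z => ?_) hq
  · change ∫⁻ z, ‖weightedStft s g (f : 𝓢'(V, ℂ)) z‖ₑ < ⊤
    simp only [hst]
    exact lintegral_eweight_mul_lt_top s S
  · change _ ≤ ENNReal.ofReal B
    rw [hst, eweight, ← ofReal_norm, ← ENNReal.ofReal_mul (weight_pos _ _ _).le]
    refine ENNReal.ofReal_le_ofReal ?_
    have h1 := SchwartzMap.one_add_le_sup_seminorm_apply (𝕜 := ℂ) (m := (2 * N, 0)) le_rfl le_rfl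
      S z
    rw [norm_iteratedFDeriv_zero] at h1
    refine (mul_le_mul_of_nonneg_right (hN z) (norm_nonneg _)).trans ?_
    rw [mul_assoc]
    exact mul_le_mul_of_nonneg_left h1 (by positivity)

theorem isNegInvariant_volume_prod : (volume : Measure (V × V)).IsNegInvariant :=
  inferInstance

variable (V) in
/-- The modulation space `M_s^q`, as a subspace of the tempered distributions. -/
noncomputable def modSpace {s : ℝ} (hs : 0 ≤ s) {q : ℝ≥0∞} (hq : 1 ≤ q) {g : 𝓢(V, ℂ)}
    (hg : g ≠ 0) : Submodule ℂ 𝓢'(V, ℂ) where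
  carrier := {ψ | MemMod s q ψ}
  zero_mem' := by
    refine ⟨g, hg, ?_⟩
    have : weightedStft s g (0 : 𝓢'(V, ℂ)) = fun _ => 0 := by
      ext z
      exact mul_zero _
    rw [this]
    exact MemLp.zero
  add_mem' := fun {ψ χ} hψ hχ => by
    have h1 := (memMod_iff hs hq hg ψ).1 hψ
    have h2 := (memMod_iff hs hq hg χ).1 hχ
    refine (memMod_iff hs hq hg (ψ + χ)).2 ?_
    have e : weightedStft s g (ψ + χ) = weightedStft s g ψ + weightedStft s g χ := by
      ext z
      exact mul_add _ _ _
    rw [modNorm, e]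
    exact (eLpNorm_add_le (continuous_weightedStft s g ψ).aestronglyMeasurable
      (continuous_weightedStft s g χ).aestronglyMeasurable hq).trans_lt
      (ENNReal.add_lt_top.2 ⟨h1, h2⟩)
  smul_mem' := fun a ψ hψ => by
    have h1 := (memMod_iff hs hq hg ψ).1 hψ
    refine (memMod_iff hs hq hg (a • ψ)).2 ?_
    have e : weightedStft s g (a • ψ) = a • weightedStft s g ψ := by
      ext z
      exact mul_left_comm _ _ _
    rw [modNorm, e, eLpNorm_const_smul]
    exact ENNReal.mul_lt_top enorm_lt_top h1

theorem mem_modSpace {s : ℝ} (hs : 0 ≤ s) {q : ℝ≥0∞} (hq : 1 ≤ q) {g : 𝓢(V, ℂ)}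
    (hg : g ≠ 0) (ψ : 𝓢'(V, ℂ)) : ψ ∈ modSpace V hs hq hg ↔ MemMod s q ψ := Iff.rfl

end Synthesis

/-! ### The action of the Weyl matrix on transforms -/

section Transform

variable {n : ℕ} {ħ : ℝ} (hħ : 0 < ħ) (A : 𝓢'(Phase n, ℂ)) (g : 𝓢(Rn n, ℂ))

instance : (volume : Measure (Rn n × Rn n)).IsNegInvariant :=
  isNegInvariant_volume_prod (V := Rn n)

/-- The short-time Fourier transform of `A^w ψ`, as a function of that of `ψ`. -/
noncomputable def weylTransform (ψ : 𝓢'(Rn n, ℂ)) (w : Rn n × Rn n) : ℂ :=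
  invEnergy g * ∫ z : Rn n × Rn n, stft g ψ z.1 z.2 * weylKernel hħ A g w z

theorem continuous_weylKernel_right (w : Rn n × Rn n) :
    Continuous fun z => weylKernel hħ A g w z := by
  have := continuous_weylKernel hħ A g
  generalize weylKernel hħ A g = K at this
  fun_prop

theorem measurable_weylTransform (ψ : 𝓢'(Rn n, ℂ)) : Measurable (weylTransform hħ A g ψ) := by
  have h1 := continuous_weylKernel hħ A g
  have h2 := continuous_stft g ψ
  have h3 : Continuous fun p : (Rn n × Rn n) × (Rn n × Rn n) =>
      stft g ψ p.2.1 p.2.2 * weylKernel hħ A g p.1 p.2 := (h2.comp continuous_snd).mul h1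
  exact (h3.stronglyMeasurable.integral_prod_right'.measurable).const_mul _

variable {hħ A g} {s : ℝ}

theorem lintegral_kernelBound_sub (w : Rn n × Rn n) :
    ∫⁻ z, kernelBound hħ s A g (w - z) = ∫⁻ u, kernelBound hħ s A g u :=
  lintegral_sub_left_eq_self (kernelBound hħ s A g) w

theorem integrable_kernelBound (hA : ∫⁻ u, kernelBound hħ s A g u < ⊤) (w : Rn n × Rn n) :
    Integrable fun z => (kernelBound hħ s A g (w - z)).toReal := by
  refine integrable_toReal_of_lintegral_ne_top ?_ ?_
  · exact ((measurable_kernelBound hħ s A g).comp (measurable_const.sub measurable_id)).aemeasurable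
  · rw [lintegral_kernelBound_sub]; exact hA.ne

/-- The dominating kernel is integrable but may be infinite on a null set, where its real value is
`0`; hence only an almost everywhere bound. -/
theorem ae_norm_weylKernel_le (hs : 0 ≤ s) (hA : ∫⁻ u, kernelBound hħ s A g u < ⊤)
    (w : Rn n × Rn n) :
    ∀ᵐ z, ‖weylKernel hħ A g w z‖ ≤ (kernelBound hħ s A g (w - z)).toReal := by
  have hm : Measurable fun z => kernelBound hħ s A g (w - z) :=
    (measurable_kernelBound hħ s A g).comp (measurable_const.sub measurable_id)
  have hfin : ∫⁻ z, kernelBound hħ s A g (w - z) ≠ ⊤ := by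
    rw [lintegral_kernelBound_sub]; exact hA.ne
  filter_upwards [ae_lt_top hm hfin] with z hz
  rw [← toReal_enorm]
  exact ENNReal.toReal_mono hz.ne (kernel_le hħ hs A g w z)

theorem integrable_stft_mul_weylKernel (hs : 0 ≤ s) (hA : ∫⁻ u, kernelBound hħ s A g u < ⊤)
    {ψ : 𝓢'(Rn n, ℂ)} {M : ℝ} (hM : ∀ z : Rn n × Rn n, ‖stft g ψ z.1 z.2‖ ≤ M)
    (w : Rn n × Rn n) :
    Integrable fun z : Rn n × Rn n => stft g ψ z.1 z.2 * weylKernel hħ A g w z := by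
  refine Integrable.bdd_mul (c := M) ?_ (continuous_stft g ψ).aestronglyMeasurable (.of_forall hM)
  exact (integrable_kernelBound hA w).mono'
    (continuous_weylKernel_right hħ A g w).aestronglyMeasurable
    (ae_norm_weylKernel_le hs hA w)

theorem enorm_weylTransform_le (hs : 0 ≤ s) (ψ : 𝓢'(Rn n, ℂ)) (w : Rn n × Rn n) :
    ‖weylTransform hħ A g ψ w‖ₑ ≤ ‖invEnergy g‖ₑ *
      ∫⁻ z, kernelBound hħ s A g (w - z) * ‖stft g ψ z.1 z.2‖ₑ := by
  rw [weylTransform, enorm_mul]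
  gcongr
  refine (enorm_integral_le_lintegral_enorm _).trans (lintegral_mono fun z => ?_)
  rw [enorm_mul, mul_comm]
  gcongr
  exact kernel_le hħ hs A g w z

theorem norm_weylTransform_le (hs : 0 ≤ s) (hA : ∫⁻ u, kernelBound hħ s A g u < ⊤)
    {ψ : 𝓢'(Rn n, ℂ)} {M : ℝ} (hM : ∀ z : Rn n × Rn n, ‖stft g ψ z.1 z.2‖ ≤ M)
    (w : Rn n × Rn n) : ‖weylTransform hħ A g ψ w‖ ≤
      (‖invEnergy g‖ₑ * ((∫⁻ u, kernelBound hħ s A g u) * ENNReal.ofReal M)).toReal := by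
  rw [← toReal_enorm]
  refine ENNReal.toReal_mono (ENNReal.mul_lt_top enorm_lt_top
    (ENNReal.mul_lt_top hA ENNReal.ofReal_lt_top)).ne ?_
  refine (enorm_weylTransform_le hs ψ w).trans ?_
  gcongr
  rw [← lintegral_kernelBound_sub w, ← lintegral_mul_const' _ _ ENNReal.ofReal_ne_top]
  gcongr with z
  rw [← ofReal_norm]
  exact ENNReal.ofReal_le_ofReal (hM z)

theorem memLp_weylTransform (hs : 0 ≤ s) (hA : ∫⁻ u, kernelBound hħ s A g u < ⊤)
    {ψ : 𝓢'(Rn n, ℂ)} {M : ℝ} (hM : ∀ z : Rn n × Rn n, ‖stft g ψ z.1 z.2‖ ≤ M) :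
    MemLp (weylTransform hħ A g ψ) ⊤ volume :=
  memLp_top_of_bound (measurable_weylTransform hħ A g ψ).aestronglyMeasurable _
    (.of_forall (norm_weylTransform_le hs hA hM))

/-- The weight is moved through the matrix by `eweight_mul_kernel_le`, and Young's inequality does
the rest. -/
theorem eLpNorm_weylTransform_le (hs : 0 ≤ s) {q : ℝ≥0∞} (hq : 1 ≤ q) (ψ : 𝓢'(Rn n, ℂ)) :
    eLpNorm (fun w => eweight s w * ‖weylTransform hħ A g ψ w‖ₑ) q volume ≤
      ‖invEnergy g‖ₑ * (∫⁻ u, kernelBound hħ s A g u) * modNorm s q g ψ := by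
  have hkm := measurable_kernelBound hħ s A g
  have h1 := eLpNorm_convolution_le (μ := (volume : Measure (Rn n × Rn n)))
    (h := fun u => ‖invEnergy g‖ₑ * kernelBound hħ s A g u)
    (f := fun z => ‖weightedStft s g ψ z‖ₑ) (by fun_prop)
    (continuous_weightedStft s g ψ).measurable.enorm hq
  rw [eLpNorm_enorm, lintegral_const_mul _ hkm] at h1
  refine le_trans (eLpNorm_mono_enorm fun w => ?_) h1
  rw [enorm_eq_self, enorm_eq_self, weylTransform, enorm_mul]
  simp only [mul_assoc]
  rw [lintegral_const_mul' _ _ enorm_ne_top, mul_left_comm]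
  gcongr
  calc eweight s w * ‖∫ z : Rn n × Rn n, stft g ψ z.1 z.2 * weylKernel hħ A g w z‖ₑ
      ≤ eweight s w * ∫⁻ z : Rn n × Rn n, ‖stft g ψ z.1 z.2 * weylKernel hħ A g w z‖ₑ := by
        gcongr
        exact enorm_integral_le_lintegral_enorm _
    _ = ∫⁻ z : Rn n × Rn n, eweight s w * ‖stft g ψ z.1 z.2 * weylKernel hħ A g w z‖ₑ :=
        (lintegral_const_mul' _ _ (eweight_ne_top s w)).symm
    _ ≤ _ := by
        refine lintegral_mono fun z => ?_
        rw [enorm_mul, enorm_weightedStft]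
        calc _ = (eweight s w * ‖weylKernel hħ A g w z‖ₑ) * ‖stft g ψ z.1 z.2‖ₑ := by ring
          _ ≤ (kernelBound hħ s A g (w - z) * eweight s z) * ‖stft g ψ z.1 z.2‖ₑ :=
            mul_le_mul_left (eweight_mul_kernel_le hħ hs A g w z) _
          _ = _ := by ring

/-- The inversion formula is used twice: `φ` is expanded in atoms with window `conjS g`, then `f` in
atoms with window `g`. The reflection of the frequency accounts for the conjugation that relates
`coef g f` to the short-time Fourier transform. -/
theorem weylOp_eq_integral (hg : g ≠ 0) (f φ : 𝓢(Rn n, ℂ)) :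
    weylOp ħ hħ A f φ = invEnergy (conjS g) *
      ∫ w, coef (conjS g) φ w * weylTransform hħ A g (f : 𝓢'(Rn n, ℂ)) w := by
  rw [apply_eq_integral_coef (conjS_ne_zero hg)]
  congr 2
  ext w
  congr 1
  rw [← weylDual_apply, apply_eq_integral_coef hg, weylTransform,
    ← measurePreserving_reflectEquiv.integral_comp
      (reflectEquiv (Rn n)).toHomeomorph.measurableEmbedding]
  congr 2
  ext z
  rw [stft_coe, weylDual_apply]
  rfl

end Transform

/-! ### The extension to modulation spaces -/

section Operator

variable {n : ℕ} {ħ : ℝ} {hħ : 0 < ħ} {A : 𝓢'(Phase n, ℂ)} {g : 𝓢(Rn n, ℂ)} {s : ℝ} {q : ℝ≥0∞}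

theorem exists_norm_stft_le (hs : 0 ≤ s) (hq : 1 ≤ q) (hg : g ≠ 0) {ψ : 𝓢'(Rn n, ℂ)}
    (hψ : MemMod s q ψ) : ∃ M : ℝ, ∀ z : Rn n × Rn n, ‖stft g ψ z.1 z.2‖ ≤ M := by
  obtain ⟨C, hC⟩ := exists_enorm_stft_le (V := Rn n) hs hq hg g
  refine ⟨(C * modNorm s q g ψ).toReal, fun z => ?_⟩
  rw [← toReal_enorm]
  exact ENNReal.toReal_mono (ENNReal.mul_lt_top ENNReal.coe_lt_top
    ((memMod_iff hs hq hg ψ).1 hψ)).ne (hC ψ z)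

theorem MemMod.memLp_weylTransform (hs : 0 ≤ s) (hq : 1 ≤ q) (hg : g ≠ 0)
    (hA : ∫⁻ u, kernelBound hħ s A g u < ⊤) {ψ : 𝓢'(Rn n, ℂ)} (hψ : MemMod s q ψ) :
    MemLp (weylTransform hħ A g ψ) ⊤ volume := by
  obtain ⟨M, hM⟩ := exists_norm_stft_le hs hq hg hψ
  exact WeylModulation.memLp_weylTransform hs hA hM

theorem MemMod.weylTransform_add (hs : 0 ≤ s) (hq : 1 ≤ q) (hg : g ≠ 0)
    (hA : ∫⁻ u, kernelBound hħ s A g u < ⊤) {ψ χ : 𝓢'(Rn n, ℂ)} (hψ : MemMod s q ψ)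
    (hχ : MemMod s q χ) (w : Rn n × Rn n) : weylTransform hħ A g (ψ + χ) w =
      weylTransform hħ A g ψ w + weylTransform hħ A g χ w := by
  obtain ⟨M, hM⟩ := exists_norm_stft_le hs hq hg hψ
  obtain ⟨N, hN⟩ := exists_norm_stft_le hs hq hg hχ
  simp only [weylTransform]
  rw [← mul_add, ← integral_add (integrable_stft_mul_weylKernel hs hA hM w)
    (integrable_stft_mul_weylKernel hs hA hN w)]
  congr 2
  ext z
  exact add_mul _ _ _

theorem weylTransform_smul (a : ℂ) (ψ : 𝓢'(Rn n, ℂ)) (w : Rn n × Rn n) :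
    weylTransform hħ A g (a • ψ) w = a * weylTransform hħ A g ψ w := by
  have h : ∀ z : Rn n × Rn n, stft g (a • ψ) z.1 z.2 * weylKernel hħ A g w z =
      a * (stft g ψ z.1 z.2 * weylKernel hħ A g w z) := fun z => mul_assoc _ _ _
  simp only [weylTransform, h]
  rw [integral_const_mul, mul_left_comm]

/-- The Weyl operator on the modulation space `M_s^q`. -/
noncomputable def weylExtension (hs : 0 ≤ s) (hq : 1 ≤ q) (hg : g ≠ 0)
    (hA : ∫⁻ u, kernelBound hħ s A g u < ⊤) : 𝓢'(Rn n, ℂ) →ₗ.[ℂ] 𝓢'(Rn n, ℂ) where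
  domain := modSpace (Rn n) hs hq hg
  toFun :=
    -- The transform of an element of `M_s^q` is bounded, so the matrix integral and the synthesis
    -- both make sense, also when `q = ∞` and Schwartz functions are not dense in norm.
    { toFun := fun ψ => synthesis (conjS g) (weylTransform hħ A g ψ)
      map_add' := fun ψ χ => by
        ext φ
        have h1 := MemMod.memLp_weylTransform hs hq hg hA ψ.2
        have h2 := MemMod.memLp_weylTransform hs hq hg hA χ.2
        have h3 := MemMod.memLp_weylTransform hs hq hg hA (ψ + χ).2
        change synthesis _ _ φ = synthesis _ _ φ + synthesis _ _ φ
        rw [synthesis_apply _ h1, synthesis_apply _ h2, synthesis_apply _ h3, ← mul_add,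
          ← integral_add (integrable_coef_mul _ h1 φ) (integrable_coef_mul _ h2 φ)]
        congr 2
        ext w
        rw [← mul_add]
        congr 1
        exact MemMod.weylTransform_add hs hq hg hA ψ.2 χ.2 w
      map_smul' := fun a ψ => by
        ext φ
        have h1 := MemMod.memLp_weylTransform hs hq hg hA ψ.2
        have h3 := MemMod.memLp_weylTransform hs hq hg hA (a • ψ).2
        change synthesis _ _ φ = a * synthesis _ _ φ
        rw [synthesis_apply _ h1, synthesis_apply _ h3, mul_left_comm]
        congr 1
        rw [← integral_const_mul]
        congr 1
        ext w
        rw [mul_left_comm]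
        congr 1
        exact weylTransform_smul a _ w }

theorem weylExtension_apply (hs : 0 ≤ s) (hq : 1 ≤ q) (hg : g ≠ 0)
    (hA : ∫⁻ u, kernelBound hħ s A g u < ⊤) (ψ : (weylExtension hs hq hg hA).domain)
    (φ : 𝓢(Rn n, ℂ)) : weylExtension hs hq hg hA ψ φ = invEnergy (conjS g) *
      ∫ w, coef (conjS g) φ w * weylTransform hħ A g ψ w :=
  synthesis_apply _ (MemMod.memLp_weylTransform hs hq hg hA ψ.2) φ

theorem modNorm_weylExtension_le (hs : 0 ≤ s) (hq : 1 ≤ q) (hg : g ≠ 0)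
    (hA : ∫⁻ u, kernelBound hħ s A g u < ⊤) (ψ : (weylExtension hs hq hg hA).domain) :
    modNorm s q g (weylExtension hs hq hg hA ψ) ≤
      (∫⁻ z, windowKernel s (conjS g) (conjS g) z) *
        (‖invEnergy g‖ₑ * (∫⁻ u, kernelBound hħ s A g u) *
          modNorm s q g (ψ : 𝓢'(Rn n, ℂ))) := by
  refine (modNorm_synthesis_le hs hq (conjS g) g
    (MemMod.memLp_weylTransform hs hq hg hA ψ.2) (measurable_weylTransform hħ A g _)).trans ?_
  gcongr
  exact eLpNorm_weylTransform_le hs hq _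

/-- Convergence in `𝓢'` gives pointwise convergence of the transforms, and the uniform bound times
the integrable kernel dominates. -/
theorem tendsto_weylTransform (hs : 0 ≤ s) (hA : ∫⁻ u, kernelBound hħ s A g u < ⊤) {M : ℝ}
    {u : ℕ → 𝓢'(Rn n, ℂ)} {v : 𝓢'(Rn n, ℂ)}
    (hM : ∀ k, ∀ z : Rn n × Rn n, ‖stft g (u k) z.1 z.2‖ ≤ M)
    (hu : Filter.Tendsto u Filter.atTop (nhds v)) (w : Rn n × Rn n) :
    Filter.Tendsto (fun k => weylTransform hħ A g (u k) w) Filter.atTop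
      (nhds (weylTransform hħ A g v w)) := by
  refine Filter.Tendsto.const_mul _ ?_
  refine tendsto_integral_of_dominated_convergence
    (fun z => M * (kernelBound hħ s A g (w - z)).toReal) (fun k => ?_)
    ((integrable_kernelBound hA w).const_mul M) (fun k => ?_) (.of_forall fun z => ?_)
  · exact ((continuous_stft g (u k)).mul
      (continuous_weylKernel_right hħ A g w)).aestronglyMeasurable
  · filter_upwards [ae_norm_weylKernel_le hs hA w] with z hz
    rw [norm_mul]
    exact mul_le_mul (hM k z) hz (norm_nonneg _) ((norm_nonneg _).trans (hM k z))
  · refine Filter.Tendsto.mul_const _ ?_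
    exact (PointwiseConvergenceCLM.tendsto_iff_forall_tendsto.1 hu) (window g z.1 z.2)

/-- Agreement on Schwartz functions is the double expansion `weylOp_eq_integral`. For continuity, a
bound in `M_s^q` with respect to any window bounds the transforms for the window `g` uniformly,
after which dominated convergence applies to the matrix and then to the synthesis. -/
theorem isWeylOperatorOn_weylExtension (hs : 0 ≤ s) (hq : 1 ≤ q) (hg : g ≠ 0)
    (hA : ∫⁻ u, kernelBound hħ s A g u < ⊤) :
    IsWeylOperatorOn ħ hħ A s q (weylExtension hs hq hg hA) where
  mem_domain_iff := fun ψ => mem_modSpace hs hq hg ψ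
  mapsTo := fun ψ => by
    refine (memMod_iff hs hq hg _).2 ((modNorm_weylExtension_le hs hq hg hA ψ).trans_lt ?_)
    exact ENNReal.mul_lt_top (lintegral_windowKernel_lt_top s _ _)
      (ENNReal.mul_lt_top (ENNReal.mul_lt_top enorm_lt_top hA) ((memMod_iff hs hq hg _).1 ψ.2))
  eq_weylOp := fun f => ⟨memMod_coe hq hg f, by
    ext φ
    rw [weylExtension_apply]
    exact (weylOp_eq_integral hg f φ).symm⟩
  tendsto := fun φ hφ R u v hR hu => by
    refine PointwiseConvergenceCLM.tendsto_iff_forall_tendsto.2 fun χ => ?_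
    simp only [weylExtension_apply]
    obtain ⟨C, hC⟩ := exists_enorm_stft_le (V := Rn n) hs hq hφ g
    have hM : ∀ k, ∀ z : Rn n × Rn n,
        ‖stft g (u k : 𝓢'(Rn n, ℂ)) z.1 z.2‖ ≤ ((C * R : ℝ≥0) : ℝ) := fun k z => by
      have h1 : ‖stft g (u k : 𝓢'(Rn n, ℂ)) z.1 z.2‖ₑ ≤ ((C * R : ℝ≥0) : ℝ≥0∞) := by
        rw [ENNReal.coe_mul]
        exact (hC _ z).trans (by gcongr; exact hR k)
      rw [← toReal_enorm]
      exact ENNReal.toReal_mono ENNReal.coe_ne_top h1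
    refine Filter.Tendsto.const_mul _ ?_
    refine tendsto_integral_of_dominated_convergence (fun w => ‖coef (conjS g) χ w‖ *
      (‖invEnergy g‖ₑ * ((∫⁻ u, kernelBound hħ s A g u) *
        ENNReal.ofReal ((C * R : ℝ≥0) : ℝ))).toReal) (fun k => ?_)
      ((coef (conjS g) χ).integrable.norm.mul_const _) (fun k => .of_forall fun w => ?_)
      (.of_forall fun w => ?_)
    · exact (coef (conjS g) χ).continuous.aestronglyMeasurable.mul
        (measurable_weylTransform hħ A g _).aestronglyMeasurable
    · rw [norm_mul]
      gcongr
      exact norm_weylTransform_le hs hA (hM k) w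
    · exact (tendsto_weylTransform hs hA hM hu w).const_mul _

theorem exists_weylOperatorOn_bound (hħ : 0 < ħ) (hs : 0 ≤ s) {Φ : 𝓢(Phase n, ℂ)} (hΦ : Φ ≠ 0)
    {φ : 𝓢(Rn n, ℂ)} (hφ : φ ≠ 0) :
    ∃ C : ℝ≥0, 0 < C ∧ ∀ A : 𝓢'(Phase n, ℂ), MemSymbol s A → ∀ q : ℝ≥0∞, 1 ≤ q →
      ∃ T : 𝓢'(Rn n, ℂ) →ₗ.[ℂ] 𝓢'(Rn n, ℂ), IsWeylOperatorOn ħ hħ A s q T ∧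
        ∀ ψ : T.domain, modNorm s q φ (T ψ) ≤
          C * symbolNorm s Φ A * modNorm s q φ (ψ : 𝓢'(Rn n, ℂ)) := by
  obtain ⟨C, hC⟩ := exists_lintegral_kernelBound (n := n) hħ s
  set a := ∫⁻ z, windowKernel s (conjS φ) (conjS φ) z with ha
  set b := ∫⁻ z, windowKernel s (conjS (phaseWindow hħ φ)) (conjS Φ) z with hb
  have hfin : a * (‖invEnergy φ‖ₑ * (C * b)) < ⊤ :=
    ENNReal.mul_lt_top (lintegral_windowKernel_lt_top s _ _)
      (ENNReal.mul_lt_top enorm_lt_top (ENNReal.mul_lt_top ENNReal.coe_lt_top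
        (lintegral_windowKernel_lt_top s _ _)))
  -- The operator is built with the given window `φ` itself, so the constant involves only the
  -- synthesis kernel, the energy, the change of variables and the passage from `Φ` to `phaseWindow
  -- hħ φ`. The summand `1` only ensures positivity.
  refine ⟨(a * (‖invEnergy φ‖ₑ * (C * b))).toNNReal + 1, by positivity, fun A hA q hq => ?_⟩
  have hkb : ∫⁻ u, kernelBound hħ s A φ u < ⊤ := by
    obtain ⟨Φ', hΦ', h⟩ := hA
    exact (hC A φ).trans_lt (ENNReal.mul_lt_top ENNReal.coe_lt_top
      ((symbolNorm_le hs hΦ' _ A).trans_lt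
        (ENNReal.mul_lt_top (lintegral_windowKernel_lt_top s _ _) h)))
  refine ⟨weylExtension hs hq hφ hkb, isWeylOperatorOn_weylExtension hs hq hφ hkb, fun ψ => ?_⟩
  refine (modNorm_weylExtension_le hs hq hφ hkb ψ).trans ?_
  rw [← mul_assoc]
  refine mul_le_mul_left ?_ _
  calc a * (‖invEnergy φ‖ₑ * ∫⁻ u, kernelBound hħ s A φ u)
      ≤ a * (‖invEnergy φ‖ₑ * (C * (b * symbolNorm s Φ A))) := by
        gcongr
        exact (hC A φ).trans (by gcongr; exact symbolNorm_le hs hΦ _ A)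
    _ = (a * (‖invEnergy φ‖ₑ * (C * b))) * symbolNorm s Φ A := by ring
    _ ≤ _ := by
        refine mul_le_mul_left ?_ _
        rw [ENNReal.coe_add, ENNReal.coe_toNNReal hfin.ne]
        exact le_self_add

end Operator

/-! ### Symbols with bounded derivatives -/

theorem eweight_zero {E : Type} [NormedAddCommGroup E] (z : E × E) : eweight 0 z = 1 := by
  simp [eweight, weight]

theorem exists_schwartz_ne_zero (V : Type) [NormedAddCommGroup V] [InnerProductSpace ℝ V]
    [FiniteDimensional ℝ V] : ∃ g : 𝓢(V, ℂ), g ≠ 0 := by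
  let b : ContDiffBump (0 : V) := ⟨1, 2, one_pos, one_lt_two⟩
  have hc : HasCompactSupport fun x => (b x : ℂ) :=
    b.hasCompactSupport.comp_left (g := Complex.ofReal) Complex.ofReal_zero
  have hs : ContDiff ℝ ∞ fun x => (b x : ℂ) := Complex.ofRealCLM.contDiff.comp b.contDiff
  refine ⟨hc.toSchwartzMap hs, fun h => ?_⟩
  have h0 := congrArg (fun g : 𝓢(V, ℂ) => g 0) h
  simp only [HasCompactSupport.toSchwartzMap_toFun, zero_apply] at h0
  have h1 : b 0 = 1 := b.one_of_mem_closedBall (Metric.mem_closedBall_self b.rIn_pos.le)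
  simp [h1] at h0

section SmoothSymbol

variable {V : Type} [NormedAddCommGroup V] [InnerProductSpace ℝ V] [FiniteDimensional ℝ V]
  [MeasurableSpace V] [BorelSpace V]

/-- The constant in the estimate of `j` derivatives of the product of `h` with a function. -/
noncomputable def leibnizConst (h : 𝓢(V, ℂ)) (j : ℕ) : ℝ :=
  ∑ i ∈ Finset.range (j + 1), (j.choose i : ℝ) * ∫ y, ‖iteratedFDeriv ℝ i h y‖

theorem leibnizConst_nonneg (h : 𝓢(V, ℂ)) (j : ℕ) : 0 ≤ leibnizConst h j :=
  Finset.sum_nonneg fun _ _ => mul_nonneg (by positivity) (integral_nonneg fun _ => norm_nonneg _)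

theorem integrable_norm_iteratedFDeriv_translate (h : 𝓢(V, ℂ)) (x : V) (i : ℕ) :
    Integrable fun y => ‖iteratedFDeriv ℝ i h (y - x)‖ := by
  have := SchwartzMap.integrable_pow_mul_iteratedFDeriv volume h 0 i
  simp only [pow_zero, one_mul] at this
  exact this.comp_sub_right x

/-- Leibniz: derivatives of the window are integrable and those of `a` are bounded by `K`.
Translation invariance makes the bound uniform in `x`. -/
theorem integral_norm_iteratedFDeriv_mul_le (h : 𝓢(V, ℂ)) {a : V → ℂ} {N : ℕ} {K : ℝ}
    (ha : ContDiff ℝ N a) (hK : ∀ k ≤ N, ∀ z, ‖iteratedFDeriv ℝ k a z‖ ≤ K) (x : V) {j : ℕ}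
    (hj : j ≤ N) :
    Integrable (fun y => ‖iteratedFDeriv ℝ j (fun y => h (y - x) * a y) y‖) ∧
      ∫ y, ‖iteratedFDeriv ℝ j (fun y => h (y - x) * a y) y‖ ≤ K * leibnizConst h j := by
  have hs : ContDiff ℝ N fun y => h (y - x) :=
    (h.smooth N).comp (contDiff_id.sub contDiff_const)
  have hle : ∀ y, ‖iteratedFDeriv ℝ j (fun y => h (y - x) * a y) y‖ ≤
      ∑ i ∈ Finset.range (j + 1), (j.choose i : ℝ) * ‖iteratedFDeriv ℝ i h (y - x)‖ * K :=
    fun y => by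
      refine (norm_iteratedFDeriv_mul_le hs ha y (by exact_mod_cast hj)).trans
        (Finset.sum_le_sum fun i _ => ?_)
      rw [iteratedFDeriv_comp_sub]
      gcongr
      exact hK _ ((Nat.sub_le j i).trans hj) y
  have hi : ∀ i ∈ Finset.range (j + 1), Integrable fun y =>
      (j.choose i : ℝ) * ‖iteratedFDeriv ℝ i h (y - x)‖ * K := fun i _ =>
    ((integrable_norm_iteratedFDeriv_translate h x i).const_mul _).mul_const _
  have hc : Continuous fun y => ‖iteratedFDeriv ℝ j (fun y => h (y - x) * a y) y‖ :=
    ((hs.mul ha).continuous_iteratedFDeriv (by exact_mod_cast hj)).norm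
  have hint := (integrable_finsetSum _ hi).mono' hc.aestronglyMeasurable
    (.of_forall fun y => by rw [norm_norm]; exact hle y)
  refine ⟨hint, (integral_mono hint (integrable_finsetSum _ hi) hle).trans (le_of_eq ?_)⟩
  rw [integral_finsetSum _ hi, leibnizConst, Finset.mul_sum]
  refine Finset.sum_congr rfl fun i _ => ?_
  rw [integral_mul_const, integral_const_mul,
    integral_sub_right_eq_self (fun y => ‖iteratedFDeriv ℝ i h y‖) x, mul_comm]

/-- Powers of `‖ζ‖` are traded for derivatives of the localized symbol. One `2 ^ N` comes from `(1 +
‖ζ‖) ^ N ≤ 2 ^ N * (1 + ‖ζ‖ ^ N)`, another from the Fourier estimate, and the factor `2` from the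
two terms, of order `0` and `N`. -/
theorem one_add_pow_mul_norm_fourier_le (h : 𝓢(V, ℂ)) {a : V → ℂ} {N : ℕ} {K : ℝ}
    (ha : ContDiff ℝ N a) (hK : ∀ k ≤ N, ∀ z, ‖iteratedFDeriv ℝ k a z‖ ≤ K) (x ζ : V) :
    (1 + ‖ζ‖) ^ N * ‖𝓕 (fun y => h (y - x) * a y) ζ‖ ≤
      4 ^ N * 2 * ∑ j ∈ Finset.range (N + 1), leibnizConst h j * K := by
  set f : V → ℂ := fun y => h (y - x) * a y with hf
  have hK0 : 0 ≤ K := (norm_nonneg _).trans (hK 0 (Nat.zero_le _) 0)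
  have hs : ContDiff ℝ N f := ((h.smooth N).comp (contDiff_id.sub contDiff_const)).mul ha
  have hpow : ∀ n ≤ N, ‖ζ‖ ^ n * ‖𝓕 f ζ‖ ≤
      2 ^ N * ∑ j ∈ Finset.range (N + 1), leibnizConst h j * K := fun n hn => by
    have := Real.pow_mul_norm_iteratedFDeriv_fourier_le (K := 0) (N := N) (f := f)
      (by exact_mod_cast hs) (fun k j hk hj => by
        obtain rfl : k = 0 := by simpa using hk
        simpa using (integral_norm_iteratedFDeriv_mul_le h ha hK x
          (by exact_mod_cast hj : j ≤ N)).1)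
      (k := 0) (n := n) le_rfl (by exact_mod_cast hn) ζ
    rw [norm_iteratedFDeriv_zero] at this
    refine this.trans ?_
    rw [pow_zero, one_mul]
    simp only [zero_add, Finset.range_one, Finset.singleton_product, Finset.sum_map,
      Function.Embedding.coeFn_mk, pow_zero, one_mul]
    norm_num
    refine mul_le_mul (pow_le_pow_right₀ one_le_two hn) ?_
      (Finset.sum_nonneg fun _ _ => integral_nonneg fun _ => norm_nonneg _) (by positivity)
    refine (Finset.sum_le_sum_of_subset_of_nonneg
      (Finset.range_mono (Nat.succ_le_succ hn))
      fun _ _ _ => integral_nonneg fun _ => norm_nonneg _).trans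
      (Finset.sum_le_sum fun j hj => ?_)
    rw [mul_comm]
    exact (integral_norm_iteratedFDeriv_mul_le h ha hK x
      (Nat.lt_succ_iff.1 (Finset.mem_range.1 hj))).2
  set S := ∑ j ∈ Finset.range (N + 1), leibnizConst h j * K with hS
  have hS0 : 0 ≤ S := Finset.sum_nonneg fun j _ => mul_nonneg (leibnizConst_nonneg h j) hK0
  have h0 := hpow 0 (Nat.zero_le _)
  have hN := hpow N le_rfl
  have h2 : (1 + ‖ζ‖) ^ N ≤ 2 ^ N * (1 + ‖ζ‖ ^ N) := by
    refine (add_pow_le zero_le_one (norm_nonneg ζ) N).trans ?_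
    rw [one_pow]
    gcongr
    · exact one_le_two
    · exact Nat.sub_le _ _
  calc (1 + ‖ζ‖) ^ N * ‖𝓕 f ζ‖ ≤ 2 ^ N * (1 + ‖ζ‖ ^ N) * ‖𝓕 f ζ‖ := by gcongr
    _ = 2 ^ N * (‖ζ‖ ^ 0 * ‖𝓕 f ζ‖ + ‖ζ‖ ^ N * ‖𝓕 f ζ‖) := by ring
    _ ≤ 2 ^ N * (2 ^ N * S + 2 ^ N * S) := by gcongr
    _ = 4 ^ N * 2 * S := by
      rw [show (4 : ℝ) = 2 * 2 by norm_num, mul_pow]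
      ring

theorem stft_eq_fourier (Φ : 𝓢(V, ℂ)) {A : 𝓢'(V, ℂ)} {a : V → ℂ}
    (hA : ∀ f : 𝓢(V, ℂ), A f = ∫ z, f z * a z) (z ζ : V) :
    stft Φ A z ζ = 𝓕 (fun y => conjS Φ (y - z) * a y) ζ := by
  rw [stft, hA, Real.fourier_eq]
  congr 1
  ext y
  rw [window_eq_shift, shift_apply, Circle.smul_def, smul_eq_mul, mul_assoc]

/-- The transform of a function symbol is the Fourier transform of the localized symbol; its decay
of order `N` is uniform in position and integrable because `N` exceeds the dimension. -/
theorem exists_symbolNorm_le_of_contDiff (Φ : 𝓢(V, ℂ)) {N : ℕ} (hN : Module.finrank ℝ V < N) :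
    ∃ C : ℝ≥0, ∀ a : V → ℂ, ContDiff ℝ N a → ∀ K : ℝ,
      (∀ k ≤ N, ∀ z, ‖iteratedFDeriv ℝ k a z‖ ≤ K) → ∀ A : 𝓢'(V, ℂ),
        (∀ f : 𝓢(V, ℂ), A f = ∫ z, f z * a z) →
          symbolNorm 0 Φ A ≤ C * ENNReal.ofReal K := by
  set D := 4 ^ N * 2 * ∑ j ∈ Finset.range (N + 1), leibnizConst (conjS Φ) j with hD
  have hD0 : 0 ≤ D := mul_nonneg (by positivity)
    (Finset.sum_nonneg fun j _ => leibnizConst_nonneg _ j)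
  have hi : Integrable fun ζ : V => (1 + ‖ζ‖) ^ (-(N : ℝ)) :=
    integrable_one_add_norm (by exact_mod_cast hN)
  have hI : ∫⁻ ζ : V, ENNReal.ofReal ((1 + ‖ζ‖) ^ (-(N : ℝ))) < ⊤ := hi.lintegral_lt_top
  refine ⟨(ENNReal.ofReal D * ∫⁻ ζ : V, ENNReal.ofReal ((1 + ‖ζ‖) ^ (-(N : ℝ)))).toNNReal,
    fun a ha K hK A hA => ?_⟩
  have hK0 : 0 ≤ K := (norm_nonneg _).trans (hK 0 (Nat.zero_le _) 0)
  rw [ENNReal.coe_toNNReal (ENNReal.mul_lt_top ENNReal.ofReal_lt_top hI).ne]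
  have hle : ∀ ζ, ⨆ z, ‖weightedStft 0 Φ A (z, ζ)‖ₑ ≤
      ENNReal.ofReal (D * K) * ENNReal.ofReal ((1 + ‖ζ‖) ^ (-(N : ℝ))) := fun ζ => by
    refine iSup_le fun z => ?_
    rw [enorm_weightedStft, eweight_zero, one_mul, stft_eq_fourier Φ hA, ← ofReal_norm,
      ← ENNReal.ofReal_mul (by positivity)]
    refine ENNReal.ofReal_le_ofReal ?_
    rw [Real.rpow_neg (by positivity), Real.rpow_natCast, ← div_eq_mul_inv,
      le_div_iff₀ (by positivity), mul_comm]
    refine (one_add_pow_mul_norm_fourier_le (conjS Φ) ha hK z ζ).trans (le_of_eq ?_)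
    rw [hD, ← Finset.sum_mul, mul_assoc]
    ring
  refine (lintegral_mono hle).trans (le_of_eq ?_)
  rw [lintegral_const_mul' _ _ ENNReal.ofReal_ne_top, ENNReal.ofReal_mul hD0]
  ring

end SmoothSymbol

/-! ### From phase space to `L²` -/

theorem enorm_integral_mul_le {α : Type*} [MeasurableSpace α] {μ : Measure α} {F G : α → ℂ}
    (hF : AEStronglyMeasurable F μ) (hG : AEStronglyMeasurable G μ) :
    ‖∫ x, F x * G x ∂μ‖ₑ ≤ eLpNorm F 2 μ * eLpNorm G 2 μ := by
  refine (enorm_integral_le_lintegral_enorm _).trans ?_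
  rw [← eLpNorm_one_eq_lintegral_enorm]
  rw [show (fun a => F a * G a) = F • G from rfl]
  exact eLpNorm_smul_le_mul_eLpNorm hG hF

section SquareIntegrable

variable {V : Type} [NormedAddCommGroup V] [InnerProductSpace ℝ V] [FiniteDimensional ℝ V]
  [MeasurableSpace V] [BorelSpace V]

theorem norm_toLp_two {E : Type} [NormedAddCommGroup E] [NormedSpace ℝ E] [FiniteDimensional ℝ E]
    [MeasurableSpace E] [BorelSpace E] {μ : Measure E} [μ.HasTemperateGrowth] (f : 𝓢(E, ℂ)) :
    ‖f.toLp 2 μ‖ = √(∫ x, ‖f x‖ ^ 2 ∂μ) := by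
  rw [SchwartzMap.norm_toLp' two_ne_zero ENNReal.ofNat_ne_top, Real.sqrt_eq_rpow]
  norm_num

theorem eLpNorm_coef_two (h φ : 𝓢(V, ℂ)) : eLpNorm (coef h φ) 2 volume =
    ENNReal.ofReal (√(energy h)) * ‖φ.toLp 2 volume‖ₑ := by
  have h0 : 0 ≤ energy h := integral_nonneg fun _ => by positivity
  have h1 : ‖(coef h φ).toLp 2 volume‖ = √(energy h) * ‖φ.toLp 2 volume‖ := by
    rw [norm_toLp_two, norm_toLp_two, integral_norm_sq_coef, Real.sqrt_mul h0]
    rfl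
  rw [← ofReal_norm, ← ENNReal.ofReal_mul (Real.sqrt_nonneg _), ← h1, SchwartzMap.norm_toLp,
    ENNReal.ofReal_toReal ((coef h φ).memLp 2 volume).eLpNorm_ne_top]

/-- Plancherel: for `s = 0` and `q = 2` the modulation norm is a multiple of the `L²` norm. -/
theorem modNorm_zero_two_coe (g f : 𝓢(V, ℂ)) : modNorm 0 2 g (f : 𝓢'(V, ℂ)) =
    ENNReal.ofReal (√(energy g)) * ‖f.toLp 2 volume‖ₑ := by
  rw [← eLpNorm_coef_two, ← eLpNorm_comp_measurePreserving
    (coef g f).continuous.aestronglyMeasurable (measurePreserving_reflectEquiv (V := V))]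
  refine eLpNorm_congr_enorm_ae (.of_forall fun z => ?_)
  rw [enorm_weightedStft, eweight_zero, one_mul, stft_coe]
  rfl

/-- A sesquilinear form on Schwartz functions which is bounded in `L²` is given by a bounded
operator. -/
theorem exists_clm_of_bound {D : ℝ} (hD : 0 ≤ D) (B : 𝓢(V, ℂ) →ₗ[ℂ] 𝓢'(V, ℂ))
    (hB : ∀ f φ, ‖B f φ‖ ≤ D * ‖f.toLp 2 volume‖ * ‖φ.toLp 2 volume‖) :
    ∃ T : Lp ℂ 2 (volume : Measure V) →L[ℂ] Lp ℂ 2 (volume : Measure V), ‖T‖ ≤ D ∧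
      ∀ f : 𝓢(V, ℂ), Lp.toTemperedDistribution (T (f.toLp 2 volume)) = B f := by
  set e : 𝓢(V, ℂ) →ₗ[ℂ] Lp ℂ 2 (volume : Measure V) :=
    (toLpCLM ℂ ℂ 2 (volume : Measure V)).toLinearMap with he
  have hdense : DenseRange e := SchwartzMap.denseRange_toLpCLM ENNReal.ofNat_ne_top
  have key : ∀ f, ∃ u : Lp ℂ 2 (volume : Measure V), ‖u‖ ≤ D * ‖e f‖ ∧
      Lp.toTemperedDistribution u = B f := fun f => by
    -- For fixed `f` the functional extends from the dense Schwartz functions to `L²`, and Riesz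
    -- gives a representing vector `v`. The pairing in `B f φ` is bilinear while the inner product
    -- conjugates `v`, so the required element is `star v`.
    set Λ : StrongDual ℂ (Lp ℂ 2 (volume : Measure V)) :=
      (B f).toLinearMap.extendOfNorm e with hΛ
    set v := (InnerProductSpace.toDual ℂ (Lp ℂ 2 (volume : Measure V))).symm Λ with hv
    refine ⟨star v, ?_, ?_⟩
    · have hstar : ‖star v‖ ≤ ‖v‖ := Lp.norm_le_norm_of_ae_le <| by
        filter_upwards [Lp.coeFn_star v] with x hx
        rw [hx, Pi.star_apply, norm_star]
      refine hstar.trans ?_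
      rw [hv, LinearIsometryEquiv.norm_map]
      exact LinearMap.opNorm_extendOfNorm_le hdense (by positivity) fun φ => hB f φ
    · ext φ
      rw [Lp.toTemperedDistribution_apply]
      have h1 : Λ (e φ) = B f φ := LinearMap.extendOfNorm_eq hdense ⟨_, fun φ => hB f φ⟩ φ
      rw [← h1, ← InnerProductSpace.toDual_symm_apply, L2.inner_def]
      refine integral_congr_ae ?_
      filter_upwards [Lp.coeFn_star v, SchwartzMap.coeFn_toLp φ 2 volume] with x hx hx'
      change _ = inner ℂ (v x) (φ.toLp 2 volume x)
      rw [hx, hx']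
      rfl
  choose u hu hu' using key
  -- An `L²` function is determined by its distribution, so the chosen `u f` depends linearly on
  -- `f`.
  have hinj : Function.Injective
      (Lp.toTemperedDistributionCLM ℂ (volume : Measure V) 2) :=
    LinearMap.ker_eq_bot.1 Lp.ker_toTemperedDistributionCLM_eq_bot
  let U : 𝓢(V, ℂ) →ₗ[ℂ] Lp ℂ 2 (volume : Measure V) :=
    { toFun := u
      map_add' := fun f f' => hinj <| by
        rw [map_add]
        change Lp.toTemperedDistribution _ = Lp.toTemperedDistribution _ +
          Lp.toTemperedDistribution _
        rw [hu', hu', hu', map_add]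
      map_smul' := fun c f => hinj <| by
        rw [map_smul]
        change Lp.toTemperedDistribution _ = c • Lp.toTemperedDistribution _
        rw [hu', hu', map_smul] }
  refine ⟨U.extendOfNorm e, LinearMap.opNorm_extendOfNorm_le hdense hD hu, fun f => ?_⟩
  have h1 : U.extendOfNorm e (e f) = U f := LinearMap.extendOfNorm_eq hdense ⟨D, hu⟩ f
  rw [← hu' f]
  exact congrArg _ h1

end SquareIntegrable

/-! ### The Calderón–Vaillancourt bound -/

section Bounded

variable {n : ℕ} {ħ : ℝ} {hħ : 0 < ħ}

/-- The Weyl operator on Schwartz functions, as a linear map. -/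
noncomputable def weylLinear (hħ : 0 < ħ) (A : 𝓢'(Phase n, ℂ)) :
    𝓢(Rn n, ℂ) →ₗ[ℂ] 𝓢'(Rn n, ℂ) where
  toFun := weylOp ħ hħ A
  map_add' f f' := by
    ext φ
    have h : tensor (f + f') φ = tensor f φ + tensor f' φ := by
      ext z
      exact add_mul _ _ _
    change A (wigner ħ hħ (f + f') φ) = A (wigner ħ hħ f φ) + A (wigner ħ hħ f' φ)
    rw [← map_add]
    congr 1
    simp only [wigner, smul_apply, ContinuousLinearMap.comp_apply, h, map_add, smul_add]
  map_smul' c f := by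
    ext φ
    have h : tensor (c • f) φ = c • tensor f φ := by
      ext z
      exact mul_assoc _ _ _
    change A (wigner ħ hħ (c • f) φ) = c • A (wigner ħ hħ f φ)
    rw [← map_smul]
    congr 1
    simp only [wigner, smul_apply, ContinuousLinearMap.comp_apply, h, map_smul]
    rw [smul_comm]

/-- Cauchy–Schwarz in the double expansion of `⟨A^w f, φ⟩`: the coefficients of `φ` are measured by
Plancherel, the transformed coefficients of `f` by Young's inequality with `q = 2`. -/
theorem enorm_weylOp_le {A : 𝓢'(Phase n, ℂ)} {g : 𝓢(Rn n, ℂ)} (hg : g ≠ 0) (f φ : 𝓢(Rn n, ℂ)) :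
    ‖weylOp ħ hħ A f φ‖ₑ ≤ ‖invEnergy (conjS g)‖ₑ * ENNReal.ofReal (√(energy (conjS g))) *
      ‖invEnergy g‖ₑ * ENNReal.ofReal (√(energy g)) * (∫⁻ u, kernelBound hħ 0 A g u) *
      ‖f.toLp 2 volume‖ₑ * ‖φ.toLp 2 volume‖ₑ := by
  set G := weylTransform hħ A g (f : 𝓢'(Rn n, ℂ)) with hG
  have hGn : eLpNorm G 2 volume ≤ ‖invEnergy g‖ₑ * (∫⁻ u, kernelBound hħ 0 A g u) *
      (ENNReal.ofReal (√(energy g)) * ‖f.toLp 2 volume‖ₑ) := by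
    rw [← modNorm_zero_two_coe]
    refine le_trans (le_of_eq ?_) (eLpNorm_weylTransform_le le_rfl one_le_two _)
    refine eLpNorm_congr_enorm_ae (.of_forall fun w => ?_)
    rw [eweight_zero, one_mul, enorm_enorm]
  have hH : ‖∫ w, coef (conjS g) φ w * G w‖ₑ ≤
      eLpNorm (coef (conjS g) φ) 2 volume * eLpNorm G 2 volume := by
    exact enorm_integral_mul_le (coef (conjS g) φ).continuous.aestronglyMeasurable
      (measurable_weylTransform hħ A g _).aestronglyMeasurable
  rw [weylOp_eq_integral hg, enorm_mul]
  rw [eLpNorm_coef_two] at hH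
  calc _ ≤ ‖invEnergy (conjS g)‖ₑ * (ENNReal.ofReal (√(energy (conjS g))) *
        ‖φ.toLp 2 volume‖ₑ * (‖invEnergy g‖ₑ * (∫⁻ u, kernelBound hħ 0 A g u) *
      (ENNReal.ofReal (√(energy g)) * ‖f.toLp 2 volume‖ₑ))) := by
        gcongr
        exact hH.trans (by gcongr)
    _ = _ := by ring

theorem exists_clm_weylOp (hħ : 0 < ħ) : ∃ C : ℝ, 0 < C ∧ ∀ a : Phase n → ℂ,
    ContDiff ℝ (2 * n + 1 : ℕ) a →
      ∀ K : ℝ, (∀ k ≤ 2 * n + 1, ∀ z, ‖iteratedFDeriv ℝ k a z‖ ≤ K) →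
        ∀ A : 𝓢'(Phase n, ℂ), (∀ f : 𝓢(Phase n, ℂ), A f = ∫ z, f z * a z) →
          ∃ T : Lp ℂ 2 (volume : Measure (Rn n)) →L[ℂ] Lp ℂ 2 (volume : Measure (Rn n)),
            ‖T‖ ≤ C * K ∧ ∀ f : 𝓢(Rn n, ℂ),
              Lp.toTemperedDistribution (T (f.toLp 2 volume)) = weylOp ħ hħ A f := by
  obtain ⟨g, hg⟩ := exists_schwartz_ne_zero (Rn n)
  obtain ⟨C₁, hC₁⟩ := exists_lintegral_kernelBound (n := n) hħ 0
  -- Here the number of derivatives is used: `2n + 1` is the least integer above the dimension `2n`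
  -- of phase space.
  have hdim : Module.finrank ℝ (Phase n) < 2 * n + 1 := by
    rw [(WithLp.linearEquiv 2 ℝ (Rn n × Rn n)).finrank_eq, Module.finrank_prod,
      finrank_euclideanSpace_fin]
    lia
  obtain ⟨C₂, hC₂⟩ := exists_symbolNorm_le_of_contDiff (phaseWindow hħ g) hdim
  set c := ‖invEnergy (conjS g)‖ₑ * ENNReal.ofReal (√(energy (conjS g))) *
      ‖invEnergy g‖ₑ * ENNReal.ofReal (√(energy g)) with hc
  have hfin : c * (C₁ * C₂) < ⊤ := ENNReal.mul_lt_top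
    (ENNReal.mul_lt_top (ENNReal.mul_lt_top (ENNReal.mul_lt_top enorm_lt_top
      ENNReal.ofReal_lt_top) enorm_lt_top) ENNReal.ofReal_lt_top)
    (ENNReal.mul_lt_top ENNReal.coe_lt_top ENNReal.coe_lt_top)
  set C := (c * (C₁ * C₂)).toReal + 1 with hCdef
  have hC : 0 < C := by positivity
  refine ⟨C, hC, fun a ha K hK A hA => ?_⟩
  have hK0 : 0 ≤ K := (norm_nonneg _).trans (hK 0 (Nat.zero_le _) 0)
  refine exists_clm_of_bound (mul_nonneg hC.le hK0) (weylLinear hħ A) fun f φ => ?_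
  have h : ‖weylOp ħ hħ A f φ‖ₑ ≤
      ENNReal.ofReal (C * K * ‖f.toLp 2 volume‖ * ‖φ.toLp 2 volume‖) := by
    refine (enorm_weylOp_le hg f φ).trans ?_
    rw [ENNReal.ofReal_mul (by positivity), ENNReal.ofReal_mul (by positivity),
      ofReal_norm, ofReal_norm, ENNReal.ofReal_mul hC.le]
    refine mul_le_mul_left (mul_le_mul_left ?_ _) _
    calc c * ∫⁻ u, kernelBound hħ 0 A g u ≤ c * (C₁ * (C₂ * ENNReal.ofReal K)) := by
          refine mul_le_mul_right ((hC₁ A g).trans (mul_le_mul_right ?_ _)) _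
          exact hC₂ a ha K hK A hA
      _ = c * (C₁ * C₂) * ENNReal.ofReal K := by ring
      _ ≤ _ := by
          refine mul_le_mul_left ?_ _
          rw [← ENNReal.ofReal_toReal hfin.ne]
          exact ENNReal.ofReal_le_ofReal (by linarith)
  rw [← ofReal_norm] at h
  exact (ENNReal.ofReal_le_ofReal_iff (by positivity)).1 h

end Bounded

end WeylModulation

open WeylModulation
theorem mainTheorem3 (n : ℕ) (ħ : ℝ) (hħ : 0 < ħ) :
    (∀ s : ℝ, 0 ≤ s → ∀ Φ : 𝓢(Phase n, ℂ), Φ ≠ 0 → ∀ φ : 𝓢(Rn n, ℂ), φ ≠ 0 →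
      ∃ C : ℝ≥0, 0 < C ∧ ∀ A : 𝓢'(Phase n, ℂ), MemSymbol s A →
        ∀ q : ℝ≥0∞, 1 ≤ q →
          ∃ T : 𝓢'(Rn n, ℂ) →ₗ.[ℂ] 𝓢'(Rn n, ℂ), IsWeylOperatorOn ħ hħ A s q T ∧
            ∀ ψ : T.domain, modNorm s q φ (T ψ) ≤
              C * symbolNorm s Φ A * modNorm s q φ (ψ : 𝓢'(Rn n, ℂ))) ∧
    (∃ C : ℝ, 0 < C ∧ ∀ a : Phase n → ℂ, ContDiff ℝ (2 * n + 1 : ℕ) a →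
      ∀ K : ℝ, (∀ k ≤ 2 * n + 1, ∀ z, ‖iteratedFDeriv ℝ k a z‖ ≤ K) →
        ∀ A : 𝓢'(Phase n, ℂ), (∀ f : 𝓢(Phase n, ℂ), A f = ∫ z, f z * a z) →
          ∃ T : Lp ℂ 2 (volume : Measure (Rn n)) →L[ℂ] Lp ℂ 2 (volume : Measure (Rn n)),
            ‖T‖ ≤ C * K ∧ ∀ f : 𝓢(Rn n, ℂ),
              Lp.toTemperedDistribution (T (f.toLp 2 volume)) = weylOp ħ hħ A f) := by
  exact ⟨fun s hs Φ hΦ φ hφ => exists_weylOperatorOn_bound hħ hs hΦ hφ, exists_clm_weylOp hħ⟩
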